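/- Let $g_2,g_3\in\mathbb C[u]$ be polynomials of degree at most $2$ and $3$ such that the discriminant $g_2^3-27g_3^2$ has degree $N_f+2$ for some integer $N_f\ge 0$. They define the elliptic surface with fibres $E_u:\ y^2=4x^3-g_2(u)x-g_3(u)$. Let $\mathring{\mathrm{UP}}=\{u\in\mathbb C: g_2(u)^3-27g_3(u)^2\neq0\}$ be the punctured $u$-plane. For $u\in\mathring{\mathrm{UP}}$ let $\Lambda_u\subset\mathbb C$ be the lattice of periods of $dx/y$ on $E_u$, and identify $E_u$ with $\mathbb C/\Lambda_u$ so that $dx/y=dz$. Let $\Delta=-4\partial_z\partial_{\bar z}$ be the Laplace operator on $E_u$, and let $\zeta_u(s)=\sum_{\mu>0}m(\mu)\mu^{-s}$ ($\operatorname{Re}s>1$) be its spectral zeta function, the sum running over the positive eigenvalues $\mu$ with multiplicities $m(\mu)$. Set $\det{}'\Delta=\exp(-\zeta_u'(0))$ and $F^{(1)}(u)=-\tfrac12\log\det{}'\Delta$. Let $\lambda=du\wedge dx/y$ and let $\Omega=\int_{E_u}\lambda\wedge\bar\lambda=i\,h\,du\wedge d\bar u$ be the special Kähler form on $\mathring{\mathrm{UP}}$,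 where $h=2\operatorname{vol}(E_u)$. For a constant $c>0$ (which accounts for the different conventions relating a Kähler form to a Riemannian metric; e.g. $c=2$ gives $\Omega(\cdot,J\cdot)$) let $g_c=c\,h\,|du|^2$ be the associated Riemannian metric, $S_c$ its scalar curvature and $\Delta_{\mathrm{UP},c}$ its Laplace–Beltrami operator. Then $\zeta_u$ extends meromorphically to $\mathbb C$ and is regular at $0$ for every $u\in\mathring{\mathrm{UP}}$, the function $F^{(1)}$ is smooth on $\mathring{\mathrm{UP}}$, and for every $c>0$ $$\Delta_{\mathrm{UP},c}\,F^{(1)}=S_c\qquad\text{on }\mathring{\mathrm{UP}}.$$ Moreover, near each point of $\mathring{\mathrm{UP}}$ there are holomorphic functions $a,a_D$ such that $2\,da/du,\ 2\,da_D/du$ is a basis of $\Lambda_u$ and $\tau=da_D/da$ has positive imaginary part. For all such $a,a_D$ on an open subset of $\mathring{\mathrm{UP}}$ one has there $$\Omega=8i\operatorname{Im}\tau\,da\wedge d\bar a,\qquad \Delta_{\mathrm{UP},c}=\frac1{2c\operatorname{Im}\tau}\,\partial_a\partial_{\bar a},\qquad S_c=\frac1{8c\,(\operatorname{Im}\tau)^3}\left|\frac{\partial\tau}{\partial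 a}\right|^2,$$ so that the equation is the holomorphic anomaly equation $\partial_a\partial_{\bar a}F^{(1)}=\frac1{4(\operatorname{Im}\tau)^2}\left|\frac{\partial\tau}{\partial a}\right|^2$. In particular, for $c=\tfrac12$ it reads $\frac1{\operatorname{Im}\tau}\partial_a\partial_{\bar a}F^{(1)}=S_{1/2}$. -/

import Mathlib

open Complex
open scoped ContDiff

noncomputable section

/-! ### Wirtinger derivatives -/

/-- The Wirtinger derivative `∂f/∂u = (∂f/∂x - i ∂f/∂y)/2`, where `u = x + i y`. -/
def wirtinger (f : ℂ → ℂ) (u : ℂ) : ℂ :=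
  (fderiv ℝ f u 1 - I * fderiv ℝ f u I) / 2

/-- The Wirtinger derivative `∂f/∂ū = (∂f/∂x + i ∂f/∂y)/2`, where `u = x + i y`. -/
def wirtingerBar (f : ℂ → ℂ) (u : ℂ) : ℂ :=
  (fderiv ℝ f u 1 + I * fderiv ℝ f u I) / 2

/-- The derivative `∂f/∂a` with respect to a local holomorphic coordinate `a = a(u)`. -/
def coordDeriv (a : ℂ → ℂ) (f : ℂ → ℂ) (u : ℂ) : ℂ :=
  wirtinger f u / deriv a u

/-- The derivative `∂f/∂ā` with respect to a local holomorphic coordinate `a = a(u)`. -/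
def coordDerivBar (a : ℂ → ℂ) (f : ℂ → ℂ) (u : ℂ) : ℂ :=
  wirtingerBar f u / (starRingEnd ℂ) (deriv a u)

/-! ### Riemannian metrics on plane domains

A Riemannian metric on a domain of the `u`-plane, `u = x¹ + i x²`, is given by its component
matrix `g u i j` with respect to the real coordinates `x¹, x²`. -/

/-- The partial derivative of a real function in the direction of the `i`-th real coordinate. -/
def partialDeriv (i : Fin 2) (f : ℂ → ℝ) (u : ℂ) : ℝ :=
  fderiv ℝ f u ((![1, I] : Fin 2 → ℂ) i)

/-- The Christoffel symbols `Γ^k_{ij}` of the Levi-Civita connection of `g`. -/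
def christoffel (g : ℂ → Matrix (Fin 2) (Fin 2) ℝ) (k i j : Fin 2) (u : ℂ) : ℝ :=
  (1 / 2) * ∑ l, (g u)⁻¹ k l *
    (partialDeriv i (fun v ↦ g v j l) u + partialDeriv j (fun v ↦ g v i l) u
      - partialDeriv l (fun v ↦ g v i j) u)

/-- The Ricci tensor
`R_{jk} = ∂_i Γ^i_{jk} - ∂_j Γ^i_{ik} + Γ^i_{ip} Γ^p_{jk} - Γ^i_{jp} Γ^p_{ik}` of `g`. -/
def ricci (g : ℂ → Matrix (Fin 2) (Fin 2) ℝ) (j k : Fin 2) (u : ℂ) : ℝ :=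
  ∑ i, (partialDeriv i (christoffel g i j k) u - partialDeriv j (christoffel g i i k) u
    + ∑ p, (christoffel g i i p u * christoffel g p j k u
      - christoffel g i j p u * christoffel g p i k u))

/-- The scalar curvature `g^{jk} R_{jk}` of `g` (equal to `2` for the unit sphere). -/
def scalarCurvature (g : ℂ → Matrix (Fin 2) (Fin 2) ℝ) (u : ℂ) : ℝ :=
  ∑ j, ∑ k, (g u)⁻¹ j k * ricci g j k u

/-- The Laplace-Beltrami operator `(det g)^{-1/2} ∂_i ((det g)^{1/2} g^{ij} ∂_j f)` of `g`. -/
def laplaceBeltrami (g : ℂ → Matrix (Fin 2) (Fin 2) ℝ) (f : ℂ → ℝ) (u : ℂ) : ℝ :=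
  (1 / Real.sqrt (g u).det) * ∑ i, partialDeriv i
    (fun v ↦ Real.sqrt (g v).det * ∑ j, (g v)⁻¹ i j * partialDeriv j f v) u

/-! ### The regularized determinant of the Laplacian on `ℂ / Λ` -/

/-- The eigenspace of the Laplace operator `-4 ∂_z ∂_z̄ = -(∂_x² + ∂_y²)`, acting on smooth complex
functions on `ℂ / Λ` (smooth `Λ`-periodic functions on `ℂ`), for the eigenvalue `μ`. -/
def laplaceEigenspace (Λ : Set ℂ) (μ : ℝ) : Submodule ℂ (ℂ → ℂ) where
  carrier := {f | ContDiff ℝ ∞ f ∧ (∀ ℓ ∈ Λ, ∀ z, f (z + ℓ) = f z) ∧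
    ∀ z, -(Laplacian.laplacian f z) = (μ : ℂ) * f z}
  zero_mem' := by
    refine ⟨contDiff_const, fun _ _ _ ↦ rfl, fun z ↦ ?_⟩
    have h : (0 : ℂ → ℂ) = fun _ ↦ 0 := rfl
    rw [h, InnerProductSpace.laplacian_eq_iteratedFDeriv_complexPlane]
    simp
  add_mem' := by
    rintro f g ⟨hf, pf, ef⟩ ⟨hg, pg, eg⟩
    refine ⟨hf.add hg, fun ℓ hℓ z ↦ by simp [pf ℓ hℓ z, pg ℓ hℓ z], fun z ↦ ?_⟩
    have h2 : (2 : WithTop ℕ∞) ≤ ∞ := WithTop.coe_le_coe.2 le_top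
    rw [((hf.of_le h2).contDiffAt).laplacian_add ((hg.of_le h2).contDiffAt), neg_add, ef, eg]
    simp [mul_add]
  smul_mem' := by
    rintro c f ⟨hf, pf, ef⟩
    refine ⟨contDiff_const.smul hf, fun ℓ hℓ z ↦ by simp [pf ℓ hℓ z], fun z ↦ ?_⟩
    have h2 : (2 : WithTop ℕ∞) ≤ ∞ := WithTop.coe_le_coe.2 le_top
    rw [InnerProductSpace.laplacian_smul c ((hf.of_le h2).contDiffAt), ← smul_neg, ef]
    simp [mul_left_comm]

/-- `Z` is the spectral zeta function of the Laplace operator on `ℂ / Λ`: for `Re s > 1` it is the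
absolutely convergent sum of `m(μ) μ^{-s}` over the eigenvalues `μ > 0` with their (finite)
multiplicities `m(μ)`, and it is meromorphic on `ℂ` and regular at `0`.
A positive number that is not an eigenvalue has multiplicity `0`. -/
structure IsSpectralZeta (Λ : Set ℂ) (Z : ℂ → ℂ) : Prop where
  finite_multiplicity : ∀ μ : ℝ, 0 < μ → FiniteDimensional ℂ (laplaceEigenspace Λ μ)
  hasSum : ∀ s : ℂ, 1 < s.re → HasSum
    (fun μ : Set.Ioi (0 : ℝ) ↦
      (Module.finrank ℂ (laplaceEigenspace Λ μ) : ℂ) * ((μ : ℝ) : ℂ) ^ (-s)) (Z s)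
  meromorphic : MeromorphicOn Z Set.univ
  analyticAt_zero : AnalyticAt ℂ Z 0

open Classical in
/-- The zeta-regularized determinant `det'Δ = exp (-Z'(0))` of the Laplace operator on `ℂ / Λ`,
with the zero eigenvalue removed. (Any two functions `Z` as above agree near `0`.) -/
def regularizedDet (Λ : Set ℂ) : ℝ :=
  if h : ∃ Z, IsSpectralZeta Λ Z then Real.exp (-(deriv h.choose 0).re) else 0

/-! ### Weierstrass fibrations over the `u`-plane -/

/-- A `C¹` loop in the smooth affine curve `y² = 4x³ - g₂x - g₃`, parametrized by `ℝ / ℤ`. Here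
`w dt` is the pull-back of the holomorphic one-form `dx / y = dy / (6x² - g₂/2)`. -/
structure WeierstrassLoop (g₂ g₃ : ℂ) where
  x : ℝ → ℂ
  y : ℝ → ℂ
  w : ℝ → ℂ
  periodic_x : Function.Periodic x 1
  periodic_y : Function.Periodic y 1
  continuous_w : Continuous w
  on_curve : ∀ t, y t ^ 2 = 4 * x t ^ 3 - g₂ * x t - g₃
  deriv_x : ∀ t, HasDerivAt x (w t * y t) t
  deriv_y : ∀ t, HasDerivAt y (w t * (6 * x t ^ 2 - g₂ / 2)) t

/-- The period lattice of `dx / y` on the curve `y² = 4x³ - g₂x - g₃`: the set of its integrals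
over closed loops. (The point at infinity may be avoided, as loops can be moved off it.) -/
def periodLattice (g₂ g₃ : ℂ) : Set ℂ :=
  Set.range fun γ : WeierstrassLoop g₂ g₃ ↦ ∫ t in (0 : ℝ)..1, γ.w t

/-- The Weierstrass data of a Jacobian rational elliptic surface `y² = 4x³ - g₂(u)x - g₃(u)` over
the `u`-plane, with discriminant of degree `N_f + 2`. -/
structure SeibergWittenCurve (Nf : ℕ) where
  g₂ : Polynomial ℂ
  g₃ : Polynomial ℂ
  natDegree_g₂ : g₂.natDegree ≤ 2
  natDegree_g₃ : g₃.natDegree ≤ 3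
  natDegree_disc : (g₂ ^ 3 - 27 * g₃ ^ 2).natDegree = Nf + 2

namespace SeibergWittenCurve

variable {Nf : ℕ} (C : SeibergWittenCurve Nf)

/-- The punctured `u`-plane, over which the fibres are smooth. -/
def puncturedPlane : Set ℂ :=
  {u | (C.g₂ ^ 3 - 27 * C.g₃ ^ 2).eval u ≠ 0}

/-- The lattice of periods of `dx / y` on the fibre `E_u`. -/
def periods (u : ℂ) : Set ℂ :=
  periodLattice (C.g₂.eval u) (C.g₃.eval u)

/-- `F⁽¹⁾ = -½ log det'Δ`, where `Δ` is the Laplace operator on the fibre `E_u`, identified with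
`ℂ / periods u` in such a way that `dx / y` becomes `dz`. -/
def F1 (u : ℂ) : ℝ :=
  -(1 / 2) * Real.log (regularizedDet (C.periods u))

/-- The area of the fibre `E_u`, i.e. the integral of `(i/2) (dx/y) ∧ conj (dx/y)` over `E_u`. -/
def fibreArea (u : ℂ) : ℝ :=
  ZLattice.covolume (Submodule.span ℤ (C.periods u))

/-- The density `h` of the Kähler form `Ω = ∫_{E_u} λ ∧ conj λ = i h du ∧ dū`, where
`λ = du ∧ dx/y`. As `dz ∧ dz̄ = -2i dA` on the fibre, `h` is twice the area of the fibre. -/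
def kaehlerDensity (u : ℂ) : ℝ :=
  2 * C.fibreArea u

/-- The components of the Riemannian metric `c h |du|²` that belongs to `Ω = i h du ∧ dū`. The
constant `c > 0` stands for the convention that relates Kähler forms and metrics; common choices are
`c = 1`, and `c = 2` for the metric `Ω(·, J ·)`. -/
def kaehlerMetric (c : ℝ) (u : ℂ) : Matrix (Fin 2) (Fin 2) ℝ :=
  (c * C.kaehlerDensity u) • (1 : Matrix (Fin 2) (Fin 2) ℝ)

/-- Local special coordinates: holomorphic functions `a`, `aD` on an open subset `U` of the
punctured `u`-plane such that `2ω = 2 da/du` and `2ω' = 2 daD/du` form an oriented basis of the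
period lattice of each fibre. -/
structure IsSpecialChart (U : Set ℂ) (a aD : ℂ → ℂ) : Prop where
  isOpen : IsOpen U
  subset : U ⊆ C.puncturedPlane
  differentiableOn_a : DifferentiableOn ℂ a U
  differentiableOn_aD : DifferentiableOn ℂ aD U
  periods_eq : ∀ u ∈ U, C.periods u =
    Set.range fun n : ℤ × ℤ ↦ n.1 * (2 * deriv a u) + n.2 * (2 * deriv aD u)
  im_pos : ∀ u ∈ U, 0 < (deriv aD u / deriv a u).im

end SeibergWittenCurve

/-- The modular parameter `τ = daD/da = ω'/ω`. -/
def modularParameter (a aD : ℂ → ℂ) (u : ℂ) : ℂ :=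
  deriv aD u / deriv a u

end

/-!
Both sides of the anomaly equation equal `|dτ/du|² / ((Im τ)² ρ)`, where `ρ` is the density of the
metric and `τ` is the modular parameter of the fibre. Three computations lead to this.

**Periods.** By `exists_scaledPair_invariants` (the `j`-invariant takes every value) the fibre
`y² = 4x³ - g₂x - g₃` belongs to a lattice `L = ℤ l + ℤ l τ` with `g₂(L) = g₂` and `g₃(L) = g₃`.
Loops on the curve lift along `(℘, ℘')` to paths in `ℂ` that end at a lattice translate of the starting
point, so the set of periods of `dx / y` is exactly `L` (`PeriodPair.periodLattice_eq`). The map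
`(l, τ) ↦ (g₂, g₃)` between open subsets of `ℂ²` is holomorphic, and its derivative is invertible:
if the curve moves by `ε`, the two loops that represent the basis can be deformed into it so that
their periods move by `O(ε)` (`exists_deformed_period`), and discreteness of the lattice identifies
the new periods with the new basis (`latticeInvariants_antilipschitz`). The inverse function theorem
then yields periods that are holomorphic in `u` (`exists_local_periods`), and half of these have
the special coordinates `a`, `a_D` as primitives.

**The determinant.** Fourier analysis on `ℂ / L` shows that each eigenspace for a positive
eigenvalue is spanned by characters (`laplaceEigenspace_eq_span`), with eigenvalues
`4π² |n + mτ|² / (|l| Im τ)²`. The spectral zeta function is therefore an Epstein zeta function.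
Poisson summation in `n` alone writes it in terms of the Riemann zeta function and of the Mellin
transform of a kernel that decays rapidly at `0` and at `∞`; this gives its meromorphic continuation
(`hasSum_epsteinZeta`). At `s = 0` the Mellin transform is a sum of elementary integrals
(`integral_bessel`), equal to the real part of a holomorphic function of `τ`. This is Kronecker's
limit formula, and it says that, for `F⁽¹⁾ = -½ log det'Δ`,
`F⁽¹⁾ = -log (Im τ) - log |l| + c₀ + c₁ Im τ + Re Φ(τ)` with constants `c₀`, `c₁` and a holomorphic
function `Φ` (`neg_half_log_regularizedDet`). As `l` and `τ` are holomorphic in `u`, all terms but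
the first are harmonic.

**Curvature.** In a special coordinate `a`, the fibre has area `|2 da/du|² Im τ`
(`covolume_latticeSet`), so `ρ = 8 c Im τ |da/du|²`. For a conformal metric `ρ |du|²` the
Laplace-Beltrami operator is `ρ⁻¹ Δ` and the scalar curvature is `-ρ⁻¹ Δ log ρ`
(`scalarCurvature_smul_one`). Since `log |da/du|` is harmonic, `-Δ log ρ = -Δ log (Im τ)`, which is
also `Δ F⁽¹⁾`. Its value is `|dτ/du|² / (Im τ)²` (`laplacian_log_im`).
-/


/-! ### Level one Eisenstein series and the lattice invariants -/

section Modular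

open UpperHalfPlane ModularForm ModularFormClass MatrixGroups EisensteinSeries Filter Asymptotics
open scoped Topology

theorem tendsto_E_atImInfty {k : ℕ} (hk : 3 ≤ k) (hk2 : Even k) :
    Tendsto (E hk) atImInfty (𝓝 1) := by
  have hval : valueAtInfty (E hk) = 1 := by
    rw [← E_qExpansion_coeff_zero hk hk2,
      UpperHalfPlane.qExpansion_coeff_zero one_pos
      (ModularFormClass.analyticAt_cuspFunction_zero (E hk) one_pos one_mem_strictPeriods_SL)
      (SlashInvariantFormClass.periodic_comp_ofComplex (E hk) one_mem_strictPeriods_SL)]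
  obtain ⟨c, hc, h⟩ := ModularFormClass.exp_decay_sub_atImInfty' (E hk)
  rw [hval] at h
  have h0 : Tendsto (fun τ : ℍ ↦ Real.exp (-c * τ.im)) atImInfty (𝓝 0) := by
    refine Real.tendsto_exp_atBot.comp ?_
    exact (tendsto_comap (f := UpperHalfPlane.im)).const_mul_atTop_of_neg (by linarith)
  simpa using (h.trans_tendsto h0).add_const 1

/-- The `j`-invariant takes every value: otherwise `Δ / (p E₄³ - q Δ)` would be a nonzero modular
form of weight `0` vanishing at the cusp. -/
theorem exists_mul_E₄_cube_eq_mul_discriminant {p : ℂ} (hp : p ≠ 0) (q : ℂ) :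
    ∃ τ : ℍ, p * E₄ τ ^ 3 = q * discriminant τ := by
  by_contra! hne
  let f : ModularForm 𝒮ℒ 12 := p • ModularForm.mcast (by decide) (E₄.pow 3) -
    q • (CuspForm.discriminant : ModularForm 𝒮ℒ 12)
  have hf (z : ℍ) : f z = p * E₄ z ^ 3 - q * discriminant z := by
    have h1 : (E₄.pow 3) z = E₄ z ^ 3 := by rw [ModularForm.coe_pow]; rfl
    simp [f, coe_mcast, h1]
  have hf0 (z : ℍ) : f z ≠ 0 := by rw [hf]; exact sub_ne_zero.2 (hne z)
  have hΔ : Tendsto discriminant atImInfty (𝓝 0) := discriminant_isZeroAtImInfty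
  have hflim : Tendsto f atImInfty (𝓝 p) := by
    have := (((tendsto_E_atImInfty (by norm_num : 3 ≤ 4) ⟨2, rfl⟩).pow 3).const_mul p).sub
      (hΔ.const_mul q)
    simp only [one_pow, mul_one, mul_zero, sub_zero] at this
    exact this.congr fun z ↦ (hf z).symm
  have hglim : Tendsto (fun z ↦ discriminant z / f z) atImInfty (𝓝 0) := by
    have := hΔ.div hflim hp
    rwa [zero_div] at this
  have hslash (γ : SL(2, ℤ)) :
      (fun z ↦ discriminant z / f z) ∣[(0 : ℤ)] γ = fun z ↦ discriminant z / f z := by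
    have hγ : (γ : GL (Fin 2) ℝ) ∈ 𝒮ℒ := ⟨γ, rfl⟩
    change (⇑CuspForm.discriminant / ⇑f) ∣[(12 - 12 : ℤ)] γ = ⇑CuspForm.discriminant / ⇑f
    simp_rw [div_slash_SL2, SL_slash, SlashInvariantFormClass.slash_action_eq _ _ hγ]
  let g : ModularForm 𝒮ℒ 0 :=
    { toFun z := discriminant z / f z
      slash_action_eq' := fun _ ⟨γ, hγ⟩ ↦ hγ ▸ hslash γ
      holo' := CuspForm.discriminant.holo'.div f.holo' hf0
      bdd_at_cusps' {c} hc := by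
        rw [Subgroup.IsArithmetic.isCusp_iff_isCusp_SL2Z] at hc
        rw [OnePoint.isBoundedAt_iff_forall_SL2Z hc]
        intro γ _
        rw [hslash γ, IsBoundedAtImInfty, BoundedAtFilter]
        exact hglim.isBigO_one ℝ }
  obtain ⟨c, hc⟩ := ModularFormClass.levelOne_weight_zero_const g
  have hg (z : ℍ) : discriminant z / f z = c := congrFun hc z
  have hc0 : c = 0 := by
    refine tendsto_nhds_unique ?_ hglim
    simp_rw [hg]
    exact tendsto_const_nhds
  have := hg UpperHalfPlane.I
  rw [hc0, div_eq_zero_iff] at this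
  exact this.elim (discriminant_ne_zero _) (hf0 _)

/-- The periods `l, l τ`. -/
noncomputable def scaledPair (l : ℂ) (hl : l ≠ 0) (τ : ℂ) (hτ : 0 < τ.im) : PeriodPair where
  ω₁ := l
  ω₂ := l * τ
  indep := by
    rw [LinearIndependent.pair_iff]
    intro s t h
    have h1 : (s : ℂ) + t * τ = 0 := by
      have : l * ((s : ℂ) + t * τ) = 0 := by
        rw [← h]; simp only [real_smul]; ring
      exact (mul_eq_zero.1 this).resolve_left hl
    have h2 := congrArg Complex.im h1
    simp at h2
    have ht : t = 0 := h2.resolve_right hτ.ne'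
    subst ht
    have h3 := congrArg Complex.re h1
    simp at h3
    exact ⟨h3, rfl⟩

theorem mem_scaledPair_lattice {l : ℂ} {hl : l ≠ 0} {τ : ℂ} {hτ : 0 < τ.im} {z : ℂ} :
    z ∈ (scaledPair l hl τ hτ).lattice ↔ ∃ m n : ℤ, m * l + n * (l * τ) = z :=
  PeriodPair.mem_lattice

theorem scaledPair_G (l : ℂ) (hl : l ≠ 0) (τ : ℍ) {k : ℕ} (hk : 3 ≤ k) :
    (scaledPair l hl τ τ.im_pos).G k = (l ^ k)⁻¹ * (2 * riemannZeta k * E hk τ) := by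
  rw [PeriodPair.G, ← (scaledPair l hl τ τ.im_pos).latticeEquivProd.symm.toEquiv.tsum_eq]
  have h1 : 2 * riemannZeta k * E hk τ = ∑' v : Fin 2 → ℤ, eisSummand k v τ := by
    rw [tsum_eisSummand_eq_riemannZeta_mul_eisensteinSeries hk τ,
      show E hk τ = (1 / 2 : ℂ) • eisensteinSeriesSIF (N := 1) 0 k τ from rfl,
      eisensteinSeriesSIF_apply 0 k τ, smul_eq_mul]
    ring
  rw [h1, ← tsum_mul_left, ← ((Equiv.prodComm ℤ ℤ).trans (finTwoArrowEquiv ℤ).symm).tsum_eq]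
  refine tsum_congr fun x ↦ ?_
  simp only [LinearEquiv.coe_toEquiv, PeriodPair.latticeEquiv_symm_apply]
  simp only [scaledPair, eisSummand, Equiv.trans_apply, Equiv.prodComm_apply, Prod.fst_swap,
    Prod.snd_swap, finTwoArrowEquiv_symm_apply]
  rw [zpow_neg, zpow_natCast, ← mul_inv, ← mul_pow]
  congr 2
  simp
  ring

theorem scaledPair_g₂ (l : ℂ) (hl : l ≠ 0) (τ : ℍ) :
    (scaledPair l hl τ τ.im_pos).g₂ = (l ^ 4)⁻¹ * (4 * Real.pi ^ 4 / 3 * E₄ τ) := by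
  rw [PeriodPair.g₂, scaledPair_G l hl τ (by norm_num : 3 ≤ 4)]
  have := riemannZeta_four
  push_cast
  rw [this]
  ring

theorem scaledPair_g₃ (l : ℂ) (hl : l ≠ 0) (τ : ℍ) :
    (scaledPair l hl τ τ.im_pos).g₃ = (l ^ 6)⁻¹ * (8 * Real.pi ^ 6 / 27 * E₆ τ) := by
  rw [PeriodPair.g₃, scaledPair_G l hl τ (by norm_num : 3 ≤ 6)]
  have : riemannZeta 6 = Real.pi ^ 6 / 945 := by
    have h := riemannZeta_two_mul_nat (k := 3) (by norm_num)
    have hb : bernoulli 6 = 1 / 42 := by decide +kernel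
    norm_num [hb, Nat.factorial] at h
    rw [h]; ring
  push_cast
  rw [this]
  ring

/-- Every nonsingular Weierstrass cubic is uniformized by a lattice. -/
theorem exists_scaledPair_invariants {A B : ℂ} (h : A ^ 3 - 27 * B ^ 2 ≠ 0) :
    ∃ (l : ℂ) (hl : l ≠ 0) (τ : ℍ),
      (scaledPair l hl τ τ.im_pos).g₂ = A ∧ (scaledPair l hl τ τ.im_pos).g₃ = B := by
  obtain ⟨τ, hτ⟩ := exists_mul_E₄_cube_eq_mul_discriminant h (1728 * A ^ 3)
  have hd := discriminant_eq_E₄_cube_sub_E₆_sq τ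
  have hd0 := discriminant_ne_zero τ
  set e := E₄ τ with he
  set f := E₆ τ with hf
  have hpi : (Real.pi : ℂ) ≠ 0 := ofReal_ne_zero.2 Real.pi_ne_zero
  set a := 4 * (Real.pi : ℂ) ^ 4 / 3 * e with ha
  set b := 8 * (Real.pi : ℂ) ^ 6 / 27 * f with hb
  suffices hs : ∃ l : ℂ, l ≠ 0 ∧ (l ^ 4)⁻¹ * a = A ∧ (l ^ 6)⁻¹ * b = B by
    obtain ⟨l, hl, h1, h2⟩ := hs
    exact ⟨l, hl, τ, by rw [scaledPair_g₂, ← he, h1], by rw [scaledPair_g₃, ← hf, h2]⟩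
  have hab : a ^ 3 * B ^ 2 = A ^ 3 * b ^ 2 := by
    have : e ^ 3 * (27 * B ^ 2) = A ^ 3 * f ^ 2 := by
      rw [hd] at hτ; linear_combination -hτ
    rw [ha, hb]
    linear_combination (64 / 27 / 27 : ℂ) * (Real.pi : ℂ) ^ 12 * this
  -- `l` is a sixth root if `A = 0`; otherwise it is a fourth root, which fixes `g₃` up to sign
  by_cases hA : A = 0
  · subst hA
    have hB : B ≠ 0 := by rintro rfl; simp at h
    have ha0 : a = 0 := by
      have : a ^ 3 * B ^ 2 = 0 := by rw [hab]; ring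
      simpa [hB] using this
    have hb0 : b ≠ 0 := by
      have he0 : e = 0 := by
        rw [ha] at ha0
        simpa [hpi] using ha0
      have : f ≠ 0 := by
        rintro h0
        rw [hd, he0, h0] at hd0
        simp at hd0
      rw [hb]
      exact mul_ne_zero (div_ne_zero (mul_ne_zero (by norm_num) (pow_ne_zero _ hpi)) (by norm_num)) this
    obtain ⟨l, hl⟩ := IsAlgClosed.exists_pow_nat_eq (b / B) (n := 6) (by norm_num)
    have hl0 : l ≠ 0 := by
      rintro rfl
      have : b / B ≠ 0 := div_ne_zero hb0 hB
      simp at hl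
      exact this hl.symm
    refine ⟨l, hl0, by rw [ha0, mul_zero], ?_⟩
    rw [hl]
    field_simp
  · have ha0 : a ≠ 0 := by
      have he0 : e ≠ 0 := by
        rintro h0
        rw [h0] at hτ
        simp [hA, hd0] at hτ
      rw [ha]
      exact mul_ne_zero (div_ne_zero (mul_ne_zero (by norm_num) (pow_ne_zero _ hpi)) (by norm_num)) he0
    obtain ⟨l, hl⟩ := IsAlgClosed.exists_pow_nat_eq (a / A) (n := 4) (by norm_num)
    have hl0 : l ≠ 0 := by
      rintro rfl
      have : a / A ≠ 0 := div_ne_zero ha0 hA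
      simp at hl
      exact this hl.symm
    have hsq : ((l ^ 6)⁻¹ * b) ^ 2 = B ^ 2 := by
      have h12 : l ^ 12 = (a / A) ^ 3 := by rw [← hl]; ring
      have : ((l ^ 6)⁻¹ * b) ^ 2 = (l ^ 12)⁻¹ * b ^ 2 := by
        rw [mul_pow, inv_pow]; ring_nf
      rw [this, h12]
      field_simp
      linear_combination -hab
    rcases sq_eq_sq_iff_eq_or_eq_neg.1 hsq with h1 | h1
    · refine ⟨l, hl0, by rw [hl]; field_simp, h1⟩
    · -- multiplication of `l` by `i` keeps `l ^ 4` and changes the sign of `l ^ 6`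
      refine ⟨Complex.I * l, mul_ne_zero I_ne_zero hl0, ?_, ?_⟩
      · rw [mul_pow, I_pow_four, one_mul, hl]; field_simp
      · rw [mul_pow, show Complex.I ^ 6 = -1 by
          rw [show 6 = 4 + 2 by norm_num, pow_add, I_pow_four, I_sq]; ring]
        rw [neg_one_mul, inv_neg, neg_mul, h1, neg_neg]

end Modular


/-! ### The Weierstrass uniformization -/

section Weierstrass

open Set Filter Topology PeriodPair

namespace PeriodPair

variable (L : PeriodPair)

theorem hasDerivAt_weierstrassP {z : ℂ} (hz : z ∉ L.lattice) :
    HasDerivAt ℘[L] (℘'[L] z) z := by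
  rw [← L.deriv_weierstrassP]
  exact (L.analyticOnNhd_weierstrassP z hz).differentiableAt.hasDerivAt

theorem tendsto_weierstrassP_cobounded {l : ℂ} (hl : l ∈ L.lattice) :
    Tendsto ℘[L] (𝓝[≠] l) (Bornology.cobounded ℂ) := by
  rw [tendsto_cobounded_iff_meromorphicOrderAt_neg (L.meromorphic_weierstrassP l),
    L.order_weierstrassP l hl]
  decide

theorem isPreconnected_compl_of_countable {s : Set ℂ} (hs : s.Countable) : IsPreconnected sᶜ :=
  (hs.isPathConnected_compl_of_one_lt_rank
    (by rw [Complex.rank_real_complex]; norm_num)).isConnected.isPreconnected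

theorem countable_lattice : (L.lattice : Set ℂ).Countable := by
  have : Countable L.lattice := L.latticeEquivProd.toEquiv.countable_iff.2 inferInstance
  exact Set.countable_coe_iff.1 this

theorem eventually_nhdsNE_notMem_lattice (l : ℂ) : ∀ᶠ z in 𝓝[≠] l, z ∉ L.lattice := by
  filter_upwards [self_mem_nhdsWithin, mem_nhdsWithin_of_mem_nhds
    (L.compl_lattice_sdiff_singleton_mem_nhds l)] with z hz hz'
  simp_all

/-- The second order equation `℘'' = 6 ℘² - g₂ / 2`. -/
theorem hasDerivAt_derivWeierstrassP {z : ℂ} (hz : z ∉ L.lattice) :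
    HasDerivAt ℘'[L] (6 * ℘[L] z ^ 2 - L.g₂ / 2) z := by
  have hd := (L.analyticOnNhd_derivWeierstrassP z hz).differentiableAt.hasDerivAt
  have hopen : IsOpen (L.lattice : Set ℂ)ᶜ := L.isClosed_lattice.isOpen_compl
  have hA : AnalyticOnNhd ℂ (fun z ↦ deriv ℘'[L] z - (6 * ℘[L] z ^ 2 - L.g₂ / 2))
      (L.lattice : Set ℂ)ᶜ := by
    intro w hw
    have h1 := (L.analyticOnNhd_derivWeierstrassP w hw).deriv
    have h2 := L.analyticOnNhd_weierstrassP w hw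
    fun_prop
  -- differentiate `℘'² = 4 ℘³ - g₂ ℘ - g₃`; the factor `℘'` may be
  -- cancelled, as `℘` is not constant
  have hmul : ∀ w ∈ (L.lattice : Set ℂ)ᶜ,
      ℘'[L] w * (deriv ℘'[L] w - (6 * ℘[L] w ^ 2 - L.g₂ / 2)) = 0 := by
    intro w hw
    have h1 := (L.analyticOnNhd_derivWeierstrassP w hw).differentiableAt.hasDerivAt
    have h2 := L.hasDerivAt_weierstrassP hw
    have h3 : HasDerivAt (fun z ↦ ℘'[L] z ^ 2) _ w := h1.pow 2
    have h4 : HasDerivAt (fun z ↦ 4 * ℘[L] z ^ 3 - L.g₂ * ℘[L] z - L.g₃) _ w :=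
      (((h2.pow 3).const_mul 4).sub (h2.const_mul L.g₂)).sub_const L.g₃
    have h5 : (fun z ↦ ℘'[L] z ^ 2) =ᶠ[𝓝 w] fun z ↦ 4 * ℘[L] z ^ 3 - L.g₂ * ℘[L] z - L.g₃ := by
      filter_upwards [hopen.mem_nhds hw] with v hv using L.derivWeierstrassP_sq v hv
    have h6 := (h3.congr_of_eventuallyEq h5.symm).unique h4
    simp at h6
    linear_combination h6 / 2
  have hne : ¬ ∀ w ∈ (L.lattice : Set ℂ)ᶜ, ℘'[L] w = 0 := by
    intro h0
    -- otherwise `℘` would be locally constant near its pole at `0`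
    have hconst : ∀ w ∈ (L.lattice : Set ℂ)ᶜ, ℘[L] w = ℘[L] (L.ω₁ / 2) := by
      intro w hw
      refine hopen.is_const_of_fderiv_eq_zero (𝕜 := ℂ)
        (isPreconnected_compl_of_countable L.countable_lattice) L.differentiableOn_weierstrassP
        (fun v hv ↦ ?_) hw L.ω₁_div_two_notMem_lattice
      ext
      simp [h0 v hv]
    have h1 := L.tendsto_weierstrassP_cobounded L.lattice.zero_mem
    have h2 : Tendsto ℘[L] (𝓝[≠] 0) (𝓝 (℘[L] (L.ω₁ / 2))) := by
      refine tendsto_const_nhds.congr' ?_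
      filter_upwards [L.eventually_nhdsNE_notMem_lattice 0] with v hv
      exact (hconst v hv).symm
    exact not_tendsto_nhds_of_tendsto_atTop (tendsto_norm_cobounded_atTop.comp h1) _ h2.norm
  have key : ∀ w ∈ (L.lattice : Set ℂ)ᶜ, deriv ℘'[L] w - (6 * ℘[L] w ^ 2 - L.g₂ / 2) = 0 := by
    have := AnalyticOnNhd.eq_zero_or_eq_zero_of_mul_eq_zero L.analyticOnNhd_derivWeierstrassP hA
      hmul (isPreconnected_compl_of_countable L.countable_lattice)
    exact this.resolve_left hne
  rw [← sub_eq_zero.1 (key z hz)]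
  exact hd

/-- The function `℘` takes every value. -/
theorem exists_weierstrassP_eq (c : ℂ) : ∃ z, z ∉ L.lattice ∧ ℘[L] z = c := by
  classical
  by_contra! hne
  -- the function `1 / (℘ - c)` is entire and doubly periodic, hence constant by Liouville's
  -- theorem; but it vanishes exactly at the lattice points
  let g : ℂ → ℂ := fun z ↦ if z ∈ L.lattice then 0 else (℘[L] z - c)⁻¹
  have hg0 {z : ℂ} (hz : z ∉ L.lattice) : DifferentiableAt ℂ g z := by
    have h1 : DifferentiableAt ℂ (fun z ↦ (℘[L] z - c)⁻¹) z :=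
      ((L.hasDerivAt_weierstrassP hz).differentiableAt.sub_const c).inv (sub_ne_zero.2 (hne z hz))
    refine h1.congr_of_eventuallyEq ?_
    filter_upwards [L.isClosed_lattice.isOpen_compl.mem_nhds hz] with v hv
    exact if_neg hv
  have hg : Differentiable ℂ g := by
    intro z
    by_cases hz : z ∈ L.lattice
    · refine (Complex.analyticAt_of_differentiable_on_punctured_nhds_of_continuousAt
        ((L.eventually_nhdsNE_notMem_lattice z).mono fun v hv ↦ hg0 hv) ?_).differentiableAt
      rw [continuousAt_iff_punctured_nhds, show g z = 0 from if_pos hz]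
      have h1 : Tendsto (fun v ↦ (℘[L] v - c)⁻¹) (𝓝[≠] z) (𝓝 0) := by
        refine tendsto_inv₀_cobounded.comp ?_
        exact (tendsto_sub_const_cobounded c).comp (L.tendsto_weierstrassP_cobounded hz)
      refine h1.congr' ?_
      filter_upwards [L.eventually_nhdsNE_notMem_lattice z] with v hv
      exact (if_neg hv).symm
    · exact hg0 hz
  have hper : ∀ z w, w ∈ L.lattice → g (z + w) = g z := by
    intro z w hw
    have h1 : z + w ∈ L.lattice ↔ z ∈ L.lattice := L.lattice.add_mem_iff_left hw
    simp only [g, h1, L.weierstrassP_add_coe z ⟨w, hw⟩]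
  have h1 := hg.apply_eq_apply_of_bounded (IsZLattice.isCompact_range_of_periodic L.lattice _
    hg.continuous hper).isBounded (L.ω₁ / 2) 0
  rw [show g 0 = 0 from if_pos L.lattice.zero_mem,
    show g (L.ω₁ / 2) = _ from if_neg L.ω₁_div_two_notMem_lattice] at h1
  exact inv_ne_zero (sub_ne_zero.2 (hne _ L.ω₁_div_two_notMem_lattice)) h1

/-- The map `(℘, ℘')` from `ℂ / Λ` onto the affine curve. -/
theorem exists_weierstrassP_eq_and_derivWeierstrassP_eq {x y : ℂ}
    (h : y ^ 2 = 4 * x ^ 3 - L.g₂ * x - L.g₃) :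
    ∃ z, z ∉ L.lattice ∧ ℘[L] z = x ∧ ℘'[L] z = y := by
  obtain ⟨z, hz, rfl⟩ := L.exists_weierstrassP_eq x
  rw [← L.derivWeierstrassP_sq z hz] at h
  rcases sq_eq_sq_iff_eq_or_eq_neg.1 h with h | h
  · exact ⟨z, hz, rfl, h.symm⟩
  · exact ⟨-z, by simpa using hz, by simp, by simp [h]⟩

end PeriodPair

/-- Uniqueness for the system `x' = w y`, `y' = w (6 x² - c)`, which describes the motion of a point
on a Weierstrass cubic. -/
theorem weierstrassODE_unique {a b : ℝ} {c : ℂ} {w x₁ y₁ x₂ y₂ : ℝ → ℂ}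
    (hw : ContinuousOn w (Icc a b))
    (hx₁ : ∀ t ∈ Icc a b, HasDerivAt x₁ (w t * y₁ t) t)
    (hy₁ : ∀ t ∈ Icc a b, HasDerivAt y₁ (w t * (6 * x₁ t ^ 2 - c)) t)
    (hx₂ : ∀ t ∈ Icc a b, HasDerivAt x₂ (w t * y₂ t) t)
    (hy₂ : ∀ t ∈ Icc a b, HasDerivAt y₂ (w t * (6 * x₂ t ^ 2 - c)) t)
    (hx : x₁ a = x₂ a) (hy : y₁ a = y₂ a) :
    ∀ t ∈ Icc a b, x₁ t = x₂ t ∧ y₁ t = y₂ t := by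
  obtain ⟨W, hW⟩ := isCompact_Icc.exists_bound_of_continuousOn hw
  have hc₁ : ContinuousOn (fun t ↦ (x₁ t, y₁ t)) (Icc a b) := fun t ht ↦
    ((hx₁ t ht).continuousAt.prodMk (hy₁ t ht).continuousAt).continuousWithinAt
  have hc₂ : ContinuousOn (fun t ↦ (x₂ t, y₂ t)) (Icc a b) := fun t ht ↦
    ((hx₂ t ht).continuousAt.prodMk (hy₂ t ht).continuousAt).continuousWithinAt
  obtain ⟨R₁, hR₁⟩ := isCompact_Icc.exists_bound_of_continuousOn hc₁
  obtain ⟨R₂, hR₂⟩ := isCompact_Icc.exists_bound_of_continuousOn hc₂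
  set R := max R₁ R₂
  let v : ℝ → ℂ × ℂ → ℂ × ℂ := fun t p ↦ (w t * p.2, w t * (6 * p.1 ^ 2 - c))
  have hv : ∀ t ∈ Ico a b, LipschitzOnWith (Real.toNNReal (|W| * (1 + 12 * |R|))) (v t)
      (Metric.closedBall 0 R) := by
    intro t ht
    refine LipschitzOnWith.of_dist_le_mul fun p hp q hq ↦ ?_
    rw [Real.coe_toNNReal _ (by positivity), dist_eq_norm, dist_eq_norm]
    have hwt : ‖w t‖ ≤ |W| := (hW t (Ico_subset_Icc_self ht)).trans (le_abs_self W)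
    have hp1 : ‖p.1‖ ≤ |R| :=
      (norm_fst_le p).trans ((mem_closedBall_zero_iff.1 hp).trans (le_abs_self R))
    have hq1 : ‖q.1‖ ≤ |R| :=
      (norm_fst_le q).trans ((mem_closedBall_zero_iff.1 hq).trans (le_abs_self R))
    have h1 : ‖p.1 - q.1‖ ≤ ‖p - q‖ := norm_fst_le (p - q)
    have h2 : ‖p.2 - q.2‖ ≤ ‖p - q‖ := norm_snd_le (p - q)
    refine norm_prod_le_iff.2 ⟨?_, ?_⟩
    · have : (v t p - v t q).1 = w t * (p.2 - q.2) := by simp [v]; ring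
      rw [this, norm_mul]
      calc ‖w t‖ * ‖p.2 - q.2‖ ≤ |W| * ‖p - q‖ := by gcongr
        _ ≤ |W| * (1 + 12 * |R|) * ‖p - q‖ := by
          have : |W| ≤ |W| * (1 + 12 * |R|) :=
            le_mul_of_one_le_right (abs_nonneg _) (by linarith [abs_nonneg R])
          gcongr
    · have : (v t p - v t q).2 = w t * (6 * ((p.1 + q.1) * (p.1 - q.1))) := by simp [v]; ring
      rw [this, norm_mul, norm_mul, norm_mul]
      have h3 : ‖p.1 + q.1‖ ≤ 2 * |R| := (norm_add_le _ _).trans (by linarith)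
      calc ‖w t‖ * (‖(6 : ℂ)‖ * (‖p.1 + q.1‖ * ‖p.1 - q.1‖))
          ≤ |W| * (6 * (2 * |R| * ‖p - q‖)) := by
            have : ‖(6 : ℂ)‖ = 6 := by norm_num
            rw [this]; gcongr
        _ ≤ |W| * (1 + 12 * |R|) * ‖p - q‖ := by
          have : 0 ≤ |W| * ‖p - q‖ := by positivity
          nlinarith
  have key := ODE_solution_unique_of_mem_Icc_right hv hc₁
    (fun t ht ↦ ((hx₁ t (Ico_subset_Icc_self ht)).prodMk
      (hy₁ t (Ico_subset_Icc_self ht))).hasDerivWithinAt)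
    (fun t ht ↦ mem_closedBall_zero_iff.2
      ((hR₁ t (Ico_subset_Icc_self ht)).trans (le_max_left _ _))) hc₂
    (fun t ht ↦ ((hx₂ t (Ico_subset_Icc_self ht)).prodMk
      (hy₂ t (Ico_subset_Icc_self ht))).hasDerivWithinAt)
    (fun t ht ↦ mem_closedBall_zero_iff.2
      ((hR₂ t (Ico_subset_Icc_self ht)).trans (le_max_right _ _)))
    (by simp [hx, hy])
  intro t ht
  simpa using key ht

namespace PeriodPair

variable (L : PeriodPair)

theorem hasDerivAt_weierstrassP_comp {z w : ℝ → ℂ} {t : ℝ} (hz : HasDerivAt z (w t) t)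
    (hzt : z t ∉ L.lattice) :
    HasDerivAt (fun s ↦ ℘[L] (z s)) (w t * ℘'[L] (z t)) t ∧
    HasDerivAt (fun s ↦ ℘'[L] (z s)) (w t * (6 * ℘[L] (z t) ^ 2 - L.g₂ / 2)) t := by
  constructor
  · exact (L.hasDerivAt_weierstrassP hzt).scomp t hz
  · exact (L.hasDerivAt_derivWeierstrassP hzt).scomp t hz

/-- The map `(℘, ℘')` is injective on `ℂ / Λ`: translates of `℘` that agree to first order at a
point solve the same differential equation, so they agree, and they have the same poles. -/
theorem sub_mem_lattice_of_weierstrassP_eq {a b : ℂ} (ha : a ∉ L.lattice) (hb : b ∉ L.lattice)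
    (h : ℘[L] a = ℘[L] b) (h' : ℘'[L] a = ℘'[L] b) : b - a ∈ L.lattice := by
  have hopen : IsOpen (L.lattice : Set ℂ)ᶜ := L.isClosed_lattice.isOpen_compl
  have hloc : ∀ᶠ v in 𝓝 (0 : ℂ), ℘[L] (a + v) = ℘[L] (b + v) := by
    have h1 : ∀ᶠ v in 𝓝 (0 : ℂ), a + v ∈ (L.lattice : Set ℂ)ᶜ :=
      (continuous_const.add continuous_id).continuousAt.eventually_mem
        (hopen.mem_nhds (by simpa using ha))
    have h2 : ∀ᶠ v in 𝓝 (0 : ℂ), b + v ∈ (L.lattice : Set ℂ)ᶜ :=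
      (continuous_const.add continuous_id).continuousAt.eventually_mem
        (hopen.mem_nhds (by simpa using hb))
    obtain ⟨ε, hε, hball⟩ := Metric.eventually_nhds_iff_ball.1 (h1.and h2)
    filter_upwards [Metric.ball_mem_nhds (0 : ℂ) hε] with v hv
    have hmem (t : ℝ) (ht : t ∈ Icc (0 : ℝ) 1) : (t : ℂ) * v ∈ Metric.ball (0 : ℂ) ε := by
      rw [mem_ball_zero_iff] at hv ⊢
      rw [norm_mul, norm_real, Real.norm_eq_abs, abs_of_nonneg ht.1]
      exact (mul_le_of_le_one_left (norm_nonneg v) ht.2).trans_lt hv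
    have hder (e : ℂ) (t : ℝ) : HasDerivAt (fun s : ℝ ↦ e + s * v) ((fun _ : ℝ ↦ v) t) t := by
      simpa using (((hasDerivAt_id t).ofReal_comp).mul_const v).const_add e
    have hsol (e : ℂ) (t : ℝ) (he : e + t * v ∉ L.lattice) :=
      L.hasDerivAt_weierstrassP_comp (z := fun s : ℝ ↦ e + s * v) (w := fun _ ↦ v) (hder e t) he
    have key := weierstrassODE_unique (a := 0) (b := 1) (w := fun _ ↦ v) (c := L.g₂ / 2)
      (x₁ := fun t ↦ ℘[L] (a + t * v)) (y₁ := fun t ↦ ℘'[L] (a + t * v))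
      (x₂ := fun t ↦ ℘[L] (b + t * v)) (y₂ := fun t ↦ ℘'[L] (b + t * v)) continuousOn_const
      (fun t ht ↦ (hsol a t (hball _ (hmem t ht)).1).1)
      (fun t ht ↦ (hsol a t (hball _ (hmem t ht)).1).2)
      (fun t ht ↦ (hsol b t (hball _ (hmem t ht)).2).1)
      (fun t ht ↦ (hsol b t (hball _ (hmem t ht)).2).2)
      (by simpa using h) (by simpa using h') 1 (by simp)
    simpa using key.1
  by_contra hba
  -- otherwise `℘ (a + v)` has a pole at `v = -a`, while `℘ (b + v)` does not
  let s : Set ℂ := (fun v ↦ a + v) ⁻¹' L.lattice ∪ (fun v ↦ b + v) ⁻¹' L.lattice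
  have hs : s.Countable :=
    (L.countable_lattice.preimage (add_right_injective a)).union
      (L.countable_lattice.preimage (add_right_injective b))
  have hf : AnalyticOnNhd ℂ (fun v ↦ ℘[L] (a + v)) sᶜ := fun v hv ↦
    (L.analyticOnNhd_weierstrassP (a + v) fun h ↦ hv (Or.inl h)).fun_comp
      (analyticAt_const.add analyticAt_id)
  have hg : AnalyticOnNhd ℂ (fun v ↦ ℘[L] (b + v)) sᶜ := fun v hv ↦
    (L.analyticOnNhd_weierstrassP (b + v) fun h ↦ hv (Or.inr h)).fun_comp
      (analyticAt_const.add analyticAt_id)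
  have h0 : (0 : ℂ) ∈ sᶜ := by
    rintro (h | h)
    · exact ha (by simpa using h)
    · exact hb (by simpa using h)
  have heq := hf.eqOn_of_preconnected_of_eventuallyEq hg (isPreconnected_compl_of_countable hs)
    h0 hloc
  have hshift : Tendsto (fun v ↦ a + v) (𝓝[≠] (-a)) (𝓝[≠] 0) := by
    refine tendsto_nhdsWithin_iff.2 ⟨?_, ?_⟩
    · have : ContinuousAt (fun v : ℂ ↦ a + v) (-a) := by fun_prop
      simpa [ContinuousAt] using this.tendsto.mono_left nhdsWithin_le_nhds
    · filter_upwards [self_mem_nhdsWithin] with v hv h0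
      exact hv (by rw [mem_singleton_iff] at h0 ⊢; linear_combination h0)
  have hpole : Tendsto (fun v ↦ ℘[L] (a + v)) (𝓝[≠] (-a)) (Bornology.cobounded ℂ) := by
    exact (L.tendsto_weierstrassP_cobounded L.lattice.zero_mem).comp hshift
  have hreg : Tendsto (fun v ↦ ℘[L] (b + v)) (𝓝[≠] (-a)) (𝓝 (℘[L] (b + -a))) := by
    have h1 : ContinuousAt (fun v ↦ ℘[L] (b + v)) (-a) :=
      ((L.analyticOnNhd_weierstrassP (b + -a) (by rwa [← sub_eq_add_neg])).fun_comp
        (analyticAt_const.add analyticAt_id)).continuousAt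
    exact h1.tendsto.mono_left nhdsWithin_le_nhds
  refine not_tendsto_nhds_of_tendsto_atTop (tendsto_norm_cobounded_atTop.comp hpole) _
    (hreg.norm.congr' ?_)
  have h1 : ∀ᶠ v in 𝓝[≠] (-a), a + v ∉ L.lattice := by
    exact hshift.eventually (L.eventually_nhdsNE_notMem_lattice 0)
  have h2 : ∀ᶠ v in 𝓝[≠] (-a), b + v ∉ L.lattice := by
    refine nhdsWithin_le_nhds ?_
    exact (continuous_const.add continuous_id).continuousAt.eventually_mem
        (hopen.mem_nhds (by simpa [← sub_eq_add_neg] using hba))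
  filter_upwards [h1, h2] with v hv1 hv2
  have : v ∈ sᶜ := by rintro (h | h); exacts [hv1 h, hv2 h]
  exact (congrArg norm (heq this)).symm

end PeriodPair

end Weierstrass


/-! ### Periods of loops on a Weierstrass cubic -/

section Periods

open Set Filter Topology PeriodPair

/-- A line in a given direction that avoids a countable set. -/
theorem exists_line_notMem_of_countable (l : ℂ) {s : Set ℂ} (hs : s.Countable) :
    ∃ z : ℂ, ∀ t : ℝ, z + t * l ∉ s := by
  -- A nonzero real functional that is constant along the lines; its value is chosen to differ from
  -- the countably many values on `s`.
  obtain ⟨e, he0, he⟩ : ∃ e : ℂ, e ≠ 0 ∧ (e * l).re = 0 := by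
    by_cases hl : l = 0
    · exact ⟨1, one_ne_zero, by simp [hl]⟩
    · exact ⟨I * (starRingEnd ℂ) l, mul_ne_zero I_ne_zero (by simpa using hl), by
        rw [mul_assoc, mul_comm _ l, mul_conj]; simp⟩
  obtain ⟨r, hr⟩ : ((fun z : ℂ ↦ (e * z).re) '' s)ᶜ.Nonempty := by
    by_contra h
    rw [not_nonempty_iff_eq_empty, compl_empty_iff] at h
    have := hs.image (fun z : ℂ ↦ (e * z).re)
    rw [h] at this
    exact not_countable_univ this
  refine ⟨r / e, fun t ht ↦ hr ⟨_, ht, ?_⟩⟩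
  have : e * (r / e + t * l) = r + t * (e * l) := by field_simp
  simp [this, he]

namespace PeriodPair

variable (L : PeriodPair)

theorem derivWeierstrassP_ne_zero {z : ℂ} (hz : z ∉ L.lattice) (h2 : z + z ∉ L.lattice) :
    ℘'[L] z ≠ 0 := by
  intro h
  refine h2 ?_
  have := L.sub_mem_lattice_of_weierstrassP_eq (a := -z) (b := z) (by simpa using hz) hz
    (by simp) (by simp [h])
  simpa using this

/-- Every lattice vector `l` is the period of a loop `t ↦ (℘ (z + t l), ℘' (z + t l))`, and the line
can be chosen such that `℘'` has no zeros on it. -/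
theorem exists_weierstrassLoop {l : ℂ} (hl : l ∈ L.lattice) :
    ∃ γ : WeierstrassLoop L.g₂ L.g₃, (∀ t, γ.y t ≠ 0) ∧ ∀ t, γ.w t = l := by
  obtain ⟨z, hz⟩ := exists_line_notMem_of_countable l
    (s := {z | z + z ∈ L.lattice}) (by
      have : {z | z + z ∈ L.lattice} = (fun z : ℂ ↦ z + z) ⁻¹' (L.lattice : Set ℂ) := rfl
      rw [this]
      refine L.countable_lattice.preimage fun a b h ↦ ?_
      have h' : a + a = b + b := h
      linear_combination h' / 2)
  have hz2 (t : ℝ) : z + t * l ∉ L.lattice := fun h ↦ hz t (L.lattice.add_mem h h)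
  have hder (t : ℝ) : HasDerivAt (fun s : ℝ ↦ z + s * l) ((fun _ : ℝ ↦ l) t) t := by
    simpa using (((hasDerivAt_id t).ofReal_comp).mul_const l).const_add z
  have hper (t : ℝ) : z + (t + 1 : ℝ) * l = z + t * l + (⟨l, hl⟩ : L.lattice) := by
    push_cast; ring
  refine ⟨⟨fun t ↦ ℘[L] (z + t * l), fun t ↦ ℘'[L] (z + t * l), fun _ ↦ l, ?_, ?_,
    continuous_const, fun t ↦ L.derivWeierstrassP_sq _ (hz2 t),
    fun t ↦ (L.hasDerivAt_weierstrassP_comp (z := fun s : ℝ ↦ z + s * l)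
      (w := fun _ ↦ l) (hder t) (hz2 t)).1,
    fun t ↦ (L.hasDerivAt_weierstrassP_comp (z := fun s : ℝ ↦ z + s * l)
      (w := fun _ ↦ l) (hder t) (hz2 t)).2⟩,
    fun t ↦ L.derivWeierstrassP_ne_zero (hz2 t) (hz t), fun _ ↦ rfl⟩
  · intro t
    exact (congrArg ℘[L] (hper t)).trans (L.weierstrassP_add_coe _ ⟨l, hl⟩)
  · intro t
    exact (congrArg ℘'[L] (hper t)).trans (L.derivWeierstrassP_add_coe _ ⟨l, hl⟩)

/-- A loop on the curve lifts to the path `z₀ + ∫ w` in `ℂ` with respect to `(℘, ℘')`: the set of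
times up to which this holds is closed, as the loop stays in the affine curve, and open, by uniqueness for
the differential equation. -/
theorem weierstrassLoop_lift (γ : WeierstrassLoop L.g₂ L.g₃) {z₀ : ℂ} (hz₀ : z₀ ∉ L.lattice)
    (hx : ℘[L] z₀ = γ.x 0) (hy : ℘'[L] z₀ = γ.y 0) :
    z₀ + ∫ s in (0 : ℝ)..1, γ.w s ∉ L.lattice ∧
    ℘[L] (z₀ + ∫ s in (0 : ℝ)..1, γ.w s) = γ.x 1 ∧
    ℘'[L] (z₀ + ∫ s in (0 : ℝ)..1, γ.w s) = γ.y 1 := by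
  let z : ℝ → ℂ := fun t ↦ z₀ + ∫ s in (0 : ℝ)..t, γ.w s
  have hz (t : ℝ) : HasDerivAt z (γ.w t) t :=
    (γ.continuous_w.integral_hasStrictDerivAt 0 t).hasDerivAt.const_add z₀
  have hzc : Continuous z := continuous_iff_continuousAt.2 fun t ↦ (hz t).continuousAt
  have hxc : Continuous γ.x := continuous_iff_continuousAt.2 fun t ↦ (γ.deriv_x t).continuousAt
  have hyc : Continuous γ.y := continuous_iff_continuousAt.2 fun t ↦ (γ.deriv_y t).continuousAt
  have hopen : IsOpen (L.lattice : Set ℂ)ᶜ := L.isClosed_lattice.isOpen_compl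
  let S : Set ℝ := {t | z t ∉ L.lattice ∧ ℘[L] (z t) = γ.x t ∧ ℘'[L] (z t) = γ.y t}
  have hS : IsClosed S := by
    refine isClosed_of_closure_subset fun t ht ↦ ?_
    have hne : (𝓝[S] t).NeBot := mem_closure_iff_nhdsWithin_neBot.1 ht
    have hzt : Tendsto z (𝓝[S] t) (𝓝 (z t)) := hzc.continuousAt.tendsto.mono_left nhdsWithin_le_nhds
    have hxt : Tendsto γ.x (𝓝[S] t) (𝓝 (γ.x t)) :=
      hxc.continuousAt.tendsto.mono_left nhdsWithin_le_nhds
    have hyt : Tendsto γ.y (𝓝[S] t) (𝓝 (γ.y t)) :=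
      hyc.continuousAt.tendsto.mono_left nhdsWithin_le_nhds
    by_cases hzL : z t ∈ L.lattice
    · -- `℘` tends to infinity at a lattice point, while `x` stays bounded
      exfalso
      have h1 : Tendsto z (𝓝[S] t) (𝓝[≠] (z t)) := by
        refine tendsto_nhdsWithin_iff.2 ⟨hzt, ?_⟩
        filter_upwards [self_mem_nhdsWithin] with s hs h
        exact hs.1 (by rw [mem_singleton_iff] at h; rwa [h])
      refine not_tendsto_nhds_of_tendsto_atTop
        (tendsto_norm_cobounded_atTop.comp ((L.tendsto_weierstrassP_cobounded hzL).comp h1)) _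
        (hxt.norm.congr' ?_)
      filter_upwards [self_mem_nhdsWithin] with s hs
      exact (congrArg norm hs.2.1).symm
    · refine ⟨hzL, ?_, ?_⟩
      · refine tendsto_nhds_unique
          ((L.hasDerivAt_weierstrassP hzL).continuousAt.tendsto.comp hzt) (hxt.congr' ?_)
        filter_upwards [self_mem_nhdsWithin] with s hs using hs.2.1.symm
      · refine tendsto_nhds_unique
          ((L.hasDerivAt_derivWeierstrassP hzL).continuousAt.tendsto.comp hzt) (hyt.congr' ?_)
        filter_upwards [self_mem_nhdsWithin] with s hs using hs.2.2.symm
  have h0 : (0 : ℝ) ∈ S := by simpa [S, z] using ⟨hz₀, hx, hy⟩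
  have key : Icc (0 : ℝ) 1 ⊆ S := by
    refine IsClosed.Icc_subset_of_forall_exists_gt (hS.inter isClosed_Icc) h0 fun t ht u hu ↦ ?_
    have hev : ∀ᶠ s in 𝓝 t, z s ∈ (L.lattice : Set ℂ)ᶜ :=
      hzc.continuousAt.eventually_mem (hopen.mem_nhds ht.1.1)
    obtain ⟨ε, hε, hball⟩ := Metric.eventually_nhds_iff_ball.1 hev
    set v := min u (t + ε / 2) with hv
    have htv : t < v := lt_min hu (by linarith)
    have hmem (s : ℝ) (hs : s ∈ Icc t v) : z s ∉ L.lattice := by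
      refine hball s ?_
      rw [Metric.mem_ball, Real.dist_eq, abs_of_nonneg (by linarith [hs.1])]
      linarith [hs.2, min_le_right u (t + ε / 2)]
    have hu := weierstrassODE_unique (a := t) (b := v) (c := L.g₂ / 2) (w := γ.w)
      (x₁ := fun s ↦ ℘[L] (z s)) (y₁ := fun s ↦ ℘'[L] (z s)) γ.continuous_w.continuousOn
      (fun s hs ↦ (L.hasDerivAt_weierstrassP_comp (hz s) (hmem s hs)).1)
      (fun s hs ↦ (L.hasDerivAt_weierstrassP_comp (hz s) (hmem s hs)).2)
      (fun s _ ↦ γ.deriv_x s) (fun s _ ↦ γ.deriv_y s) ht.1.2.1 ht.1.2.2 v ⟨htv.le, le_rfl⟩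
    exact ⟨v, ⟨hmem v ⟨htv.le, le_rfl⟩, hu.1, hu.2⟩, htv, min_le_left _ _⟩
  exact key ⟨zero_le_one, le_rfl⟩

/-- The periods of `dx / y` form the lattice itself: the endpoints of the lift of a loop differ by a
lattice vector, and each lattice vector is the period of a straight line in `ℂ / Λ`. -/
theorem periodLattice_eq : periodLattice L.g₂ L.g₃ = L.lattice := by
  ext l
  constructor
  · rintro ⟨γ, rfl⟩
    obtain ⟨z₀, hz₀, hx, hy⟩ := L.exists_weierstrassP_eq_and_derivWeierstrassP_eq (γ.on_curve 0)
    obtain ⟨h1, h2, h3⟩ := L.weierstrassLoop_lift γ hz₀ hx hy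
    have hp1 : γ.x 1 = γ.x 0 := by simpa using γ.periodic_x 0
    have hp2 : γ.y 1 = γ.y 0 := by simpa using γ.periodic_y 0
    have := L.sub_mem_lattice_of_weierstrassP_eq hz₀ h1 (by rw [h2, hp1, hx]) (by rw [h3, hp2, hy])
    simpa using this
  · intro hl
    obtain ⟨γ, -, hw⟩ := L.exists_weierstrassLoop hl
    exact ⟨γ, by simp [hw]⟩

end PeriodPair

/-- Deforming the curve while keeping the `x`-coordinate of a loop without zeros of `y`, the form
`dx / y` changes by a factor close to `1`. -/
theorem exists_deformed_period {g₂ g₃ l : ℂ} (γ : WeierstrassLoop g₂ g₃) (hy : ∀ t, γ.y t ≠ 0)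
    (hw : ∀ t, γ.w t = l) :
    ∃ C > 0, ∃ δ > 0, ∀ A B : ℂ, ‖A - g₂‖ + ‖B - g₃‖ < δ →
      ∃ p ∈ periodLattice A B, ‖p - l‖ ≤ C * (‖A - g₂‖ + ‖B - g₃‖) := by
  have hxc : Continuous γ.x := continuous_iff_continuousAt.2 fun t ↦ (γ.deriv_x t).continuousAt
  have hyc : Continuous γ.y := continuous_iff_continuousAt.2 fun t ↦ (γ.deriv_y t).continuousAt
  have hbd1 : ∃ M, ∀ t, ‖γ.x t / γ.y t ^ 2‖ ≤ M := by
    have hc : Continuous fun t ↦ γ.x t / γ.y t ^ 2 :=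
      hxc.div (hyc.pow 2) fun t ↦ pow_ne_zero 2 (hy t)
    have hp : Function.Periodic (fun t ↦ γ.x t / γ.y t ^ 2) 1 := fun t ↦ by
      simp only [γ.periodic_x t, γ.periodic_y t]
    obtain ⟨M, hM⟩ := (hp.isBounded_of_continuous one_ne_zero hc).exists_norm_le
    exact ⟨M, fun t ↦ hM _ ⟨t, rfl⟩⟩
  have hbd2 : ∃ M, ∀ t, ‖1 / γ.y t ^ 2‖ ≤ M := by
    have hc : Continuous fun t ↦ 1 / γ.y t ^ 2 :=
      continuous_const.div (hyc.pow 2) fun t ↦ pow_ne_zero 2 (hy t)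
    have hp : Function.Periodic (fun t ↦ 1 / γ.y t ^ 2) 1 := fun t ↦ by
      simp only [γ.periodic_y t]
    obtain ⟨M, hM⟩ := (hp.isBounded_of_continuous one_ne_zero hc).exists_norm_le
    exact ⟨M, fun t ↦ hM _ ⟨t, rfl⟩⟩
  obtain ⟨M₁, hM₁⟩ := hbd1
  obtain ⟨M₂, hM₂⟩ := hbd2
  set K := max M₁ M₂ with hK
  have hK0 : 0 ≤ K := (norm_nonneg _).trans ((hM₂ 0).trans (le_max_right _ _))
  refine ⟨2 * ‖l‖ * K + 1, by positivity, 1 / (2 * (K + 1)), by positivity, fun A B hAB ↦ ?_⟩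
  set d := ‖A - g₂‖ + ‖B - g₃‖ with hd
  have hd0 : 0 ≤ d := by positivity
  -- the deformed loop is `(x, y √(1 - ε))`; as `ε` is small, the principal branch is
  -- holomorphic there
  let ε : ℝ → ℂ := fun t ↦ (A - g₂) * (γ.x t / γ.y t ^ 2) + (B - g₃) * (1 / γ.y t ^ 2)
  have hε (t : ℝ) : ‖ε t‖ ≤ K * d := by
    calc ‖ε t‖ ≤ ‖A - g₂‖ * ‖γ.x t / γ.y t ^ 2‖ + ‖B - g₃‖ * ‖1 / γ.y t ^ 2‖ := by
          refine (norm_add_le _ _).trans_eq ?_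
          rw [norm_mul, norm_mul]
      _ ≤ ‖A - g₂‖ * K + ‖B - g₃‖ * K := by
          gcongr
          · exact (hM₁ t).trans (le_max_left _ _)
          · exact (hM₂ t).trans (le_max_right _ _)
      _ = K * d := by ring
  have hKd : K * d ≤ 1 / 2 := by
    rw [lt_div_iff₀ (by positivity)] at hAB
    nlinarith
  have hε' (t : ℝ) : ‖ε t‖ ≤ 1 / 2 := (hε t).trans hKd
  have hre (t : ℝ) : 1 / 2 ≤ (1 - ε t).re := by
    have := (abs_re_le_norm (ε t)).trans (hε' t)
    simp only [sub_re, one_re]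
    linarith [le_abs_self (ε t).re]
  have hslit (t : ℝ) : 1 - ε t ∈ slitPlane := Or.inl (by linarith [hre t])
  let s : ℝ → ℂ := fun t ↦ (1 - ε t) ^ (2⁻¹ : ℂ)
  have hs2 (t : ℝ) : s t ^ 2 = 1 - ε t := by
    simp only [s]
    exact Complex.cpow_ofNat_inv_pow _ 2
  have hs0 (t : ℝ) : s t ≠ 0 := by
    intro h
    have := hs2 t
    rw [h] at this
    exact slitPlane_ne_zero (hslit t) (by rw [← this]; simp)
  have hsre (t : ℝ) : 0 ≤ (s t).re := by
    simp only [s, cpow_inv_two_re]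
    positivity
  have hεd (t : ℝ) : DifferentiableAt ℝ ε t := by
    have h1 := (γ.deriv_x t).differentiableAt
    have h2 := (γ.deriv_y t).differentiableAt
    have h3 := hy t
    simp only [ε]
    fun_prop (disch := simpa using h3)
  have hsd (t : ℝ) : DifferentiableAt ℝ s t := by
    have h1 : HasDerivAt (fun z : ℂ ↦ z ^ (2⁻¹ : ℂ)) _ (1 - ε t) :=
      (hasDerivAt_id (1 - ε t)).cpow_const (hslit t)
    exact (h1.differentiableAt.restrictScalars ℝ).comp t ((hεd t).const_sub 1)
  have hcurve (t : ℝ) : (γ.y t * s t) ^ 2 = 4 * γ.x t ^ 3 - A * γ.x t - B := by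
    rw [mul_pow, hs2]
    have := γ.on_curve t
    have h3 := hy t
    simp only [ε]
    field_simp
    linear_combination this
  have hsc : Continuous s := continuous_iff_continuousAt.2 fun t ↦ (hsd t).continuousAt
  let γ' : WeierstrassLoop A B :=
    { x := γ.x
      y := fun t ↦ γ.y t * s t
      w := fun t ↦ l / s t
      periodic_x := γ.periodic_x
      periodic_y := fun t ↦ by simp only [s, ε, γ.periodic_x t, γ.periodic_y t]
      continuous_w := continuous_const.div hsc hs0
      on_curve := hcurve
      deriv_x := fun t ↦ by
        have h1 := γ.deriv_x t
        rw [hw t] at h1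
        convert h1 using 1
        have := hs0 t
        field_simp
      deriv_y := fun t ↦ by
        have h1 := γ.deriv_x t
        rw [hw t] at h1
        have h2 : HasDerivAt (fun t ↦ γ.y t * s t) _ t :=
          ((γ.deriv_y t).differentiableAt.mul (hsd t)).hasDerivAt
        have h3 : HasDerivAt (fun t ↦ (γ.y t * s t) ^ 2) _ t := h2.pow 2
        have h4 : HasDerivAt (fun t ↦ 4 * γ.x t ^ 3 - A * γ.x t - B) _ t :=
          (((h1.pow 3).const_mul 4).sub (h1.const_mul A)).sub_const B
        have h5 := h3.unique (h4.congr_of_eventuallyEq (Eventually.of_forall hcurve))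
        convert h2 using 1
        have h6 := hs0 t
        have h7 := hy t
        have h8 : γ.y t * s t ≠ 0 := mul_ne_zero h7 h6
        simp at h5
        field_simp
        set D := deriv (fun t ↦ γ.y t * s t) t
        have h9 : γ.y t * (2 * (s t * D)) = γ.y t * (l * (12 * γ.x t ^ 2 - A)) := by
          linear_combination h5
        have h10 := mul_left_cancel₀ h7 h9
        linear_combination -h10 }
  refine ⟨∫ t in (0 : ℝ)..1, γ'.w t, ⟨γ', rfl⟩, ?_⟩
  have hdiff (t : ℝ) : ‖l / s t - l‖ ≤ 2 * ‖l‖ * K * d := by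
    have h1 : l / s t - l = l * (ε t / ((1 + s t) * s t)) := by
      have h6 := hs0 t
      have h7 : 1 + s t ≠ 0 := by
        intro h
        have := congrArg re h
        simp at this
        linarith [hsre t]
      have := hs2 t
      field_simp
      linear_combination (-l) * this
    have h2 : 1 ≤ ‖1 + s t‖ := by
      have := (le_abs_self _).trans (abs_re_le_norm (1 + s t))
      simp at this
      linarith [hsre t]
    have h3 : 1 / 2 ≤ ‖s t‖ := by
      have h4 : ‖s t‖ ^ 2 = ‖1 - ε t‖ := by rw [← norm_pow, hs2]
      have h5 : 1 / 2 ≤ ‖1 - ε t‖ := (hre t).trans ((le_abs_self _).trans (abs_re_le_norm _))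
      nlinarith [norm_nonneg (s t)]
    rw [h1, norm_mul, norm_div, norm_mul]
    have h4 : 1 / 2 ≤ ‖1 + s t‖ * ‖s t‖ := by nlinarith
    have h5 : ‖ε t‖ / (‖1 + s t‖ * ‖s t‖) ≤ 2 * (K * d) := by
      rw [div_le_iff₀ (by linarith)]
      have := hε t
      nlinarith [norm_nonneg (ε t), mul_nonneg hK0 hd0]
    calc ‖l‖ * (‖ε t‖ / (‖1 + s t‖ * ‖s t‖)) ≤ ‖l‖ * (2 * (K * d)) := by gcongr
      _ = 2 * ‖l‖ * K * d := by ring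
  have hint : (∫ t in (0 : ℝ)..1, γ'.w t) - l = ∫ t in (0 : ℝ)..1, (l / s t - l) := by
    rw [intervalIntegral.integral_sub]
    · simp [γ']
    · exact (continuous_const.div hsc hs0).intervalIntegrable _ _
    · exact continuous_const.intervalIntegrable _ _
  rw [hint]
  calc ‖∫ t in (0 : ℝ)..1, (l / s t - l)‖ ≤ 2 * ‖l‖ * K * d * |1 - 0| :=
        intervalIntegral.norm_integral_le_of_norm_le_const fun t _ ↦ hdiff t
    _ = 2 * ‖l‖ * K * d := by simp
    _ ≤ (2 * ‖l‖ * K + 1) * d := by nlinarith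

end Periods


/-! ### Local holomorphic dependence of the periods -/

section LocalPeriods

open Set Filter Topology PeriodPair

/-- The invariants `(g₂, g₃)` of the lattice with basis `l, l τ`. -/
noncomputable def latticeInvariants (p : ℂ × ℂ) : ℂ × ℂ :=
  ((p.1 ^ 4)⁻¹ * (4 * Real.pi ^ 4 / 3 * ModularForm.E₄ (UpperHalfPlane.ofComplex p.2)),
    (p.1 ^ 6)⁻¹ * (8 * Real.pi ^ 6 / 27 * ModularForm.E₆ (UpperHalfPlane.ofComplex p.2)))

theorem latticeInvariants_eq (l : ℂ) (hl : l ≠ 0) (τ : ℂ) (hτ : 0 < τ.im) :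
    latticeInvariants (l, τ) = ((scaledPair l hl τ hτ).g₂, (scaledPair l hl τ hτ).g₃) := by
  have h1 := scaledPair_g₂ l hl ⟨τ, hτ⟩
  have h2 := scaledPair_g₃ l hl ⟨τ, hτ⟩
  simp only [latticeInvariants, UpperHalfPlane.ofComplex_apply_of_im_pos hτ]
  exact Prod.ext h1.symm h2.symm

theorem periodLattice_latticeInvariants (l : ℂ) (hl : l ≠ 0) (τ : ℂ) (hτ : 0 < τ.im) :
    periodLattice (latticeInvariants (l, τ)).1 (latticeInvariants (l, τ)).2 =
      (scaledPair l hl τ hτ).lattice := by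
  rw [latticeInvariants_eq l hl τ hτ]
  exact (scaledPair l hl τ hτ).periodLattice_eq

theorem contDiffAt_latticeInvariants {p : ℂ × ℂ} (hl : p.1 ≠ 0) (hτ : 0 < p.2.im) :
    ContDiffAt ℂ 1 latticeInvariants p := by
  have hE {k : ℕ} (hk : 3 ≤ k) :
      ContDiffAt ℂ 1 (fun p : ℂ × ℂ ↦ ModularForm.E hk (UpperHalfPlane.ofComplex p.2)) p := by
    have h1 : DifferentiableOn ℂ (ModularForm.E hk ∘ UpperHalfPlane.ofComplex) {z | 0 < z.im} :=
      UpperHalfPlane.mdifferentiable_iff.1 (ModularForm.E hk).holo'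
    have h2 : ContDiffAt ℂ 1 (ModularForm.E hk ∘ UpperHalfPlane.ofComplex) p.2 :=
      (h1.analyticAt ((isOpen_lt continuous_const continuous_im).mem_nhds hτ)).contDiffAt
    exact h2.comp p contDiffAt_snd
  have h4 := hE (k := 4) (by norm_num)
  have h6 := hE (k := 6) (by norm_num)
  refine ContDiffAt.prodMk ?_ ?_
  · exact ((contDiffAt_fst.pow 4).inv (pow_ne_zero 4 hl)).mul (contDiffAt_const.mul h4)
  · exact ((contDiffAt_fst.pow 6).inv (pow_ne_zero 6 hl)).mul (contDiffAt_const.mul h6)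

/-- Nonzero vectors of the lattice `ℤ l + ℤ l τ` are not short. -/
theorem eq_zero_of_mem_scaledPair_lattice {l : ℂ} {hl : l ≠ 0} {τ : ℂ} {hτ : 0 < τ.im} {z : ℂ}
    (hz : z ∈ (scaledPair l hl τ hτ).lattice) (h : ‖z‖ < ‖l‖ * min 1 τ.im) : z = 0 := by
  obtain ⟨m, n, rfl⟩ := mem_scaledPair_lattice.1 hz
  have h1 : (m : ℂ) * l + n * (l * τ) = l * (m + n * τ) := by ring
  rw [h1, norm_mul] at h
  have h2 : ‖(m : ℂ) + n * τ‖ < min 1 τ.im := lt_of_mul_lt_mul_left h (norm_nonneg l)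
  have him : |(n : ℝ)| * τ.im < τ.im := by
    have h3 := (abs_im_le_norm ((m : ℂ) + n * τ)).trans_lt (h2.trans_le (min_le_right _ _))
    simpa [abs_mul, abs_of_pos hτ] using h3
  have hn : n = 0 := by
    have : |(n : ℝ)| < 1 := by
      by_contra hc
      push Not at hc
      nlinarith
    exact Int.abs_lt_one_iff.1 (by exact_mod_cast this)
  subst hn
  have hm : m = 0 := by
    have h3 := h2.trans_le (min_le_left _ _)
    simp only [Int.cast_zero, zero_mul, add_zero, norm_intCast] at h3
    exact Int.abs_lt_one_iff.1 (by exact_mod_cast h3)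
  subst hm
  simp

/-- The invariants detect the periods to first order: deforming the curve, the loops that represent
the two basic periods move by at most a constant times the deformation of the curve, and by
discreteness the deformed periods are the basic periods of the deformed lattice. -/
theorem latticeInvariants_antilipschitz {l₀ τ₀ : ℂ} (hl₀ : l₀ ≠ 0) (hτ₀ : 0 < τ₀.im) :
    ∃ C : ℝ, ∀ᶠ p in 𝓝 (l₀, τ₀), ‖p - (l₀, τ₀)‖ ≤
      C * ‖latticeInvariants p - latticeInvariants (l₀, τ₀)‖ := by
  set L := scaledPair l₀ hl₀ τ₀ hτ₀ with hL
  have hinv := latticeInvariants_eq l₀ hl₀ τ₀ hτ₀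
  obtain ⟨γ₁, hy₁, hw₁⟩ := L.exists_weierstrassLoop L.ω₁_mem_lattice
  obtain ⟨γ₂, hy₂, hw₂⟩ := L.exists_weierstrassLoop L.ω₂_mem_lattice
  obtain ⟨C₁, hC₁, δ₁, hδ₁, H₁⟩ := exists_deformed_period γ₁ hy₁ hw₁
  obtain ⟨C₂, hC₂, δ₂, hδ₂, H₂⟩ := exists_deformed_period γ₂ hy₂ hw₂
  set d : ℂ × ℂ → ℝ := fun p ↦ ‖(latticeInvariants p).1 - L.g₂‖ + ‖(latticeInvariants p).2 - L.g₃‖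
    with hd
  have hcont : ContinuousAt latticeInvariants (l₀, τ₀) :=
    (contDiffAt_latticeInvariants (p := (l₀, τ₀)) hl₀ hτ₀).continuousAt
  have hd0 : Tendsto d (𝓝 (l₀, τ₀)) (𝓝 0) := by
    have h1 : ContinuousAt d (l₀, τ₀) :=
      ((hcont.fst.sub continuousAt_const).norm).add ((hcont.snd.sub continuousAt_const).norm)
    have h2 : d (l₀, τ₀) = 0 := by simp [hd, hinv, ← hL]
    rw [ContinuousAt, h2] at h1
    exact h1
  have hfst : Tendsto (fun p : ℂ × ℂ ↦ p.1) (𝓝 (l₀, τ₀)) (𝓝 l₀) := continuous_fst.continuousAt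
  have hsnd : Tendsto (fun p : ℂ × ℂ ↦ p.2) (𝓝 (l₀, τ₀)) (𝓝 τ₀) := continuous_snd.continuousAt
  have him : Tendsto (fun p : ℂ × ℂ ↦ p.2.im) (𝓝 (l₀, τ₀)) (𝓝 τ₀.im) :=
    (continuous_im.tendsto τ₀).comp hsnd
  have hsmall (C : ℝ) (b : ℂ) (f : ℂ × ℂ → ℂ) (hf : Tendsto f (𝓝 (l₀, τ₀)) (𝓝 b)) :
      ∀ᶠ p in 𝓝 (l₀, τ₀), C * d p + ‖f p - b‖ < ‖p.1‖ * min 1 p.2.im := by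
    have h1 : Tendsto (fun p ↦ C * d p + ‖f p - b‖) (𝓝 (l₀, τ₀)) (𝓝 (C * 0 + ‖b - b‖)) :=
      (hd0.const_mul C).add (hf.sub_const b).norm
    have h2 : Tendsto (fun p : ℂ × ℂ ↦ ‖p.1‖ * min 1 p.2.im) (𝓝 (l₀, τ₀))
        (𝓝 (‖l₀‖ * min 1 τ₀.im)) := hfst.norm.mul (tendsto_const_nhds.min him)
    refine h1.eventually_lt h2 ?_
    simp only [mul_zero, sub_self, norm_zero, add_zero]
    have := norm_pos_iff.2 hl₀
    positivity
  refine ⟨2 * (C₁ + (C₂ + C₁ * ‖τ₀‖) / (‖l₀‖ / 2)), ?_⟩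
  filter_upwards [hd0.eventually_lt_const hδ₁, hd0.eventually_lt_const hδ₂,
    him.eventually_const_lt hτ₀, hsmall C₁ l₀ (fun p ↦ p.1) hfst,
    hsmall C₂ (l₀ * τ₀) (fun p ↦ p.1 * p.2) (hfst.mul hsnd),
    hfst.norm.eventually_const_lt (half_lt_self (norm_pos_iff.2 hl₀))] with p h1 h2 him h3 h4 h5
  obtain ⟨l, τ⟩ := p
  simp only at him h3 h4 h5
  have hl : l ≠ 0 := norm_pos_iff.1 ((half_pos (norm_pos_iff.2 hl₀)).trans h5)
  have hlat := periodLattice_latticeInvariants l hl τ him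
  obtain ⟨p₁, hp₁, hb₁⟩ := H₁ _ _ h1
  obtain ⟨p₂, hp₂, hb₂⟩ := H₂ _ _ h2
  rw [hlat] at hp₁ hp₂
  change ‖p₁ - l₀‖ ≤ C₁ * d (l, τ) at hb₁
  change ‖p₂ - l₀ * τ₀‖ ≤ C₂ * d (l, τ) at hb₂
  -- `p₁ - l` and `p₂ - l τ` are vectors of the deformed lattice that are too short to be nonzero
  have e1 : p₁ = l := by
    have hmem := (scaledPair l hl τ him).lattice.sub_mem hp₁ (scaledPair l hl τ him).ω₁_mem_lattice
    refine sub_eq_zero.1 (eq_zero_of_mem_scaledPair_lattice hmem ?_)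
    change ‖p₁ - l‖ < _
    have : p₁ - l = (p₁ - l₀) - (l - l₀) := by ring
    rw [this]
    exact (norm_sub_le _ _).trans_lt (by linarith)
  have e2 : p₂ = l * τ := by
    have hmem := (scaledPair l hl τ him).lattice.sub_mem hp₂ (scaledPair l hl τ him).ω₂_mem_lattice
    refine sub_eq_zero.1 (eq_zero_of_mem_scaledPair_lattice hmem ?_)
    change ‖p₂ - l * τ‖ < _
    have : p₂ - l * τ = (p₂ - l₀ * τ₀) - (l * τ - l₀ * τ₀) := by ring
    rw [this]
    exact (norm_sub_le _ _).trans_lt (by linarith)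
  rw [e1] at hb₁
  rw [e2] at hb₂
  have hdle : d (l, τ) ≤ 2 * ‖latticeInvariants (l, τ) - latticeInvariants (l₀, τ₀)‖ := by
    rw [hinv, two_mul]
    exact add_le_add (norm_fst_le (latticeInvariants (l, τ) - (L.g₂, L.g₃)))
      (norm_snd_le (latticeInvariants (l, τ) - (L.g₂, L.g₃)))
  have hd0' : 0 ≤ d (l, τ) := by positivity
  have hl2 : 0 < ‖l₀‖ / 2 := half_pos (norm_pos_iff.2 hl₀)
  have hτb : ‖τ - τ₀‖ ≤ (C₂ + C₁ * ‖τ₀‖) / (‖l₀‖ / 2) * d (l, τ) := by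
    have h6 : l * (τ - τ₀) = (l * τ - l₀ * τ₀) - (l - l₀) * τ₀ := by ring
    have h7 : ‖l‖ * ‖τ - τ₀‖ ≤ (C₂ + C₁ * ‖τ₀‖) * d (l, τ) := by
      rw [← norm_mul, h6]
      refine (norm_sub_le _ _).trans ?_
      rw [norm_mul]
      nlinarith [norm_nonneg τ₀]
    rw [div_mul_eq_mul_div, le_div_iff₀ hl2]
    nlinarith [norm_nonneg (τ - τ₀)]
  have hK : 0 ≤ (C₂ + C₁ * ‖τ₀‖) / (‖l₀‖ / 2) := by positivity
  have hgoal : ‖((l, τ) : ℂ × ℂ) - (l₀, τ₀)‖ ≤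
      (C₁ + (C₂ + C₁ * ‖τ₀‖) / (‖l₀‖ / 2)) * d (l, τ) := by
    refine norm_prod_le_iff.2 ⟨?_, ?_⟩
    · simp only [Prod.fst_sub]; nlinarith
    · simp only [Prod.snd_sub]; nlinarith
  refine hgoal.trans ?_
  have : 0 ≤ C₁ + (C₂ + C₁ * ‖τ₀‖) / (‖l₀‖ / 2) := by positivity
  nlinarith

/-- A map that is antilipschitz at a point has injective derivative there. -/
theorem injective_of_hasFDerivAt_of_le {E F : Type*} [NormedAddCommGroup E] [NormedSpace ℂ E]
    [NormedAddCommGroup F] [NormedSpace ℂ F] {f : E → F} {f' : E →L[ℂ] F} {x : E} {C : ℝ}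
    (hf : HasFDerivAt f f' x) (h : ∀ᶠ y in 𝓝 x, ‖y - x‖ ≤ C * ‖f y - f x‖) :
    Function.Injective f' := by
  rw [injective_iff_map_eq_zero]
  intro v hv
  have hline : HasDerivAt (fun t : ℂ ↦ f (x + t • v)) (f' v) 0 := hf.hasLineDerivAt v
  rw [hv] at hline
  have hslope := (hasDerivAt_iff_tendsto_slope_zero.1 hline).norm
  simp only [zero_add, zero_smul, add_zero, norm_zero] at hslope
  have hx : Tendsto (fun t : ℂ ↦ x + t • v) (𝓝[≠] 0) (𝓝 x) := by
    have : ContinuousAt (fun t : ℂ ↦ x + t • v) 0 := by fun_prop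
    simpa [ContinuousAt] using this.tendsto.mono_left nhdsWithin_le_nhds
  have hle : ∀ᶠ t : ℂ in 𝓝[≠] 0, ‖v‖ ≤ C * ‖t⁻¹ • (f (x + t • v) - f x)‖ := by
    filter_upwards [hx.eventually h, self_mem_nhdsWithin] with t ht ht0
    have ht0' : 0 < ‖t‖ := norm_pos_iff.2 ht0
    rw [add_sub_cancel_left, norm_smul] at ht
    rw [norm_smul, norm_inv]
    have : ‖v‖ = ‖t‖⁻¹ * (‖t‖ * ‖v‖) := by field_simp
    rw [this]
    calc ‖t‖⁻¹ * (‖t‖ * ‖v‖) ≤ ‖t‖⁻¹ * (C * ‖f (x + t • v) - f x‖) := by gcongr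
      _ = C * (‖t‖⁻¹ * ‖f (x + t • v) - f x‖) := by ring
  have := le_of_tendsto_of_tendsto tendsto_const_nhds (hslope.const_mul C) hle
  rw [mul_zero] at this
  exact norm_le_zero_iff.1 this

/-- The periods of a holomorphic family of nonsingular cubics have a basis `l, l τ` that depends
holomorphically on the parameter. -/
theorem exists_local_periods {A B : ℂ → ℂ} {u₀ : ℂ} (hA : ContDiff ℂ 1 A) (hB : ContDiff ℂ 1 B)
    (h : A u₀ ^ 3 - 27 * B u₀ ^ 2 ≠ 0) :
    ∃ r > 0, ∃ l τ : ℂ → ℂ, DifferentiableOn ℂ l (Metric.ball u₀ r) ∧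
      DifferentiableOn ℂ τ (Metric.ball u₀ r) ∧
      ∀ u ∈ Metric.ball u₀ r, l u ≠ 0 ∧ 0 < (τ u).im ∧
        periodLattice (A u) (B u) =
          range fun n : ℤ × ℤ ↦ (n.1 : ℂ) * l u + n.2 * (l u * τ u) := by
  obtain ⟨l₀, hl₀, τ₀, hg₂, hg₃⟩ := exists_scaledPair_invariants h
  have hinv := latticeInvariants_eq l₀ hl₀ τ₀ τ₀.im_pos
  rw [hg₂, hg₃] at hinv
  set p₀ : ℂ × ℂ := (l₀, (τ₀ : ℂ)) with hp₀
  have hcd : ContDiffAt ℂ 1 latticeInvariants p₀ :=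
    contDiffAt_latticeInvariants (p := p₀) hl₀ τ₀.im_pos
  have hfd := (hcd.differentiableAt one_ne_zero).hasFDerivAt
  obtain ⟨C, hC⟩ := latticeInvariants_antilipschitz hl₀ τ₀.im_pos
  have hinj := injective_of_hasFDerivAt_of_le hfd hC
  let e : (ℂ × ℂ) ≃L[ℂ] (ℂ × ℂ) :=
    (LinearEquiv.ofInjectiveEndo (fderiv ℂ latticeInvariants p₀ : ℂ × ℂ →ₗ[ℂ] ℂ × ℂ)
      hinj).toContinuousLinearEquiv
  have hfe : HasFDerivAt latticeInvariants (e : ℂ × ℂ →L[ℂ] ℂ × ℂ) p₀ := by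
    have : (e : ℂ × ℂ →L[ℂ] ℂ × ℂ) = fderiv ℂ latticeInvariants p₀ :=
      ContinuousLinearMap.ext fun _ ↦ rfl
    rwa [this]
  have hstrict := hcd.hasStrictFDerivAt' hfe one_ne_zero
  set ψ := hcd.localInverse hfe one_ne_zero with hψ
  have hψcd : ContDiffAt ℂ 1 ψ (A u₀, B u₀) := by
    have := hcd.to_localInverse hfe one_ne_zero
    rwa [hinv] at this
  have hψ0 : ψ (A u₀, B u₀) = p₀ := by
    have := hstrict.localInverse_apply_image
    rwa [hinv] at this
  have hright : ∀ᶠ q in 𝓝 (A u₀, B u₀), latticeInvariants (ψ q) = q := by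
    have := hstrict.eventually_right_inverse
    rwa [hinv] at this
  have hg : ContDiffAt ℂ 1 (fun u ↦ (A u, B u)) u₀ := (hA.prodMk hB).contDiffAt
  have hcomp : ContDiffAt ℂ 1 (fun u ↦ ψ (A u, B u)) u₀ := hψcd.comp u₀ hg
  have hfst : ContinuousAt (fun u ↦ (ψ (A u, B u)).1) u₀ := hcomp.continuousAt.fst
  have hsnd : ContinuousAt (fun u ↦ (ψ (A u, B u)).2.im) u₀ :=
    continuous_im.continuousAt.comp hcomp.continuousAt.snd
  have hev := ((hcomp.eventually (by simp)).and (hg.continuousAt.eventually hright)).and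
    ((hfst.eventually_ne (by simpa [hψ0] using hl₀)).and
      (hsnd.eventually (lt_mem_nhds (a := 0) (by simp only [hψ0]; exact τ₀.im_pos))))
  obtain ⟨r, hr, hball⟩ := Metric.eventually_nhds_iff_ball.1 hev
  refine ⟨r, hr, fun u ↦ (ψ (A u, B u)).1, fun u ↦ (ψ (A u, B u)).2, fun u hu ↦ ?_, fun u hu ↦ ?_,
    fun u hu ↦ ?_⟩
  · exact ((hball u hu).1.1.differentiableAt one_ne_zero).fst.differentiableWithinAt
  · exact ((hball u hu).1.1.differentiableAt one_ne_zero).snd.differentiableWithinAt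
  · obtain ⟨⟨-, hinv⟩, hl, hτ⟩ := hball u hu
    refine ⟨hl, hτ, ?_⟩
    have := periodLattice_latticeInvariants _ hl _ hτ
    rw [Prod.mk.eta, hinv] at this
    rw [this]
    ext z
    simp [mem_scaledPair_lattice]

end LocalPeriods


/-! ### The Bessel-type integral `∫ t^{-3/2} exp (-a²t - b²/t) dt` -/

section BesselIntegral

open Filter MeasureTheory Set
open scoped Topology

/-- The unnormalized error function. -/
noncomputable def gaussPrimitive (x : ℝ) : ℝ :=
  ∫ s in (0 : ℝ)..x, Real.exp (-s ^ 2)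

theorem hasDerivAt_gaussPrimitive (x : ℝ) :
    HasDerivAt gaussPrimitive (Real.exp (-x ^ 2)) x := by
  have hc : Continuous fun s : ℝ ↦ Real.exp (-s ^ 2) := by fun_prop
  exact intervalIntegral.integral_hasDerivAt_right (hc.intervalIntegrable _ _)
    hc.stronglyMeasurable.stronglyMeasurableAtFilter hc.continuousAt

theorem tendsto_gaussPrimitive_atTop :
    Tendsto gaussPrimitive atTop (𝓝 (√Real.pi / 2)) := by
  have h : IntegrableOn (fun s : ℝ ↦ Real.exp (-s ^ 2)) (Ioi 0) := by
    simpa using (integrable_exp_neg_mul_sq one_pos).integrableOn (s := Ioi (0 : ℝ))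
  have h1 := intervalIntegral_tendsto_integral_Ioi 0 h tendsto_id
  have h2 := integral_gaussian_Ioi 1
  simp only [neg_mul, one_mul, div_one] at h2
  rw [h2] at h1
  exact h1

theorem tendsto_gaussPrimitive_atBot :
    Tendsto gaussPrimitive atBot (𝓝 (-(√Real.pi / 2))) := by
  have h : ∀ x, gaussPrimitive x = -gaussPrimitive (-x) := by
    intro x
    have := intervalIntegral.integral_comp_neg (a := 0) (b := x) fun s : ℝ ↦ Real.exp (-s ^ 2)
    simp only [even_two, Even.neg_pow, neg_zero] at this
    rw [gaussPrimitive, this, intervalIntegral.integral_symm, gaussPrimitive]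
  rw [funext h]
  exact (tendsto_gaussPrimitive_atTop.comp tendsto_neg_atBot_atTop).neg

variable {a b : ℝ}

/-- An explicit primitive of `t^{-3/2} exp (-a²t - b²/t)`; it is extended to `t ≤ 0` by its limit
at `0`. -/
noncomputable def besselPrimitive (a b t : ℝ) : ℝ :=
  if t ≤ 0 then -(1 / b) * (Real.exp (2 * a * b) + Real.exp (-(2 * a * b))) * (√Real.pi / 2)
  else -(1 / b) * (Real.exp (2 * a * b) * gaussPrimitive (b / √t + a * √t) +
    Real.exp (-(2 * a * b)) * gaussPrimitive (b / √t - a * √t))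

theorem hasDerivAt_besselPrimitive (hb : 0 < b) {t : ℝ} (ht : 0 < t) :
    HasDerivAt (besselPrimitive a b)
      (t⁻¹ * (√t)⁻¹ * Real.exp (-(a ^ 2 * t) - b ^ 2 / t)) t := by
  have hs := Real.sqrt_pos.2 ht
  have hss := Real.sq_sqrt ht.le
  have h1 : HasDerivAt (fun t ↦ √t) (1 / (2 * √t)) t := Real.hasDerivAt_sqrt ht.ne'
  have h2 : HasDerivAt (fun t ↦ b / √t) (-(b * (1 / (2 * √t))) / √t ^ 2) t := by
    simpa using (hasDerivAt_const t b).fun_div h1 hs.ne'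
  have hu := (hasDerivAt_gaussPrimitive (b / √t + a * √t)).comp t (h2.add (h1.const_mul a))
  have hv := (hasDerivAt_gaussPrimitive (b / √t - a * √t)).comp t (h2.sub (h1.const_mul a))
  have h3 := ((hu.const_mul (Real.exp (2 * a * b))).add
    (hv.const_mul (Real.exp (-(2 * a * b))))).const_mul (-(1 / b))
  have e1 : Real.exp (2 * a * b) * Real.exp (-(b / √t + a * √t) ^ 2) =
      Real.exp (-(a ^ 2 * t) - b ^ 2 / t) := by
    rw [← Real.exp_add]
    congr 1
    field_simp
    rw [← hss]
    ring_nf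
    simp only [Real.sqrt_sq hs.le]
    ring
  have e2 : Real.exp (-(2 * a * b)) * Real.exp (-(b / √t - a * √t) ^ 2) =
      Real.exp (-(a ^ 2 * t) - b ^ 2 / t) := by
    rw [← Real.exp_add]
    congr 1
    field_simp
    rw [← hss]
    ring_nf
    simp only [Real.sqrt_sq hs.le]
    ring
  refine (h3.congr_deriv ?_).congr_of_eventuallyEq ?_
  · rw [← mul_assoc, ← mul_assoc, e1, e2, hss]
    field_simp
    ring
  · filter_upwards [lt_mem_nhds ht] with s hs
    simp [besselPrimitive, not_le.2 hs]

theorem continuousWithinAt_besselPrimitive (hb : 0 < b) :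
    ContinuousWithinAt (besselPrimitive a b) (Ici 0) 0 := by
  rw [← continuousWithinAt_Ioi_iff_Ici, ContinuousWithinAt]
  have h0 : Tendsto (fun t : ℝ ↦ √t) (𝓝[>] 0) (𝓝 0) := by
    have := (Real.continuous_sqrt.tendsto 0).mono_left (nhdsWithin_le_nhds (s := Ioi 0))
    simpa using this
  have h0' : Tendsto (fun t : ℝ ↦ √t) (𝓝[>] 0) (𝓝[>] 0) :=
    tendsto_nhdsWithin_iff.2 ⟨h0, eventually_nhdsWithin_of_forall fun t ht ↦ Real.sqrt_pos.2 ht⟩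
  have h1 : Tendsto (fun t : ℝ ↦ b / √t) (𝓝[>] 0) atTop :=
    (tendsto_inv_nhdsGT_zero.comp h0').const_mul_atTop hb
  have hu := tendsto_gaussPrimitive_atTop.comp (h1.atTop_add (h0.const_mul a))
  have hv := tendsto_gaussPrimitive_atTop.comp (h1.atTop_add ((h0.const_mul a).neg))
  have := ((hu.const_mul (Real.exp (2 * a * b))).add
    (hv.const_mul (Real.exp (-(2 * a * b))))).const_mul (-(1 / b))
  refine (this.congr' ?_).trans_eq ?_
  · filter_upwards [self_mem_nhdsWithin] with t ht
    simp [besselPrimitive, not_le.2 (mem_Ioi.1 ht), sub_eq_add_neg]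
  · simp only [besselPrimitive, le_refl, if_true]
    ring_nf

theorem tendsto_besselPrimitive (ha : 0 < a) :
    Tendsto (besselPrimitive a b) atTop
      (𝓝 (-(1 / b) * (Real.exp (2 * a * b) - Real.exp (-(2 * a * b))) * (√Real.pi / 2))) := by
  have h1 : Tendsto (fun t : ℝ ↦ b / √t) atTop (𝓝 0) :=
    tendsto_const_nhds.div_atTop Real.tendsto_sqrt_atTop
  have h2 : Tendsto (fun t : ℝ ↦ a * √t) atTop atTop := Real.tendsto_sqrt_atTop.const_mul_atTop ha
  have hu := tendsto_gaussPrimitive_atTop.comp (h1.add_atTop h2)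
  have hv := tendsto_gaussPrimitive_atBot.comp (h1.add_atBot (tendsto_neg_atTop_atBot.comp h2))
  have := ((hu.const_mul (Real.exp (2 * a * b))).add
    (hv.const_mul (Real.exp (-(2 * a * b))))).const_mul (-(1 / b))
  refine (this.congr' ?_).trans_eq ?_
  · filter_upwards [eventually_gt_atTop 0] with t ht
    simp [besselPrimitive, not_le.2 ht, sub_eq_add_neg]
  · ring_nf

theorem integrableOn_bessel (ha : 0 < a) (hb : 0 < b) :
    IntegrableOn (fun t ↦ t⁻¹ * (√t)⁻¹ * Real.exp (-(a ^ 2 * t) - b ^ 2 / t)) (Ioi 0) :=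
  integrableOn_Ioi_deriv_of_nonneg (continuousWithinAt_besselPrimitive hb)
    (fun _ ht ↦ hasDerivAt_besselPrimitive hb ht)
    (fun t ht ↦ by have := mem_Ioi.1 ht; positivity) (tendsto_besselPrimitive ha)

/-- The case `K_{1/2}` of the Bessel integral, in which it is elementary. -/
theorem integral_bessel (ha : 0 < a) (hb : 0 < b) :
    ∫ t in Ioi 0, t⁻¹ * (√t)⁻¹ * Real.exp (-(a ^ 2 * t) - b ^ 2 / t) =
      √Real.pi / b * Real.exp (-(2 * a * b)) := by
  rw [integral_Ioi_of_hasDerivAt_of_nonneg (continuousWithinAt_besselPrimitive hb)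
    (fun _ ht ↦ hasDerivAt_besselPrimitive hb ht)
    (fun t ht ↦ by have := mem_Ioi.1 ht; positivity) (tendsto_besselPrimitive ha)]
  simp only [besselPrimitive, le_refl, if_true]
  ring

end BesselIntegral


/-! ### The rapidly decaying part of the Epstein theta function -/

section KroneckerKernel

open Filter MeasureTheory Set Asymptotics
open scoped Topology

theorem summable_exp_neg_mul_succ {c : ℝ} (hc : 0 < c) :
    Summable fun n : ℕ ↦ Real.exp (-c * (n + 1)) := by
  have h := (Real.summable_exp_nat_mul_iff.2 (neg_lt_zero.2 hc)).mul_left (Real.exp (-c))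
  refine h.congr fun n ↦ ?_
  rw [← Real.exp_add]
  ring_nf

theorem exp_neg_mul_succ_sq_le {c : ℝ} (hc : 0 < c) (n : ℕ) :
    Real.exp (-c * (n + 1) ^ 2) ≤ Real.exp (-c * (n + 1)) := by
  refine Real.exp_le_exp.2 ?_
  have h : (n + 1 : ℝ) ≤ (n + 1) ^ 2 := by nlinarith [(Nat.cast_nonneg n : (0 : ℝ) ≤ n)]
  nlinarith

theorem summable_exp_neg_mul_succ_sq {c : ℝ} (hc : 0 < c) :
    Summable fun n : ℕ ↦ Real.exp (-c * (n + 1) ^ 2) :=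
  Summable.of_nonneg_of_le (fun _ ↦ (Real.exp_pos _).le) (exp_neg_mul_succ_sq_le hc)
    (summable_exp_neg_mul_succ hc)

theorem tsum_exp_neg_mul_succ_sq_le {c : ℝ} (hc : 0 < c) :
    ∑' n : ℕ, Real.exp (-c * (n + 1) ^ 2) ≤ Real.exp (-c / 2) / c := by
  have h1 : Real.exp (-c) < 1 := Real.exp_lt_one_iff.2 (neg_lt_zero.2 hc)
  have h2 : HasSum (fun n : ℕ ↦ Real.exp (-c * (n + 1)))
      (Real.exp (-c) * (1 - Real.exp (-c))⁻¹) := by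
    refine ((hasSum_geometric_of_lt_one (Real.exp_pos _).le h1).mul_left (Real.exp (-c))).congr_fun
      fun n ↦ ?_
    rw [← Real.exp_nat_mul, ← Real.exp_add]
    ring_nf
  refine ((summable_exp_neg_mul_succ_sq hc).tsum_le_tsum (exp_neg_mul_succ_sq_le hc)
    h2.summable).trans ?_
  rw [h2.tsum_eq, ← div_eq_mul_inv, div_le_div_iff₀ (by linarith) hc]
  -- the inequality is `c / 2 ≤ sinh (c / 2)`
  have h3 : c / 2 ≤ Real.sinh (c / 2) := Real.self_le_sinh_iff.2 (by positivity)
  rw [Real.sinh_eq] at h3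
  have e1 : Real.exp (-c) = Real.exp (-c / 2) * Real.exp (-(c / 2)) := by
    rw [← Real.exp_add]; ring_nf
  have e2 : Real.exp (-c / 2) * Real.exp (c / 2) = 1 := by
    rw [← Real.exp_add]; ring_nf; simp
  have e3 : Real.exp (-c / 2) = Real.exp (-(c / 2)) := by ring_nf
  have hp := Real.exp_pos (-c / 2)
  rw [e1]
  rw [e3] at e2 hp ⊢
  have h4 := mul_le_mul_of_nonneg_left h3 (mul_pos hp hp).le
  linear_combination 2 * h4 + Real.exp (-(c / 2)) * e2

variable (x y : ℝ)

/-- The terms with `m = p.1 + 1`, `k = ±(p.2 + 1)` of the theta series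
`∑ exp (-π t |n + m τ|²)`, `τ = x + i y`, after Poisson summation over `n`. -/
noncomputable def kroneckerTerm (p : ℕ × ℕ) (t : ℝ) : ℝ :=
  2 * Real.cos (2 * Real.pi * ((p.1 + 1) * x) * (p.2 + 1)) *
    ((√t)⁻¹ * (Real.exp (-(Real.pi * y ^ 2 * t) * (p.1 + 1) ^ 2) *
      Real.exp (-(Real.pi / t) * (p.2 + 1) ^ 2)))

/-- The part of the theta series of the quadratic form `|n + m τ|²` that decays rapidly at both `0`
and `∞`: after Poisson summation over `n`, the terms with `m ≥ 1` and nonzero frequency. -/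
noncomputable def kroneckerKernel (t : ℝ) : ℝ :=
  ∑' p, kroneckerTerm x y p t

variable {x y}

theorem norm_kroneckerTerm_le (p : ℕ × ℕ) (t : ℝ) :
    ‖kroneckerTerm x y p t‖ ≤ 2 * ((√t)⁻¹ * (Real.exp (-(Real.pi * y ^ 2 * t) * (p.1 + 1) ^ 2) *
      Real.exp (-(Real.pi / t) * (p.2 + 1) ^ 2))) := by
  have h0 : 0 ≤ (√t)⁻¹ := inv_nonneg.2 (Real.sqrt_nonneg t)
  rw [kroneckerTerm, norm_mul, norm_mul, Real.norm_of_nonneg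
    (mul_nonneg h0 (mul_pos (Real.exp_pos _) (Real.exp_pos _)).le)]
  refine mul_le_mul_of_nonneg_right ?_
    (mul_nonneg h0 (mul_pos (Real.exp_pos _) (Real.exp_pos _)).le)
  have := Real.abs_cos_le_one (2 * Real.pi * ((p.1 + 1) * x) * (p.2 + 1))
  simp only [Real.norm_eq_abs, abs_two]
  linarith

theorem hasSum_kroneckerTerm_bound (hy : 0 < y) {t : ℝ} (ht : 0 < t) :
    HasSum (fun p : ℕ × ℕ ↦ 2 * ((√t)⁻¹ * (Real.exp (-(Real.pi * y ^ 2 * t) * (p.1 + 1) ^ 2) *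
      Real.exp (-(Real.pi / t) * (p.2 + 1) ^ 2))))
      (2 * ((√t)⁻¹ * ((∑' m : ℕ, Real.exp (-(Real.pi * y ^ 2 * t) * (m + 1) ^ 2)) *
        ∑' k : ℕ, Real.exp (-(Real.pi / t) * (k + 1) ^ 2)))) := by
  have h1 := summable_exp_neg_mul_succ_sq (c := Real.pi * y ^ 2 * t) (by positivity)
  have h2 := summable_exp_neg_mul_succ_sq (c := Real.pi / t) (by positivity)
  exact ((h1.hasSum.mul h2.hasSum (h1.mul_of_nonneg h2 (fun _ ↦ (Real.exp_pos _).le)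
    (fun _ ↦ (Real.exp_pos _).le))).mul_left _).mul_left _

theorem hasSum_kroneckerKernel (hy : 0 < y) {t : ℝ} (ht : 0 < t) :
    HasSum (fun p ↦ kroneckerTerm x y p t) (kroneckerKernel x y t) :=
  (Summable.of_norm_bounded (hasSum_kroneckerTerm_bound hy ht).summable
    fun p ↦ norm_kroneckerTerm_le p t).hasSum

/-- The factors `t` and `1 / t` of the two one-variable estimates cancel, which leaves exponential
decay at both ends. -/
theorem norm_kroneckerKernel_le (hy : 0 < y) {t : ℝ} (ht : 0 < t) :
    ‖kroneckerKernel x y t‖ ≤ 2 / (Real.pi ^ 2 * y ^ 2) *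
      ((√t)⁻¹ * (Real.exp (-(Real.pi * y ^ 2 / 2) * t) * Real.exp (-(Real.pi / 2) / t))) := by
  have h0 : 0 ≤ (√t)⁻¹ := inv_nonneg.2 (Real.sqrt_nonneg t)
  refine (tsum_of_norm_bounded (hasSum_kroneckerTerm_bound hy ht)
    fun p ↦ norm_kroneckerTerm_le p t).trans ?_
  have h1 := tsum_exp_neg_mul_succ_sq_le (c := Real.pi * y ^ 2 * t) (by positivity)
  have h2 := tsum_exp_neg_mul_succ_sq_le (c := Real.pi / t) (by positivity)
  calc _ ≤ 2 * ((√t)⁻¹ * ((Real.exp (-(Real.pi * y ^ 2 * t) / 2) / (Real.pi * y ^ 2 * t)) *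
        (Real.exp (-(Real.pi / t) / 2) / (Real.pi / t)))) := by
        gcongr
    _ = _ := by
        have e1 : -(Real.pi * y ^ 2 * t) / 2 = -(Real.pi * y ^ 2 / 2) * t := by ring
        have e2 : -(Real.pi / t) / 2 = -(Real.pi / 2) / t := by ring
        rw [e1, e2]
        field_simp

theorem continuousOn_kroneckerTerm (p : ℕ × ℕ) : ContinuousOn (kroneckerTerm x y p) (Ioi 0) := by
  unfold kroneckerTerm
  have h : ∀ t ∈ Ioi (0 : ℝ), t ≠ 0 := fun t ht ↦ (mem_Ioi.1 ht).ne'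
  have h' : ∀ t ∈ Ioi (0 : ℝ), √t ≠ 0 := fun t ht ↦ (Real.sqrt_pos.2 ht).ne'
  fun_prop (disch := assumption)

theorem aestronglyMeasurable_kroneckerKernel (hy : 0 < y) :
    AEStronglyMeasurable (kroneckerKernel x y) (volume.restrict (Ioi 0)) := by
  refine aestronglyMeasurable_of_tendsto_ae (atTop : Filter (Finset (ℕ × ℕ)))
    (f := fun s t ↦ ∑ p ∈ s, kroneckerTerm x y p t) (fun s ↦ ?_) ?_
  · exact (continuousOn_finsetSum s fun p _ ↦
      continuousOn_kroneckerTerm p).aestronglyMeasurable measurableSet_Ioi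
  · filter_upwards [ae_restrict_mem measurableSet_Ioi] with t ht
    exact hasSum_kroneckerKernel hy ht

theorem locallyIntegrableOn_kroneckerKernel (hy : 0 < y) :
    LocallyIntegrableOn (kroneckerKernel x y) (Ioi 0) := by
  have h : ∀ t ∈ Ioi (0 : ℝ), t ≠ 0 := fun t ht ↦ (mem_Ioi.1 ht).ne'
  have h' : ∀ t ∈ Ioi (0 : ℝ), √t ≠ 0 := fun t ht ↦ (Real.sqrt_pos.2 ht).ne'
  have hc : ContinuousOn (fun t : ℝ ↦ 2 / (Real.pi ^ 2 * y ^ 2) *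
      ((√t)⁻¹ * (Real.exp (-(Real.pi * y ^ 2 / 2) * t) * Real.exp (-(Real.pi / 2) / t))))
      (Ioi 0) := by
    fun_prop (disch := assumption)
  have hi := hc.locallyIntegrableOn (μ := volume) measurableSet_Ioi
  rw [locallyIntegrableOn_iff isOpen_Ioi.isLocallyClosed] at hi ⊢
  intro k hk hkc
  refine (hi k hk hkc).mono' ((aestronglyMeasurable_kroneckerKernel hy).mono_set hk) ?_
  filter_upwards [ae_restrict_mem hkc.measurableSet] with t ht
  exact norm_kroneckerKernel_le hy (hk ht)

theorem isBigO_kroneckerKernel_atTop (hy : 0 < y) :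
    kroneckerKernel x y =O[atTop] fun t ↦ Real.exp (-(Real.pi * y ^ 2 / 2) * t) := by
  refine IsBigO.of_bound (2 / (Real.pi ^ 2 * y ^ 2)) ?_
  filter_upwards [eventually_ge_atTop 1] with t ht
  refine (norm_kroneckerKernel_le hy (by linarith)).trans ?_
  have h1 : (√t)⁻¹ ≤ 1 := inv_le_one_of_one_le₀ (Real.one_le_sqrt.2 ht)
  have h2 : Real.exp (-(Real.pi / 2) / t) ≤ 1 := Real.exp_le_one_iff.2 (by
    rw [neg_div]; exact neg_nonpos.2 (by positivity))
  have h3 := Real.exp_pos (-(Real.pi * y ^ 2 / 2) * t)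
  rw [Real.norm_of_nonneg h3.le]
  gcongr
  calc (√t)⁻¹ * (Real.exp (-(Real.pi * y ^ 2 / 2) * t) * Real.exp (-(Real.pi / 2) / t))
      ≤ 1 * (Real.exp (-(Real.pi * y ^ 2 / 2) * t) * 1) := by gcongr
    _ = _ := by ring

theorem isBigO_kroneckerKernel_zero (hy : 0 < y) (n : ℕ) :
    kroneckerKernel x y =O[𝓝[>] 0] fun t ↦ t ^ (-((1 / 2 : ℝ) - n)) := by
  refine IsBigO.of_bound (2 / (Real.pi ^ 2 * y ^ 2) * n.factorial) ?_
  filter_upwards [self_mem_nhdsWithin] with t ht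
  have ht : 0 < t := ht
  refine (norm_kroneckerKernel_le hy ht).trans ?_
  have h1 : Real.exp (-(Real.pi * y ^ 2 / 2) * t) ≤ 1 := Real.exp_le_one_iff.2 (by
    rw [neg_mul]; exact neg_nonpos.2 (by positivity))
  have h2 : Real.exp (-(Real.pi / 2) / t) ≤ n.factorial * t ^ n := by
    have h3 := Real.pow_div_factorial_le_exp (Real.pi / 2 / t) (by positivity) n
    have h4 : (1 / t) ^ n ≤ (Real.pi / 2 / t) ^ n := by
      gcongr
      linarith [Real.pi_gt_three]
    have h5 : 0 < (n.factorial : ℝ) := by positivity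
    have h6 : (1 / t) ^ n / n.factorial ≤ Real.exp (Real.pi / 2 / t) := le_trans (by gcongr) h3
    rw [neg_div, Real.exp_neg, inv_le_comm₀ (Real.exp_pos _) (by positivity)]
    refine le_trans (le_of_eq ?_) h6
    rw [one_div, inv_pow, mul_inv]
    field_simp
  have h7 : t ^ (-((1 / 2 : ℝ) - n)) = (√t)⁻¹ * t ^ n := by
    rw [Real.sqrt_eq_rpow, ← Real.rpow_neg ht.le, ← Real.rpow_natCast t n, ← Real.rpow_add ht]
    ring_nf
  rw [h7, Real.norm_of_nonneg (by positivity), mul_assoc]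
  gcongr 2 / (Real.pi ^ 2 * y ^ 2) * ?_
  calc (√t)⁻¹ * (Real.exp (-(Real.pi * y ^ 2 / 2) * t) * Real.exp (-(Real.pi / 2) / t))
      ≤ (√t)⁻¹ * (1 * (n.factorial * t ^ n)) := by gcongr
    _ = _ := by ring

theorem exists_nat_half_sub_lt (s : ℝ) : ∃ n : ℕ, (1 / 2 : ℝ) - n < s := by
  obtain ⟨n, hn⟩ := exists_nat_gt (1 / 2 - s)
  exact ⟨n, by linarith⟩

theorem differentiable_mellin_kroneckerKernel (hy : 0 < y) :
    Differentiable ℂ (mellin fun t ↦ (kroneckerKernel x y t : ℂ)) := by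
  intro s
  obtain ⟨n, hn⟩ := exists_nat_half_sub_lt s.re
  refine mellin_differentiableAt_of_isBigO_rpow_exp (a := Real.pi * y ^ 2 / 2) (by positivity)
    ?_ ?_ ?_ hn
  · have := locallyIntegrableOn_kroneckerKernel (x := x) hy
    rw [locallyIntegrableOn_iff isOpen_Ioi.isLocallyClosed] at this ⊢
    exact fun k hk hkc ↦ (this k hk hkc).ofReal
  · exact isBigO_ofReal_left.2 (isBigO_kroneckerKernel_atTop hy)
  · exact isBigO_ofReal_left.2 (isBigO_kroneckerKernel_zero hy n)

theorem mellinConvergent_kroneckerKernel (hy : 0 < y) (s : ℂ) :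
    MellinConvergent (fun t ↦ (kroneckerKernel x y t : ℂ)) s := by
  obtain ⟨n, hn⟩ := exists_nat_half_sub_lt s.re
  refine mellinConvergent_of_isBigO_rpow_exp (a := Real.pi * y ^ 2 / 2) (by positivity)
    ?_ ?_ ?_ hn
  · have := locallyIntegrableOn_kroneckerKernel (x := x) hy
    rw [locallyIntegrableOn_iff isOpen_Ioi.isLocallyClosed] at this ⊢
    exact fun k hk hkc ↦ (this k hk hkc).ofReal
  · exact isBigO_ofReal_left.2 (isBigO_kroneckerKernel_atTop hy)
  · exact isBigO_ofReal_left.2 (isBigO_kroneckerKernel_zero hy n)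

/-- The holomorphic function whose real part is the value at `s = 0` of the Mellin transform of
`kroneckerKernel` (it equals `-2 log ∏ (1 - q ^ m)`, `q = exp (2πiτ)`). -/
noncomputable def kroneckerLog (τ : ℂ) : ℂ :=
  ∑' p : ℕ × ℕ, 2 / (p.2 + 1 : ℂ) * cexp (2 * Real.pi * I * ((p.1 + 1) * (p.2 + 1)) * τ)

theorem summable_exp_neg_mul_succ_mul_succ {c : ℝ} (hc : 0 < c) :
    Summable fun p : ℕ × ℕ ↦ 2 * Real.exp (-c * ((p.1 + 1) * (p.2 + 1))) := by
  have h := (Real.summable_exp_nat_mul_iff.2 (neg_lt_zero.2 hc))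
  refine Summable.of_nonneg_of_le (fun _ ↦ by positivity) (fun p ↦ ?_)
    ((h.mul_of_nonneg h (fun _ ↦ (Real.exp_pos _).le) (fun _ ↦ (Real.exp_pos _).le)).mul_left 2)
  rw [← Real.exp_add]
  gcongr
  have h1 : (0 : ℝ) ≤ p.1 := Nat.cast_nonneg _
  have h2 : (0 : ℝ) ≤ p.2 := Nat.cast_nonneg _
  nlinarith [mul_nonneg h1 h2, mul_nonneg hc.le (mul_nonneg h1 h2)]

theorem norm_kroneckerLog_term_le {δ : ℝ} {τ : ℂ} (h : δ ≤ τ.im) (p : ℕ × ℕ) :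
    ‖2 / (p.2 + 1 : ℂ) * cexp (2 * Real.pi * I * ((p.1 + 1) * (p.2 + 1)) * τ)‖ ≤
      2 * Real.exp (-(2 * Real.pi * δ) * ((p.1 + 1) * (p.2 + 1))) := by
  have e : (2 * Real.pi * I * ((p.1 + 1) * (p.2 + 1)) * τ : ℂ) =
      ((2 * Real.pi * ((p.1 + 1) * (p.2 + 1)) : ℝ) : ℂ) * (I * τ) := by push_cast; ring
  rw [norm_mul, norm_exp, e, re_ofReal_mul, norm_div]
  have h1 : ‖(p.2 + 1 : ℂ)‖ = p.2 + 1 := by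
    rw [show (p.2 + 1 : ℂ) = ((p.2 + 1 : ℕ) : ℂ) by push_cast; ring, norm_natCast]; push_cast; ring
  rw [h1]
  have h2 : ‖(2 : ℂ)‖ / (p.2 + 1 : ℝ) ≤ 2 := by
    rw [Complex.norm_two]
    exact div_le_self (by norm_num) (by linarith [(Nat.cast_nonneg p.2 : (0 : ℝ) ≤ p.2)])
  have : 0 ≤ 2 * Real.pi * ((p.1 + 1) * (p.2 + 1) : ℝ) := by positivity
  refine mul_le_mul h2 (Real.exp_le_exp.2 ?_) (Real.exp_pos _).le zero_le_two
  simp only [mul_re, I_re, I_im, zero_mul, one_mul, zero_sub]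
  nlinarith [mul_le_mul_of_nonneg_left h this]

theorem differentiableOn_kroneckerLog : DifferentiableOn ℂ kroneckerLog {τ | 0 < τ.im} := by
  intro τ hτ
  have hτ : 0 < τ.im := hτ
  have ho : IsOpen {z : ℂ | τ.im / 2 < z.im} := isOpen_lt continuous_const continuous_im
  have h := differentiableOn_tsum_of_summable_norm
    (F := fun (p : ℕ × ℕ) (z : ℂ) ↦
      2 / (p.2 + 1 : ℂ) * cexp (2 * Real.pi * I * ((p.1 + 1) * (p.2 + 1)) * z))
    (summable_exp_neg_mul_succ_mul_succ (c := 2 * Real.pi * (τ.im / 2)) (by positivity))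
    (fun p ↦ by fun_prop) ho (fun p w hw ↦ norm_kroneckerLog_term_le (le_of_lt hw) p)
  exact (h.differentiableAt (ho.mem_nhds (half_lt_self hτ))).differentiableWithinAt

theorem mellin_kroneckerKernel_zero (hy : 0 < y) :
    mellin (fun t ↦ (kroneckerKernel x y t : ℂ)) 0 = ((kroneckerLog (x + y * I)).re : ℂ) := by
  have hf : ∀ p : ℕ × ℕ, ∀ t ∈ Ioi (0 : ℝ), t⁻¹ * kroneckerTerm x y p t =
      2 * Real.cos (2 * Real.pi * ((p.1 + 1) * x) * (p.2 + 1)) * (t⁻¹ * (√t)⁻¹ * Real.exp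
        (-((√Real.pi * y * (p.1 + 1)) ^ 2 * t) - (√Real.pi * (p.2 + 1)) ^ 2 / t)) := by
    intro p t ht
    have hp := Real.sq_sqrt Real.pi_pos.le
    rw [kroneckerTerm, ← Real.exp_add, mul_pow, mul_pow, mul_pow, hp]
    ring_nf
  have hpi := Real.sqrt_pos.2 Real.pi_pos
  have ha : ∀ p : ℕ × ℕ, 0 < √Real.pi * y * (p.1 + 1) := fun p ↦ by positivity
  have hb : ∀ p : ℕ × ℕ, 0 < √Real.pi * (p.2 + 1) := fun p ↦ by positivity
  have hint : ∀ p, IntegrableOn (fun t ↦ t⁻¹ * kroneckerTerm x y p t) (Ioi 0) := fun p ↦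
    IntegrableOn.congr_fun ((integrableOn_bessel (ha p) (hb p)).const_mul _)
      (fun t ht ↦ (hf p t ht).symm) measurableSet_Ioi
  have hval : ∀ p : ℕ × ℕ, √Real.pi / (√Real.pi * (p.2 + 1)) *
      Real.exp (-(2 * (√Real.pi * y * (p.1 + 1)) * (√Real.pi * (p.2 + 1)))) =
      1 / (p.2 + 1) * Real.exp (-(2 * Real.pi * y) * ((p.1 + 1) * (p.2 + 1))) := by
    intro p
    have e : -(2 * (√Real.pi * y * (p.1 + 1)) * (√Real.pi * (p.2 + 1))) =
        -(2 * Real.pi * y) * ((p.1 + 1) * (p.2 + 1)) := by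
      linear_combination (-(2 * y * (p.1 + 1) * (p.2 + 1))) * Real.sq_sqrt Real.pi_pos.le
    rw [e]
    field_simp
  have hI : ∀ p : ℕ × ℕ, ∫ t in Ioi 0, t⁻¹ * kroneckerTerm x y p t =
      2 * Real.cos (2 * Real.pi * ((p.1 + 1) * x) * (p.2 + 1)) *
        (1 / (p.2 + 1) * Real.exp (-(2 * Real.pi * y) * ((p.1 + 1) * (p.2 + 1)))) := by
    intro p
    rw [setIntegral_congr_fun measurableSet_Ioi (hf p), integral_const_mul,
      integral_bessel (ha p) (hb p), hval]
  have hN : Summable fun p : ℕ × ℕ ↦ ∫ t in Ioi 0, ‖t⁻¹ * kroneckerTerm x y p t‖ := by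
    refine Summable.of_nonneg_of_le (fun p ↦ integral_nonneg fun _ ↦ norm_nonneg _) (fun p ↦ ?_)
      (summable_exp_neg_mul_succ_mul_succ (c := 2 * Real.pi * y) (by positivity))
    have h1 : ∫ t in Ioi 0, ‖t⁻¹ * kroneckerTerm x y p t‖ =
        |2 * Real.cos (2 * Real.pi * ((p.1 + 1) * x) * (p.2 + 1))| *
          (1 / (p.2 + 1) * Real.exp (-(2 * Real.pi * y) * ((p.1 + 1) * (p.2 + 1)))) := by
      rw [← hval, ← integral_bessel (ha p) (hb p), ← integral_const_mul]
      refine setIntegral_congr_fun measurableSet_Ioi fun t ht ↦ ?_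
      have ht : 0 < t := ht
      rw [hf p t ht, norm_mul, Real.norm_eq_abs, Real.norm_of_nonneg]
      positivity
    rw [h1, abs_mul, abs_two, mul_assoc]
    have h2 := Real.abs_cos_le_one (2 * Real.pi * ((p.1 + 1) * x) * (p.2 + 1))
    have h3 : 1 / (p.2 + 1 : ℝ) ≤ 1 :=
      div_le_self zero_le_one (by linarith [(Nat.cast_nonneg p.2 : (0 : ℝ) ≤ p.2)])
    calc _ ≤ 2 * (1 * (1 * Real.exp (-(2 * Real.pi * y) * ((p.1 + 1) * (p.2 + 1))))) := by gcongr
      _ = _ := by ring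
  have hS := hasSum_integral_of_summable_integral_norm hint hN
  have hL : mellin (fun t ↦ (kroneckerKernel x y t : ℂ)) 0 =
      ((∫ t in Ioi 0, ∑' p, t⁻¹ * kroneckerTerm x y p t : ℝ) : ℂ) := by
    rw [mellin, ← integral_complex_ofReal]
    refine setIntegral_congr_fun measurableSet_Ioi fun t ht ↦ ?_
    simp only [tsum_mul_left, zero_sub, cpow_neg_one, smul_eq_mul, kroneckerKernel]
    push_cast
    rfl
  rw [hL, ← hS.tsum_eq]
  have hτ : y ≤ (x + y * I : ℂ).im := by simp
  have hs := Summable.of_norm_bounded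
    (summable_exp_neg_mul_succ_mul_succ (c := 2 * Real.pi * y) (by positivity))
    (norm_kroneckerLog_term_le hτ)
  rw [kroneckerLog, re_tsum hs]
  congr 2
  ext p
  rw [hI]
  have e : (2 * Real.pi * I * ((p.1 + 1) * (p.2 + 1)) * (x + y * I) : ℂ) =
      ((-(2 * Real.pi * y) * ((p.1 + 1) * (p.2 + 1)) : ℝ) : ℂ) +
      ((2 * Real.pi * ((p.1 + 1) * x) * (p.2 + 1) : ℝ) : ℂ) * I := by
    push_cast
    linear_combination (2 * Real.pi * ((p.1 + 1) * (p.2 + 1)) * y : ℂ) * I_sq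
  have e2 : (2 / (p.2 + 1 : ℂ)) = ((2 / (p.2 + 1) : ℝ) : ℂ) := by push_cast; rfl
  rw [e, e2, re_ofReal_mul, exp_re]
  simp only [add_re, ofReal_re, add_im, ofReal_im, mul_re, mul_im, I_re, I_im, mul_zero, mul_one,
    sub_zero, add_zero, zero_add]
  ring

end KroneckerKernel


/-! ### The Epstein zeta function of `|n + m τ|²` -/

section Epstein

open Filter MeasureTheory Set Asymptotics HurwitzZeta
open scoped Topology

theorem hasSum_prod_of_nonneg {α β : Type*} {f : α × β → ℝ} (hf : 0 ≤ f) {g : α → ℝ} {a : ℝ}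
    (h₁ : ∀ i, HasSum (fun j ↦ f (i, j)) (g i)) (h₂ : HasSum g a) : HasSum f a := by
  have hs : Summable f := (summable_prod_of_nonneg hf).2
    ⟨fun i ↦ (h₁ i).summable, by simpa only [(h₁ _).tsum_eq] using h₂.summable⟩
  exact (hs.hasSum.prod_fiberwise h₁).unique h₂ ▸ hs.hasSum

/-- The quadratic form `|n + m (x + i y)|²`, at `p = (m, n)`. -/
noncomputable def epsteinForm (x y : ℝ) (p : ℤ × ℤ) : ℝ :=
  (p.2 + p.1 * x) ^ 2 + (p.1 * y) ^ 2

variable {x y : ℝ}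

theorem epsteinForm_nonneg (p : ℤ × ℤ) : 0 ≤ epsteinForm x y p := by
  unfold epsteinForm; positivity

theorem epsteinForm_pos (hy : 0 < y) {p : ℤ × ℤ} (hp : p ≠ 0) : 0 < epsteinForm x y p := by
  refine (epsteinForm_nonneg p).lt_of_ne fun h ↦ hp ?_
  have h1 : (p.1 * y : ℝ) = 0 := by
    unfold epsteinForm at h
    nlinarith [sq_nonneg (p.2 + p.1 * x : ℝ), sq_nonneg (p.1 * y : ℝ)]
  have h2 : p.1 = 0 := by
    rcases mul_eq_zero.1 h1 with h | h
    · exact_mod_cast h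
    · exact absurd h hy.ne'
  have h3 : p.2 = 0 := by
    simp only [epsteinForm, h2, Int.cast_zero, zero_mul, add_zero] at h
    have h4 : (p.2 : ℝ) ^ 2 = 0 := by linarith
    exact_mod_cast pow_eq_zero_iff two_ne_zero |>.1 h4
  exact Prod.ext h2 h3

theorem summable_epsteinForm_rpow (hy : 0 < y) {σ : ℝ} (hσ : 1 < σ) :
    Summable fun p ↦ epsteinForm x y p ^ (-σ) := by
  have h1 := EisensteinSeries.summable_one_div_norm_rpow (k := 2 * σ) (by linarith)
  let z : UpperHalfPlane := ⟨x + y * I, by simpa using hy⟩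
  have h2 : Summable fun v : Fin 2 → ℤ ↦ ‖v 0 * (z : ℂ) + v 1‖ ^ (-(2 * σ)) :=
    Summable.of_nonneg_of_le (fun v ↦ by positivity)
      (fun v ↦ EisensteinSeries.summand_bound z (by linarith) v) (h1.mul_left _)
  rw [← (finTwoArrowEquiv ℤ).symm.summable_iff] at h2
  refine h2.congr fun p ↦ ?_
  have e : ‖((p.1 : ℤ) : ℂ) * (z : ℂ) + (p.2 : ℤ)‖ ^ 2 = epsteinForm x y p := by
    rw [← normSq_eq_norm_sq, normSq_apply]
    simp [z, epsteinForm]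
    ring
  simp only [Function.comp_apply, finTwoArrowEquiv_symm_apply, Matrix.cons_val_zero,
    Matrix.cons_val_one, Matrix.cons_val_fin_one]
  rw [← e, ← Real.rpow_natCast, ← Real.rpow_mul (norm_nonneg _)]
  congr 1
  push_cast
  ring

theorem summable_epsteinForm_cpow (hy : 0 < y) {s : ℂ} (hs : 1 < s.re) :
    Summable fun p ↦ (epsteinForm x y p : ℂ) ^ (-s) := by
  refine (summable_epsteinForm_rpow (x := x) hy hs).of_norm_bounded fun p ↦ ?_
  refine (norm_cpow_eq_rpow_re_of_nonneg (epsteinForm_nonneg p) ?_).le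
  rw [neg_re]
  linarith

/-- The theta series `∑_{m ≥ 1} exp (-π m² t)`. -/
noncomputable def halfTheta (t : ℝ) : ℝ := (evenKernel 0 t - 1) / 2

theorem hasSum_halfTheta {t : ℝ} (ht : 0 < t) :
    HasSum (fun m : ℕ ↦ Real.exp (-Real.pi * (m + 1) ^ 2 * t)) (halfTheta t) := by
  have h := (hasSum_nat_cosKernel₀ 0 ht).div_const 2
  simp only [mul_zero, zero_mul, Real.cos_zero, mul_one] at h
  rw [halfTheta, evenKernel_eq_cosKernel_of_zero]
  refine (by simpa using h : HasSum _ ((cosKernel 0 t - 1) / 2)).congr_fun fun m ↦ ?_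
  ring_nf

theorem hasMellin_halfTheta {s : ℂ} (hs : 1 / 2 < s.re) :
    HasMellin (fun t ↦ (halfTheta t : ℂ)) s (completedRiemannZeta (2 * s)) := by
  have h := (hurwitzEvenFEPair 0).hasMellin (s := s) hs
  have h2 := hasMellin_const_smul h.1 (1 / 2 : ℂ)
  rw [h.2] at h2
  have e : completedRiemannZeta (2 * s) = (1 / 2 : ℂ) • (hurwitzEvenFEPair 0).Λ s := by
    rw [completedRiemannZeta, completedHurwitzZetaEven, mul_div_cancel_left₀ _ two_ne_zero,
      smul_eq_mul]
    ring
  have e2 : (fun t ↦ (halfTheta t : ℂ)) = fun t ↦ (1 / 2 : ℂ) •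
      ((hurwitzEvenFEPair 0).f t - (hurwitzEvenFEPair 0).f₀) := by
    ext t
    simp only [halfTheta, hurwitzEvenFEPair, Function.comp_apply, if_true, smul_eq_mul]
    push_cast
    ring
  rwa [e, e2]

/-- The terms of frequency `0` after Poisson summation in `n`. -/
theorem hasMellin_frequency_zero (hy : 0 < y) {s : ℂ} (hs : 1 < s.re) :
    HasMellin (fun t ↦ (t : ℂ) ^ (-(1 / 2) : ℂ) • (halfTheta (y ^ 2 * t) : ℂ)) s
      ((y : ℂ) ^ (1 - 2 * s) * completedRiemannZeta (2 * s - 1)) := by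
  have hy2 : 0 < y ^ 2 := by positivity
  have hs' : 1 / 2 < (s + -(1 / 2) : ℂ).re := by
    simp only [add_re, neg_re, one_div, inv_re, re_ofNat, normSq_ofNat]
    linarith
  have h := hasMellin_halfTheta hs'
  refine ⟨?_, ?_⟩
  · rw [MellinConvergent.cpow_smul,
      MellinConvergent.comp_mul_left (f := fun t ↦ (halfTheta t : ℂ)) hy2]
    exact h.1
  · rw [mellin_cpow_smul, mellin_comp_mul_left (fun t ↦ (halfTheta t : ℂ)) _ hy2, h.2, smul_eq_mul]
    congr 1
    · rw [ofReal_pow, ← cpow_nat_mul' (by rw [arg_ofReal_of_nonneg hy.le]; simp [Real.pi_pos])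
        (by rw [arg_ofReal_of_nonneg hy.le]; simp [Real.pi_pos.le])]
      congr 1
      push_cast
      ring
    · congr 1
      ring

/-- Poisson summation in `n`, on the rows `m ≥ 1`. -/
theorem hasSum_exp_epsteinForm (hy : 0 < y) {t : ℝ} (ht : 0 < t) :
    HasSum (fun p : ℕ × ℤ ↦ Real.exp (-Real.pi * epsteinForm x y (p.1 + 1, p.2) * t))
      (kroneckerKernel x y t + (√t)⁻¹ * halfTheta (y ^ 2 * t)) := by
  have ht' : 0 < 1 / t := by positivity
  have hK := hasSum_kroneckerKernel (x := x) hy ht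
  have hfib : ∀ m : ℕ, HasSum (fun k ↦ kroneckerTerm x y (m, k) t)
      ((√t)⁻¹ * Real.exp (-Real.pi * (m + 1) ^ 2 * (y ^ 2 * t)) *
        (cosKernel ((m + 1) * x : ℝ) (1 / t) - 1)) := by
    intro m
    refine ((hasSum_nat_cosKernel₀ ((m + 1) * x) ht').mul_left _).congr_fun fun k ↦ ?_
    rw [kroneckerTerm]
    ring_nf
  refine hasSum_prod_of_nonneg (fun _ ↦ (Real.exp_pos _).le) (fun m ↦ ?_)
    ((hK.prod_fiberwise hfib).add ((hasSum_halfTheta (by positivity)).mul_left _))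
  have h := (hasSum_int_evenKernel ((m + 1) * x) ht).mul_left
    (Real.exp (-Real.pi * (m + 1) ^ 2 * (y ^ 2 * t)))
  rw [evenKernel_functional_equation, ← Real.sqrt_eq_rpow] at h
  have e : ∀ E c : ℝ, E * (1 / √t * c) = (√t)⁻¹ * E * (c - 1) + (√t)⁻¹ * E := fun E c ↦ by ring
  rw [e] at h
  refine h.congr_fun fun n ↦ ?_
  rw [← Real.exp_add, epsteinForm]
  push_cast
  ring_nf

/-- The Mellin transform of the theta series gives the sum over the rows `m ≥ 1`. -/
theorem hasSum_epsteinForm_upper (hy : 0 < y) {s : ℂ} (hs : 1 < s.re) :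
    HasSum (fun p : ℕ × ℤ ↦ (Real.pi : ℂ) ^ (-s) * Gamma s * 1 /
        (epsteinForm x y (p.1 + 1, p.2) : ℂ) ^ s)
      (mellin (fun t ↦ (kroneckerKernel x y t : ℂ)) s +
        (y : ℂ) ^ (1 - 2 * s) * completedRiemannZeta (2 * s - 1)) := by
  have hd := hasMellin_frequency_zero hy hs
  have hm := hasMellin_add (mellinConvergent_kroneckerKernel (x := x) hy s) hd.1
  rw [hd.2] at hm
  rw [← hm.2]
  have hne : ∀ p : ℕ × ℤ, ((p.1 + 1 : ℤ), p.2) ≠ 0 := fun p h ↦ by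
    have := congrArg Prod.fst h
    simp only [Prod.fst_zero] at this
    omega
  refine hasSum_mellin_pi_mul (a := fun _ : ℕ × ℤ ↦ (1 : ℂ))
    (fun p ↦ Or.inr (epsteinForm_pos hy (hne p))) (by linarith) (fun t ht ↦ ?_) ?_
  · have ht : 0 < t := ht
    have h := Complex.hasSum_ofReal.2 (hasSum_exp_epsteinForm (x := x) hy ht)
    have e : (t : ℂ) ^ (-(1 / 2) : ℂ) = (((√t)⁻¹ : ℝ) : ℂ) := by
      rw [Real.sqrt_eq_rpow, ← Real.rpow_neg ht.le, ofReal_cpow ht.le]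
      push_cast
      rfl
    simp only [one_mul]
    rw [e, smul_eq_mul]
    simpa using h
  · have h := (summable_epsteinForm_rpow (x := x) hy hs).comp_injective
      (i := fun p : ℕ × ℤ ↦ ((p.1 + 1 : ℤ), p.2)) (fun p q h ↦ by
        simp only [Prod.mk.injEq, add_left_inj, Nat.cast_inj] at h
        exact Prod.ext h.1 h.2)
    refine h.congr fun p ↦ ?_
    simp only [Function.comp_apply, norm_one, one_div]
    rw [Real.rpow_neg (epsteinForm_nonneg _)]

/-- The factor `R` in `∑ |n + m τ|^{-2s} = π^s (-1 + s R(s)) / Γ(s + 1)`. It is regular at `s = 0`: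
the pole of the completed Riemann zeta function at `0` is accounted for by the summand `-1`. -/
noncomputable def epsteinRegular (x y : ℝ) (s : ℂ) : ℂ :=
  2 * completedRiemannZeta₀ (2 * s) - 2 / (1 - 2 * s) +
    2 * (y : ℂ) ^ (1 - 2 * s) *
      (completedRiemannZeta₀ (2 * s - 1) + 1 / (1 - 2 * s) - 1 / (2 - 2 * s)) +
    2 * mellin (fun t ↦ (kroneckerKernel x y t : ℂ)) s

/-- The meromorphic continuation of `∑ |n + m τ|^{-2s}`, `τ = x + i y`. -/
noncomputable def epsteinZeta (x y : ℝ) (s : ℂ) : ℂ :=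
  (Real.pi : ℂ) ^ s * (Gamma (s + 1))⁻¹ * (-1 + s * epsteinRegular x y s)

/-- The row `m = 0`; its term at `n = 0` is `0 ^ (-s) = 0`. -/
theorem hasSum_epsteinForm_row_zero {s : ℂ} (hs : 1 < s.re) :
    HasSum (fun n : ℤ ↦ (epsteinForm x y (0, n) : ℂ) ^ (-s)) (2 * riemannZeta (2 * s)) := by
  have hs0 : s ≠ 0 := fun h ↦ by simp [h] at hs; linarith
  have h2 : 1 < (2 * s).re := by simp; linarith
  have hz := zeta_eq_tsum_one_div_nat_add_one_cpow h2
  have hsum : Summable fun n : ℕ ↦ 1 / (n + 1 : ℂ) ^ (2 * s) := by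
    have := (summable_one_div_nat_cpow.2 h2)
    rw [← summable_nat_add_iff 1] at this
    simpa using this
  have hN : HasSum (fun n : ℕ ↦ (((n + 1 : ℤ) : ℝ) ^ 2 : ℂ) ^ (-s)) (riemannZeta (2 * s)) := by
    rw [hz]
    refine hsum.hasSum.congr_fun fun n ↦ ?_
    have : ((((n + 1 : ℤ) : ℝ) : ℂ)) = ((n + 1 : ℕ) : ℂ) := by push_cast; rfl
    rw [this, ← cpow_nat_mul' (by rw [natCast_arg]; simp [Real.pi_pos])
      (by rw [natCast_arg]; simp [Real.pi_pos.le])]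
    rw [one_div, ← cpow_neg]
    push_cast
    ring_nf
  have h := HasSum.of_nat_of_neg_add_one (f := fun n : ℤ ↦ (epsteinForm x y (0, n) : ℂ) ^ (-s))
    (m := riemannZeta (2 * s)) (m' := riemannZeta (2 * s)) ?_ ?_
  · rwa [← two_mul] at h
  · rw [← hasSum_nat_add_iff' 1]
    simp only [epsteinForm, Finset.sum_range_one, Int.cast_natCast, Nat.cast_zero, Int.cast_zero,
      zero_mul, add_zero, ne_eq, OfNat.ofNat_ne_zero, not_false_eq_true, zero_pow, ofReal_zero]
    rw [zero_cpow (neg_ne_zero.2 hs0), sub_zero]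
    refine hN.congr_fun fun n ↦ ?_
    push_cast
    rfl
  · refine hN.congr_fun fun n ↦ ?_
    simp only [epsteinForm]
    push_cast
    ring_nf

/-- The sum includes the index `p = 0`, which contributes `0 ^ (-s) = 0`. -/
theorem hasSum_epsteinZeta (hy : 0 < y) {s : ℂ} (hs : 1 < s.re) :
    HasSum (fun p ↦ (epsteinForm x y p : ℂ) ^ (-s)) (epsteinZeta x y s) := by
  have hsum := summable_epsteinForm_cpow (x := x) hy hs
  have hs0 : s ≠ 0 := fun h ↦ by simp [h] at hs; linarith
  have hΓ : Gamma s ≠ 0 := Gamma_ne_zero_of_re_pos (by linarith)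
  have hπ : (Real.pi : ℂ) ^ s ≠ 0 := by simp [cpow_eq_zero_iff, Real.pi_ne_zero]
  set M := mellin (fun t ↦ (kroneckerKernel x y t : ℂ)) s +
        (y : ℂ) ^ (1 - 2 * s) * completedRiemannZeta (2 * s - 1) with hM
  have hU : HasSum (fun p : ℕ × ℤ ↦ (epsteinForm x y (p.1 + 1, p.2) : ℂ) ^ (-s))
      ((Real.pi : ℂ) ^ s * (Gamma s)⁻¹ * M) := by
    refine ((hasSum_epsteinForm_upper (x := x) hy hs).mul_left _).congr_fun fun p ↦ ?_
    rw [cpow_neg, cpow_neg, mul_one]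
    field_simp
  -- the rows `m` and `-m` contribute equally
  have hrow : ∀ m : ℤ, Summable fun n : ℤ ↦ (epsteinForm x y (m, n) : ℂ) ^ (-s) :=
    fun m ↦ hsum.prod_factor m
  have hfib := hsum.hasSum.prod_fiberwise fun m ↦ (hrow m).hasSum
  set g : ℤ → ℂ := fun m ↦ ∑' n : ℤ, (epsteinForm x y (m, n) : ℂ) ^ (-s) with hg
  have heven : ∀ m, g (-m) = g m := by
    intro m
    rw [hg]
    simp only
    rw [← (Equiv.neg ℤ).tsum_eq]
    refine tsum_congr fun n ↦ ?_
    simp only [epsteinForm, Equiv.neg_apply]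
    push_cast
    ring_nf
  have hup : HasSum (fun m : ℕ ↦ g (m + 1)) ((Real.pi : ℂ) ^ s * (Gamma s)⁻¹ * M) :=
    hU.prod_fiberwise fun m ↦ (hrow (m + 1)).hasSum
  have hZ : HasSum g (((Real.pi : ℂ) ^ s * (Gamma s)⁻¹ * M + g 0) +
      (Real.pi : ℂ) ^ s * (Gamma s)⁻¹ * M) := by
    refine HasSum.of_nat_of_neg_add_one ?_ ?_
    · rw [← hasSum_nat_add_iff' 1]
      simpa using hup
    · refine hup.congr_fun fun m ↦ ?_
      exact heven (m + 1)
  have hval := hfib.unique hZ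
  have h0 : g 0 = 2 * riemannZeta (2 * s) := (hasSum_epsteinForm_row_zero hs).tsum_eq
  have hζ : riemannZeta (2 * s) =
      (Real.pi : ℂ) ^ s * (Gamma s)⁻¹ * completedRiemannZeta (2 * s) := by
    rw [riemannZeta_def_of_ne_zero (by simpa using hs0), Gammaℝ]
    rw [show -(2 * s) / 2 = -s by ring, show 2 * s / 2 = s by ring, cpow_neg]
    field_simp
  have : epsteinZeta x y s = ∑' p, (epsteinForm x y p : ℂ) ^ (-s) := by
    have hne : 1 - 2 * s ≠ 0 := fun h ↦ by
      have := congrArg re h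
      simp at this
      linarith
    have hne' : 1 - s ≠ 0 := fun h ↦ by
      have := congrArg re h
      simp at this
      linarith
    have hne2 : 2 - 2 * s ≠ 0 := by
      rw [show 2 - 2 * s = 2 * (1 - s) by ring]
      exact mul_ne_zero two_ne_zero hne'
    rw [hval, h0, hζ, hM, epsteinZeta, Gamma_add_one s hs0, mul_inv, epsteinRegular,
      completedRiemannZeta_eq (2 * s), completedRiemannZeta_eq (2 * s - 1),
      show 1 - (2 * s - 1) = 2 - 2 * s by ring, show 2 * s - 1 = -(1 - 2 * s) by ring, div_neg]
    field_simp
    ring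
  rw [this]
  exact hsum.hasSum

theorem differentiableAt_epsteinRegular (hy : 0 < y) {s : ℂ} (h1 : 1 - 2 * s ≠ 0)
    (h2 : 2 - 2 * s ≠ 0) : DifferentiableAt ℂ (epsteinRegular x y) s := by
  have hm := differentiable_mellin_kroneckerKernel (x := x) hy s
  have hz := differentiable_completedZeta₀
  have hy' : (y : ℂ) ≠ 0 := ofReal_ne_zero.2 hy.ne'
  unfold epsteinRegular
  have e1 : DifferentiableAt ℂ (fun s ↦ (y : ℂ) ^ (1 - 2 * s)) s :=
    (by fun_prop : DifferentiableAt ℂ (fun s : ℂ ↦ 1 - 2 * s) s).const_cpow (Or.inl hy')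
  have e2 : DifferentiableAt ℂ (fun s ↦ completedRiemannZeta₀ (2 * s)) s :=
    (hz _).comp s (by fun_prop)
  have e3 : DifferentiableAt ℂ (fun s ↦ completedRiemannZeta₀ (2 * s - 1)) s :=
    (hz _).comp s (by fun_prop)
  fun_prop (disch := assumption)

end Epstein


/-! ### Kronecker's limit formula at `s = 0` -/

section KroneckerLimit

open Filter Set
open scoped Topology

variable {x y : ℝ}

/-- The entire factor `π ^ s / Γ(s + 1)` of the Epstein zeta function. -/
noncomputable def epsteinFactor (s : ℂ) : ℂ := (Real.pi : ℂ) ^ s * (Gamma (s + 1))⁻¹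

theorem differentiable_epsteinFactor : Differentiable ℂ epsteinFactor := by
  have h1 : Differentiable ℂ fun s : ℂ ↦ (Real.pi : ℂ) ^ s :=
    fun s ↦ differentiableAt_id.const_cpow (Or.inl (ofReal_ne_zero.2 Real.pi_ne_zero))
  have h2 : Differentiable ℂ fun s : ℂ ↦ (Gamma (s + 1))⁻¹ :=
    differentiable_one_div_Gamma.comp (differentiable_id.add_const 1)
  exact h1.mul h2

theorem meromorphicAt_epsteinZeta (hy : 0 < y) (s : ℂ) : MeromorphicAt (epsteinZeta x y) s := by
  have hy' : (y : ℂ) ≠ 0 := ofReal_ne_zero.2 hy.ne'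
  have hz := differentiable_completedZeta₀
  have h1 := (differentiable_epsteinFactor.analyticAt s).meromorphicAt
  have h2 := ((differentiable_mellin_kroneckerKernel (x := x) hy).analyticAt s).meromorphicAt
  have d1 : Differentiable ℂ (fun s : ℂ ↦ (y : ℂ) ^ (1 - 2 * s)) := fun s ↦
    (by fun_prop : DifferentiableAt ℂ (fun s : ℂ ↦ 1 - 2 * s) s).const_cpow (Or.inl hy')
  have d2 : Differentiable ℂ (fun s : ℂ ↦ completedRiemannZeta₀ (2 * s)) := fun s ↦
    (hz _).comp s (by fun_prop)
  have d3 : Differentiable ℂ (fun s : ℂ ↦ completedRiemannZeta₀ (2 * s - 1)) := fun s ↦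
    (hz _).comp s (by fun_prop)
  have h3 := (d1.analyticAt s).meromorphicAt
  have h4 := (d2.analyticAt s).meromorphicAt
  have h5 := (d3.analyticAt s).meromorphicAt
  have h6 : MeromorphicAt (fun s : ℂ ↦ 1 - 2 * s) s := by fun_prop
  have h7 : MeromorphicAt (fun s : ℂ ↦ 2 - 2 * s) s := by fun_prop
  have c (z : ℂ) : MeromorphicAt (fun _ : ℂ ↦ z) s := MeromorphicAt.const z s
  exact h1.mul ((c _).add ((MeromorphicAt.id s).mul (((((c 2).mul h4).sub ((c 2).div h6)).add
    (((c 2).mul h3).mul ((h5.add ((c 1).div h6)).sub ((c 1).div h7)))).add ((c 2).mul h2))))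

theorem analyticAt_epsteinZeta_zero (hy : 0 < y) : AnalyticAt ℂ (epsteinZeta x y) 0 := by
  have h : ∀ᶠ s : ℂ in 𝓝 0, DifferentiableAt ℂ (epsteinZeta x y) s := by
    have e1 : ∀ᶠ s : ℂ in 𝓝 0, 1 - 2 * s ≠ 0 :=
      (by fun_prop : ContinuousAt (fun s : ℂ ↦ 1 - 2 * s) 0).eventually_ne (by simp)
    have e2 : ∀ᶠ s : ℂ in 𝓝 0, 2 - 2 * s ≠ 0 :=
      (by fun_prop : ContinuousAt (fun s : ℂ ↦ 2 - 2 * s) 0).eventually_ne (by simp)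
    filter_upwards [e1, e2] with s h1 h2
    exact (differentiable_epsteinFactor s).mul ((differentiableAt_const _).add
      (differentiableAt_id.mul (differentiableAt_epsteinRegular hy h1 h2)))
  exact analyticAt_iff_eventually_differentiableAt.2 h

theorem epsteinFactor_zero : epsteinFactor 0 = 1 := by simp [epsteinFactor]

theorem epsteinZeta_zero : epsteinZeta x y 0 = -1 := by simp [epsteinZeta]

/-- The constant term in the derivative at `0` of the Epstein zeta function. -/
noncomputable def kroneckerConst : ℂ :=
  -deriv epsteinFactor 0 + 2 * completedRiemannZeta₀ 0 - 2

/-- The coefficient of `Im τ` in the derivative at `0` of the Epstein zeta function. -/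
noncomputable def kroneckerCoeff : ℂ :=
  2 * (completedRiemannZeta₀ (-1) + 1 / 2)

/-- Kronecker's limit formula; the factor `y` stems from the term `ζ*(2s - 1) y^{1 - 2s}`, where
`ζ*` is the completed Riemann zeta function. -/
theorem hasDerivAt_epsteinZeta_zero (hy : 0 < y) :
    HasDerivAt (epsteinZeta x y) (kroneckerConst + kroneckerCoeff * y +
      2 * ((kroneckerLog (x + y * I)).re : ℂ)) 0 := by
  have hR := (differentiableAt_epsteinRegular (x := x) (s := 0) hy (by simp) (by simp)).hasDerivAt
  have h := (differentiable_epsteinFactor 0).hasDerivAt.mul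
    (((hasDerivAt_id (0 : ℂ)).mul hR).const_add (-1))
  refine h.congr_deriv ?_
  simp only [epsteinFactor_zero, id, Pi.mul_apply, zero_mul, add_zero, one_mul, epsteinRegular,
    mellin_kroneckerKernel_zero hy, kroneckerConst, kroneckerCoeff, mul_zero, sub_zero, cpow_one,
    zero_sub]
  ring

end KroneckerLimit


/-! ### Fourier analysis on `ℂ / Λ` -/

section TorusFourier

open Filter Set MeasureTheory
open scoped Topology

/-- `g` is periodic with respect to the lattice `ℤ l + ℤ l τ`. -/
def LatticePeriodic (l τ : ℂ) (g : ℂ → ℂ) : Prop :=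
  ∀ (a b : ℤ) (z : ℂ), g (z + (a * l + b * (l * τ))) = g z

variable {l τ : ℂ}

theorem exists_real_coordinates (hl : l ≠ 0) (hτ : 0 < τ.im) (z : ℂ) :
    ∃ r : Fin 2 → ℝ, l * r 0 + l * τ * r 1 = z := by
  refine ⟨![(z / l).re - τ.re * ((z / l).im / τ.im), (z / l).im / τ.im], ?_⟩
  have h : (((z / l).re - τ.re * ((z / l).im / τ.im) : ℝ) : ℂ) +
      τ * (((z / l).im / τ.im : ℝ) : ℂ) = z / l := by
    apply Complex.ext
    · simp
    · simp
      field_simp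
  simp only [Matrix.cons_val_zero, Matrix.cons_val_one, Matrix.cons_val_fin_one]
  rw [mul_assoc, ← mul_add, h]
  field_simp

/-- The function on the standard torus `(ℝ / ℤ)²` that corresponds to a periodic function `g` under
`(s, t) ↦ l s + l τ t`. -/
noncomputable def torusLift (l τ : ℂ) (g : ℂ → ℂ) (x : UnitAddTorus (Fin 2)) : ℂ :=
  g (l * (Function.surjInv QuotientAddGroup.mk_surjective (x 0) : ℝ) +
    l * τ * (Function.surjInv QuotientAddGroup.mk_surjective (x 1) : ℝ))

/-- The value of the lift does not depend on the representatives chosen in its definition. -/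
theorem LatticePeriodic.torusLift_mk {g : ℂ → ℂ} (hg : LatticePeriodic l τ g) (r : Fin 2 → ℝ) :
    torusLift l τ g (fun i ↦ (r i : UnitAddCircle)) = g (l * r 0 + l * τ * r 1) := by
  have h : ∀ s : ℝ, ∃ n : ℤ, (Function.surjInv QuotientAddGroup.mk_surjective
      (s : UnitAddCircle) : ℝ) = s + n := by
    intro s
    have h1 := Function.surjInv_eq
      (QuotientAddGroup.mk_surjective (s := AddSubgroup.zmultiples (1 : ℝ))) (s : UnitAddCircle)
    obtain ⟨n, hn⟩ := (AddCircle.coe_eq_zero_iff (1 : ℝ)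
      (x := (Function.surjInv QuotientAddGroup.mk_surjective (s : UnitAddCircle) : ℝ) - s)).1
      (by rw [AddCircle.coe_sub, sub_eq_zero]; exact h1)
    exact ⟨n, by rw [zsmul_one] at hn; linarith⟩
  obtain ⟨a, ha⟩ := h (r 0)
  obtain ⟨b, hb⟩ := h (r 1)
  rw [torusLift, ha, hb, ← hg a b (l * r 0 + l * τ * r 1)]
  congr 1
  push_cast
  ring

theorem exists_torus_rep (x : UnitAddTorus (Fin 2)) :
    ∃ r : Fin 2 → ℝ, (fun i ↦ (r i : UnitAddCircle)) = x := by
  choose r hr using fun i ↦ QuotientAddGroup.mk_surjective (x i)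
  exact ⟨r, funext hr⟩

theorem LatticePeriodic.continuous_torusLift {g : ℂ → ℂ} (hg : LatticePeriodic l τ g)
    (hc : Continuous g) : Continuous (torusLift l τ g) := by
  have hq : IsOpenQuotientMap (Pi.map fun (_ : Fin 2) (s : ℝ) ↦ (s : UnitAddCircle)) :=
    IsOpenQuotientMap.piMap fun _ ↦ QuotientAddGroup.isOpenQuotientMap_mk
  rw [hq.isQuotientMap.continuous_iff]
  have : torusLift l τ g ∘ (Pi.map fun (_ : Fin 2) (s : ℝ) ↦ (s : UnitAddCircle)) =
      fun r ↦ g (l * r 0 + l * τ * r 1) := funext fun r ↦ hg.torusLift_mk r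
  rw [this]
  fun_prop

theorem LatticePeriodic.exists_bound (hl : l ≠ 0) (hτ : 0 < τ.im) {g : ℂ → ℂ}
    (hg : LatticePeriodic l τ g) (hc : Continuous g) : ∃ B, ∀ z, ‖g z‖ ≤ B := by
  obtain ⟨B, hB⟩ := isCompact_univ.exists_bound_of_continuousOn
    (hg.continuous_torusLift hc).continuousOn
  refine ⟨B, fun z ↦ ?_⟩
  obtain ⟨r, rfl⟩ := exists_real_coordinates hl hτ z
  rw [← hg.torusLift_mk r]
  exact hB _ (mem_univ _)

theorem LatticePeriodic.fderiv_apply {g : ℂ → ℂ} (hg : LatticePeriodic l τ g) (v : ℂ) :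
    LatticePeriodic l τ fun z ↦ fderiv ℝ g z v := by
  intro a b z
  have h : (fun z ↦ g (z + (a * l + b * (l * τ)))) = g := funext (hg a b)
  have := fderiv_comp_add_right (𝕜 := ℝ) (f := g) (x := z) (a * l + b * (l * τ))
  rw [h] at this
  exact congrArg (fun L : ℂ →L[ℝ] ℂ ↦ L v) this.symm

theorem LatticePeriodic.comp_add {g : ℂ → ℂ} (hg : LatticePeriodic l τ g) (v : ℂ) :
    LatticePeriodic l τ fun z ↦ g (z + v) := by
  intro a b z
  simp only
  rw [add_right_comm, hg]

/-- The Haar probability measure on `(ℝ / ℤ)²`. -/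
noncomputable def torusMeasure : Measure (UnitAddTorus (Fin 2)) :=
  Measure.pi fun _ ↦ AddCircle.haarAddCircle

instance : torusMeasure.IsAddHaarMeasure :=
  inferInstanceAs (Measure.pi fun _ : Fin 2 ↦ AddCircle.haarAddCircle (T := 1)).IsAddHaarMeasure

instance : IsProbabilityMeasure torusMeasure :=
  inferInstanceAs (IsProbabilityMeasure
    (Measure.pi fun _ : Fin 2 ↦ AddCircle.haarAddCircle (T := 1)))

/-- The mean value of a periodic function. -/
noncomputable def latticeMean (l τ : ℂ) (g : ℂ → ℂ) : ℂ :=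
  ∫ x, torusLift l τ g x ∂torusMeasure

theorem LatticePeriodic.integrable_torusLift {g : ℂ → ℂ} (hg : LatticePeriodic l τ g)
    (hc : Continuous g) : Integrable (torusLift l τ g) torusMeasure :=
  (hg.continuous_torusLift hc).integrable_of_hasCompactSupport (.of_compactSpace _)

theorem LatticePeriodic.latticeMean_comp_add (hl : l ≠ 0) (hτ : 0 < τ.im) {g : ℂ → ℂ}
    (hg : LatticePeriodic l τ g) (v : ℂ) :
    latticeMean l τ (fun z ↦ g (z + v)) = latticeMean l τ g := by
  obtain ⟨r, rfl⟩ := exists_real_coordinates hl hτ v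
  rw [latticeMean, latticeMean, ← integral_add_right_eq_self (μ := torusMeasure)
    (torusLift l τ g) (fun i ↦ (r i : UnitAddCircle))]
  refine integral_congr_ae (Eventually.of_forall fun x ↦ ?_)
  obtain ⟨q, rfl⟩ := exists_torus_rep x
  have e : ((fun i ↦ (q i : UnitAddCircle)) + fun i ↦ (r i : UnitAddCircle)) =
      fun i ↦ ((q + r) i : UnitAddCircle) := by
    ext i
    simp
  simp only
  rw [(hg.comp_add _).torusLift_mk, e, hg.torusLift_mk]
  congr 1
  simp only [Pi.add_apply]
  push_cast
  ring

/-- A directional derivative of a periodic function has mean value `0`, as translations preserve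
the mean value. -/
theorem LatticePeriodic.latticeMean_fderiv (hl : l ≠ 0) (hτ : 0 < τ.im) {g : ℂ → ℂ}
    (hg : LatticePeriodic l τ g) (hc : ContDiff ℝ 1 g) (v : ℂ) :
    latticeMean l τ (fun z ↦ fderiv ℝ g z v) = 0 := by
  have hg' := hg.fderiv_apply v
  have hc' : Continuous fun z ↦ fderiv ℝ g z v := (hc.continuous_fderiv one_ne_zero).clm_apply
    continuous_const
  obtain ⟨B, hB⟩ := hg'.exists_bound hl hτ hc'
  have hsm : ∀ ε : ℝ, AEStronglyMeasurable (torusLift l τ fun z ↦ g (z + ε * v)) torusMeasure :=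
    fun ε ↦ ((hg.comp_add (ε * v)).continuous_torusLift
      (by have := hc.continuous; fun_prop)).aestronglyMeasurable
  have h := (hasDerivAt_integral_of_dominated_loc_of_deriv_le (𝕜 := ℝ) (μ := torusMeasure)
    (F := fun (ε : ℝ) ↦ torusLift l τ fun z ↦ g (z + ε * v))
    (F' := fun (ε : ℝ) ↦ torusLift l τ fun z ↦ fderiv ℝ g (z + ε * v) v)
    (bound := fun _ ↦ B) (x₀ := 0) univ_mem (Eventually.of_forall hsm)
    (by simpa using hg.integrable_torusLift hc.continuous)
    (by simpa using (hg'.integrable_torusLift hc').aestronglyMeasurable)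
    (Eventually.of_forall fun x ε _ ↦ hB _) (integrable_const B)
    (Eventually.of_forall fun x ε _ ↦ ?_)).2
  · have e : (fun ε : ℝ ↦ ∫ x, torusLift l τ (fun z ↦ g (z + ε * v)) x ∂torusMeasure) =
        fun _ ↦ latticeMean l τ g := funext fun ε ↦ hg.latticeMean_comp_add hl hτ _
    rw [e] at h
    simpa [latticeMean] using h.unique (hasDerivAt_const 0 (latticeMean l τ g))
  · simp only [torusLift]
    generalize (l * (Function.surjInv QuotientAddGroup.mk_surjective (x 0) : ℝ) +
      l * τ * (Function.surjInv QuotientAddGroup.mk_surjective (x 1) : ℝ)) = w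
    have h1 : HasDerivAt (fun ε : ℝ ↦ w + ε * v) v ε := by
      simpa using ((ofRealCLM.hasDerivAt (x := ε)).mul_const v).const_add w
    exact ((hc.differentiable one_ne_zero _).hasFDerivAt).comp_hasDerivAt ε h1

/-! ### Characters of `ℂ / Λ` -/

/-- The real linear form with `l ↦ -m`, `l τ ↦ n`, for `p = (m, n)`. -/
noncomputable def dualForm (l τ : ℂ) (p : ℤ × ℤ) : ℂ →L[ℝ] ℝ :=
  ((p.2 + p.1 * τ.re) / τ.im) • imCLM ∘L ContinuousLinearMap.mul ℝ ℂ l⁻¹ -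
    (p.1 : ℝ) • reCLM ∘L ContinuousLinearMap.mul ℝ ℂ l⁻¹

theorem dualForm_apply (p : ℤ × ℤ) (z : ℂ) : dualForm l τ p z =
    (p.2 + p.1 * τ.re) / τ.im * (l⁻¹ * z).im - p.1 * (l⁻¹ * z).re := rfl

theorem dualForm_left (hl : l ≠ 0) (p : ℤ × ℤ) : dualForm l τ p l = -p.1 := by
  simp [dualForm_apply, inv_mul_cancel₀ hl]

theorem dualForm_right (hl : l ≠ 0) (hτ : 0 < τ.im) (p : ℤ × ℤ) :
    dualForm l τ p (l * τ) = p.2 := by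
  rw [dualForm_apply, inv_mul_cancel_left₀ hl]
  field_simp
  ring

theorem dualForm_combination (hl : l ≠ 0) (hτ : 0 < τ.im) (p : ℤ × ℤ) (s t : ℝ) :
    dualForm l τ p (l * s + l * τ * t) = -p.1 * s + p.2 * t := by
  have e : l * s + l * τ * t = s • l + t • (l * τ) := by
    simp only [real_smul]
    ring
  rw [e, map_add, map_smul, map_smul, dualForm_left hl, dualForm_right hl hτ, smul_eq_mul,
    smul_eq_mul]
  ring

theorem dualForm_sq_add_sq (hτ : 0 < τ.im) (p : ℤ × ℤ) :
    dualForm l τ p 1 ^ 2 + dualForm l τ p I ^ 2 =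
      epsteinForm τ.re τ.im p / (‖l‖ ^ 2 * τ.im ^ 2) := by
  have h : (l⁻¹).re ^ 2 + (l⁻¹).im ^ 2 = (‖l‖ ^ 2)⁻¹ := by
    rw [← inv_pow, ← norm_inv, ← normSq_eq_norm_sq, normSq_apply]
    ring
  rw [div_mul_eq_div_div_swap, div_eq_mul_inv _ (‖l‖ ^ 2), ← h]
  simp only [dualForm_apply, epsteinForm, mul_one, mul_re, mul_im, I_re, I_im, mul_zero, zero_sub,
    add_zero]
  field_simp
  ring

/-- The characters `exp (2πi (n t - m s))`, `z = l s + l τ t`, of `ℂ / Λ`. -/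
noncomputable def latticeChar (l τ : ℂ) (p : ℤ × ℤ) (z : ℂ) : ℂ :=
  cexp (2 * Real.pi * I * dualForm l τ p z)

theorem latticeChar_add (p : ℤ × ℤ) (z w : ℂ) :
    latticeChar l τ p (z + w) = latticeChar l τ p z * latticeChar l τ p w := by
  rw [latticeChar, latticeChar, latticeChar, ← Complex.exp_add, map_add]
  push_cast
  ring_nf

theorem latticeChar_zero (p : ℤ × ℤ) : latticeChar l τ p 0 = 1 := by
  simp [latticeChar]

theorem latticePeriodic_latticeChar (hl : l ≠ 0) (hτ : 0 < τ.im) (p : ℤ × ℤ) :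
    LatticePeriodic l τ (latticeChar l τ p) := by
  intro a b z
  have e : (a * l + b * (l * τ) : ℂ) = l * (a : ℝ) + l * τ * (b : ℝ) := by push_cast; ring
  rw [latticeChar_add, latticeChar, latticeChar, e, dualForm_combination hl hτ]
  have := Complex.exp_int_mul_two_pi_mul_I (-p.1 * a + p.2 * b)
  push_cast at this ⊢
  rw [show 2 * (Real.pi : ℂ) * I * (-p.1 * a + p.2 * b) =
    (-p.1 * a + p.2 * b) * (2 * Real.pi * I) by ring, this, mul_one]

theorem hasFDerivAt_latticeChar (p : ℤ × ℤ) (z : ℂ) :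
    HasFDerivAt (latticeChar l τ p) (latticeChar l τ p z • (2 * Real.pi * I : ℂ) •
      (ofRealCLM ∘L dualForm l τ p)) z :=
  (((ofRealCLM ∘L dualForm l τ p).hasFDerivAt (x := z)).const_mul (2 * Real.pi * I : ℂ)).cexp

theorem fderiv_latticeChar (p : ℤ × ℤ) (z v : ℂ) :
    fderiv ℝ (latticeChar l τ p) z v =
      2 * Real.pi * I * dualForm l τ p v * latticeChar l τ p z := by
  rw [(hasFDerivAt_latticeChar p z).fderiv]
  simp only [smul_apply, ContinuousLinearMap.comp_apply, ofRealCLM_apply,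
    smul_eq_mul]
  ring

theorem contDiff_latticeChar (p : ℤ × ℤ) {n : WithTop ℕ∞} : ContDiff ℝ n (latticeChar l τ p) :=
  (contDiff_const.mul (ofRealCLM ∘L dualForm l τ p).contDiff).cexp

theorem laplacian_eq_fderiv_fderiv {F : Type*} [NormedAddCommGroup F] [NormedSpace ℝ F]
    {f : ℂ → F} {z : ℂ} (hf : ContDiffAt ℝ 2 f z) :
    Laplacian.laplacian f z = fderiv ℝ (fun w ↦ fderiv ℝ f w 1) z 1 +
      fderiv ℝ (fun w ↦ fderiv ℝ f w I) z I := by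
  have hd : DifferentiableAt ℝ (fderiv ℝ f) z :=
    (hf.fderiv_right (m := 1) (by norm_num)).differentiableAt one_ne_zero
  have h : ∀ v, fderiv ℝ (fun w ↦ fderiv ℝ f w v) z v = fderiv ℝ (fderiv ℝ f) z v v := by
    intro v
    rw [fderiv_clm_apply hd (differentiableAt_const v)]
    simp
  rw [InnerProductSpace.laplacian_eq_iteratedFDeriv_complexPlane, h, h]
  simp [iteratedFDeriv_two_apply]

/-- The eigenvalue of the Laplace operator that belongs to the character with index `p`. -/
noncomputable def latticeEigenvalue (l τ : ℂ) (p : ℤ × ℤ) : ℝ :=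
  4 * Real.pi ^ 2 / (‖l‖ ^ 2 * τ.im ^ 2) * epsteinForm τ.re τ.im p

theorem latticeEigenvalue_eq (hτ : 0 < τ.im) (p : ℤ × ℤ) :
    latticeEigenvalue l τ p =
      4 * Real.pi ^ 2 * (dualForm l τ p 1 ^ 2 + dualForm l τ p I ^ 2) := by
  rw [dualForm_sq_add_sq hτ, latticeEigenvalue]
  ring

theorem laplacian_latticeChar (hτ : 0 < τ.im) (p : ℤ × ℤ) (z : ℂ) :
    -(Laplacian.laplacian (latticeChar l τ p) z) =
      (latticeEigenvalue l τ p : ℂ) * latticeChar l τ p z := by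
  have h : ∀ v, fderiv ℝ (fun w ↦ fderiv ℝ (latticeChar l τ p) w v) z v =
      (2 * Real.pi * I * dualForm l τ p v) ^ 2 * latticeChar l τ p z := by
    intro v
    simp_rw [fderiv_latticeChar]
    rw [fderiv_const_mul (hasFDerivAt_latticeChar p z).differentiableAt,
      smul_apply, fderiv_latticeChar, smul_eq_mul]
    ring
  rw [laplacian_eq_fderiv_fderiv (contDiff_latticeChar p).contDiffAt, h, h,
    latticeEigenvalue_eq hτ]
  push_cast
  linear_combination (-4 * Real.pi ^ 2 * (dualForm l τ p 1 ^ 2 + dualForm l τ p I ^ 2) *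
    latticeChar l τ p z : ℂ) * I_sq

/-- The Fourier coefficients of a periodic function. -/
noncomputable def latticeCoeff (l τ : ℂ) (p : ℤ × ℤ) (f : ℂ → ℂ) : ℂ :=
  latticeMean l τ fun z ↦ latticeChar l τ (-p) z * f z

theorem LatticePeriodic.mul {f g : ℂ → ℂ} (hf : LatticePeriodic l τ f)
    (hg : LatticePeriodic l τ g) : LatticePeriodic l τ fun z ↦ f z * g z :=
  fun a b z ↦ by simp only [hf a b z, hg a b z]

theorem dualForm_neg (p : ℤ × ℤ) (z : ℂ) : dualForm l τ (-p) z = -dualForm l τ p z := by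
  simp only [dualForm_apply, Prod.fst_neg, Prod.snd_neg]
  push_cast
  ring

/-- Integration by parts against a character. -/
theorem LatticePeriodic.latticeCoeff_fderiv (hl : l ≠ 0) (hτ : 0 < τ.im) {f : ℂ → ℂ}
    (hf : LatticePeriodic l τ f) (hc : ContDiff ℝ 1 f) (p : ℤ × ℤ) (v : ℂ) :
    latticeCoeff l τ p (fun z ↦ fderiv ℝ f z v) =
      2 * Real.pi * I * dualForm l τ p v * latticeCoeff l τ p f := by
  have hχ := latticePeriodic_latticeChar hl hτ (-p)
  have hχc : ContDiff ℝ 1 (latticeChar l τ (-p)) := contDiff_latticeChar _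
  have h := (hχ.mul hf).latticeMean_fderiv hl hτ (hχc.mul hc) v
  have e : ∀ z, fderiv ℝ (fun z ↦ latticeChar l τ (-p) z * f z) z v =
      latticeChar l τ (-p) z * fderiv ℝ f z v -
        2 * Real.pi * I * dualForm l τ p v * (latticeChar l τ (-p) z * f z) := by
    intro z
    rw [fderiv_fun_mul (hχc.differentiable one_ne_zero z) (hc.differentiable one_ne_zero z)]
    simp only [add_apply, smul_apply, smul_eq_mul,
      fderiv_latticeChar, dualForm_neg]
    push_cast
    ring
  simp_rw [e] at h
  have i1 := (hχ.mul (hf.fderiv_apply v)).integrable_torusLift (hχc.continuous.mul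
    ((hc.continuous_fderiv one_ne_zero).clm_apply continuous_const))
  have i2 := (hχ.mul hf).integrable_torusLift (hχc.continuous.mul hc.continuous)
  have h2 : latticeMean l τ (fun z ↦ latticeChar l τ (-p) z * fderiv ℝ f z v -
        2 * Real.pi * I * dualForm l τ p v * (latticeChar l τ (-p) z * f z)) =
      latticeCoeff l τ p (fun z ↦ fderiv ℝ f z v) -
        2 * Real.pi * I * dualForm l τ p v * latticeCoeff l τ p f := by
    rw [latticeCoeff, latticeCoeff, latticeMean, latticeMean, latticeMean, ← integral_const_mul,
      ← integral_sub i1 (i2.const_mul _)]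
    rfl
  rw [h2] at h
  exact sub_eq_zero.1 h

theorem LatticePeriodic.latticeCoeff_laplacian (hl : l ≠ 0) (hτ : 0 < τ.im) {f : ℂ → ℂ}
    (hf : LatticePeriodic l τ f) (hc : ContDiff ℝ ∞ f) (p : ℤ × ℤ) :
    latticeCoeff l τ p (fun z ↦ Laplacian.laplacian f z) =
      -(latticeEigenvalue l τ p : ℂ) * latticeCoeff l τ p f := by
  have hc2 : ContDiff ℝ 2 f := hc.of_le (WithTop.coe_le_coe.2 le_top)
  have hc1 : ContDiff ℝ 1 f := hc2.of_le one_le_two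
  have hD : ∀ v, ContDiff ℝ 1 fun z ↦ fderiv ℝ f z v := fun v ↦
    (hc2.fderiv_right (m := 1) (by norm_num)).clm_apply contDiff_const
  have hDD : ∀ v, Continuous fun z ↦ fderiv ℝ (fun w ↦ fderiv ℝ f w v) z v := fun v ↦
    ((hD v).continuous_fderiv one_ne_zero).clm_apply continuous_const
  have h : ∀ v, latticeCoeff l τ p (fun z ↦ fderiv ℝ (fun w ↦ fderiv ℝ f w v) z v) =
      (2 * Real.pi * I * dualForm l τ p v) ^ 2 * latticeCoeff l τ p f := by
    intro v
    rw [(hf.fderiv_apply v).latticeCoeff_fderiv hl hτ (hD v), hf.latticeCoeff_fderiv hl hτ hc1]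
    ring
  have hχ := latticePeriodic_latticeChar hl hτ (-p)
  have hχc : Continuous (latticeChar l τ (-p)) := (contDiff_latticeChar (n := 1) _).continuous
  have i : ∀ v, Integrable (torusLift l τ fun z ↦ latticeChar l τ (-p) z *
      fderiv ℝ (fun w ↦ fderiv ℝ f w v) z v) torusMeasure := fun v ↦
    (hχ.mul ((hf.fderiv_apply v).fderiv_apply v)).integrable_torusLift (hχc.mul (hDD v))
  have e : (fun z ↦ Laplacian.laplacian f z) = fun z ↦ fderiv ℝ (fun w ↦ fderiv ℝ f w 1) z 1 +
      fderiv ℝ (fun w ↦ fderiv ℝ f w I) z I :=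
    funext fun z ↦ laplacian_eq_fderiv_fderiv hc2.contDiffAt
  have h2 : latticeCoeff l τ p (fun z ↦ Laplacian.laplacian f z) =
      latticeCoeff l τ p (fun z ↦ fderiv ℝ (fun w ↦ fderiv ℝ f w 1) z 1) +
      latticeCoeff l τ p (fun z ↦ fderiv ℝ (fun w ↦ fderiv ℝ f w I) z I) := by
    rw [e, latticeCoeff, latticeCoeff, latticeCoeff, latticeMean, latticeMean, latticeMean,
      ← integral_add (i 1) (i I)]
    simp only [torusLift, mul_add]
  rw [h2, h, h, latticeEigenvalue_eq hτ]
  push_cast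
  linear_combination (4 * Real.pi ^ 2 * (dualForm l τ p 1 ^ 2 + dualForm l τ p I ^ 2) *
    latticeCoeff l τ p f : ℂ) * I_sq

/-- Fourier inversion for periodic functions with finitely many non-zero coefficients. -/
theorem LatticePeriodic.eq_sum_latticeChar (hl : l ≠ 0) (hτ : 0 < τ.im) {f : ℂ → ℂ}
    (hf : LatticePeriodic l τ f) (hc : Continuous f) {S : Finset (ℤ × ℤ)}
    (hS : ∀ p ∉ S, latticeCoeff l τ p f = 0) (z : ℂ) :
    f z = ∑ p ∈ S, latticeCoeff l τ p f * latticeChar l τ p z := by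
  let e : ℤ × ℤ ≃ (Fin 2 → ℤ) := ((Equiv.neg ℤ).prodCongr (Equiv.refl ℤ)).trans
    (finTwoArrowEquiv ℤ).symm
  have he : ∀ p : ℤ × ℤ, e p = ![-p.1, p.2] := fun p ↦ rfl
  have hχ : ∀ (p : ℤ × ℤ) (r : Fin 2 → ℝ), UnitAddTorus.mFourier (e p)
      (fun i ↦ (r i : UnitAddCircle)) = latticeChar l τ p (l * r 0 + l * τ * r 1) := by
    intro p r
    rw [latticeChar, dualForm_combination hl hτ, he]
    simp only [UnitAddTorus.mFourier, ContinuousMap.coe_mk, Fin.prod_univ_two, fourier_coe_apply,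
      Matrix.cons_val_zero, Matrix.cons_val_one, Matrix.cons_val_fin_one, ← Complex.exp_add]
    push_cast
    ring_nf
  let F : C(UnitAddTorus (Fin 2), ℂ) := ⟨torusLift l τ f, hf.continuous_torusLift hc⟩
  have hcoef : ∀ p, UnitAddTorus.mFourierCoeff F (e p) = latticeCoeff l τ p f := by
    intro p
    change ∫ t, UnitAddTorus.mFourier (-e p) t • torusLift l τ f t ∂torusMeasure = _
    rw [latticeCoeff, latticeMean]
    refine integral_congr_ae (Eventually.of_forall fun x ↦ ?_)
    obtain ⟨r, rfl⟩ := exists_torus_rep x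
    have e1 : -e p = e (-p) := by
      rw [he, he]
      ext i
      fin_cases i <;> rfl
    simp only
    rw [e1, hχ, ((latticePeriodic_latticeChar hl hτ (-p)).mul hf).torusLift_mk,
      hf.torusLift_mk, smul_eq_mul]
  have hsupp : ∀ k ∉ S.map e.toEmbedding, UnitAddTorus.mFourierCoeff F k = 0 := by
    intro k hk
    obtain ⟨p, rfl⟩ := e.surjective k
    rw [hcoef]
    exact hS p fun hp ↦ hk (Finset.mem_map_of_mem _ hp)
  obtain ⟨r, rfl⟩ := exists_real_coordinates hl hτ z
  have hsum := UnitAddTorus.hasSum_mFourier_series_apply_of_summable (f := F)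
    (summable_of_ne_finset_zero hsupp) fun i ↦ (r i : UnitAddCircle)
  have hfin := hasSum_sum_of_ne_finset_zero (L := SummationFilter.unconditional _) (s := S.map e.toEmbedding)
    (f := fun k ↦ UnitAddTorus.mFourierCoeff F k •
      UnitAddTorus.mFourier k (fun i ↦ (r i : UnitAddCircle)))
    (fun k hk ↦ by rw [hsupp k hk, zero_smul])
  have := hsum.unique hfin
  rw [Finset.sum_map] at this
  refine (hf.torusLift_mk r).symm.trans (this.trans (Finset.sum_congr rfl fun p _ ↦ ?_))
  rw [Equiv.coe_toEmbedding, hcoef, hχ, smul_eq_mul]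

end TorusFourier


/-! ### The spectrum and the determinant of the Laplace operator on `ℂ / Λ` -/

section Spectrum

open Filter Set
open scoped Topology

/-- The lattice `ℤ l + ℤ l τ`. -/
def latticeSet (l τ : ℂ) : Set ℂ :=
  range fun n : ℤ × ℤ ↦ (n.1 : ℂ) * l + n.2 * (l * τ)

variable {l τ : ℂ}

theorem latticePeriodic_iff {f : ℂ → ℂ} :
    LatticePeriodic l τ f ↔ ∀ w ∈ latticeSet l τ, ∀ z, f (z + w) = f z := by
  constructor
  · rintro h _ ⟨n, rfl⟩ z
    exact h n.1 n.2 z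
  · exact fun h a b z ↦ h _ ⟨(a, b), rfl⟩ z

theorem latticeEigenvalue_nonneg (p : ℤ × ℤ) : 0 ≤ latticeEigenvalue l τ p :=
  mul_nonneg (by positivity) (epsteinForm_nonneg p)

theorem finite_latticeEigenvalue_eq (hl : l ≠ 0) (hτ : 0 < τ.im) {μ : ℝ} (hμ : 0 < μ) :
    {p | latticeEigenvalue l τ p = μ}.Finite := by
  have hK : 0 < 4 * Real.pi ^ 2 / (‖l‖ ^ 2 * τ.im ^ 2) := by
    have := norm_pos_iff.2 hl
    positivity
  have hQ : 0 < μ / (4 * Real.pi ^ 2 / (‖l‖ ^ 2 * τ.im ^ 2)) := div_pos hμ hK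
  have h := (summable_epsteinForm_rpow (x := τ.re) hτ (σ := 2)
    one_lt_two).tendsto_cofinite_zero.eventually_lt_const (Real.rpow_pos_of_pos hQ (-2))
  refine (eventually_cofinite.1 h).subset fun p hp ↦ ?_
  have hp : latticeEigenvalue l τ p = μ := hp
  rw [mem_ofPred_eq, not_lt, ← hp, latticeEigenvalue, mul_div_cancel_left₀ _ hK.ne']

/-- An instance of the linear independence of characters of a monoid. -/
theorem linearIndependent_latticeChar (hl : l ≠ 0) (hτ : 0 < τ.im) :
    LinearIndependent ℂ (latticeChar l τ) := by
  let χ : ℤ × ℤ → Multiplicative ℂ →* ℂ := fun p ↦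
    { toFun := fun z ↦ latticeChar l τ p z.toAdd
      map_one' := latticeChar_zero p
      map_mul' := fun z w ↦ latticeChar_add p z.toAdd w.toAdd }
  have hχ : Function.Injective χ := by
    intro p q h
    have hpq : latticeChar l τ p = latticeChar l τ q := funext fun z ↦ DFunLike.congr_fun h
      (Multiplicative.ofAdd z)
    have hd : ∀ v, dualForm l τ p v = dualForm l τ q v := by
      intro v
      have h1 := fderiv_latticeChar (l := l) (τ := τ) p 0 v
      rw [hpq, fderiv_latticeChar, latticeChar_zero, mul_one, mul_one] at h1
      exact_mod_cast (mul_left_cancel₀ two_pi_I_ne_zero h1).symm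
    have h1 := hd l
    have h2 := hd (l * τ)
    rw [dualForm_left hl, dualForm_left hl, neg_inj] at h1
    rw [dualForm_right hl hτ, dualForm_right hl hτ] at h2
    exact Prod.ext (by exact_mod_cast h1) (by exact_mod_cast h2)
  exact (linearIndependent_monoidHom (Multiplicative ℂ) ℂ).comp χ hχ

/-- The Fourier coefficients of an eigenfunction vanish except at the finitely many characters with
the same eigenvalue. -/
theorem laplaceEigenspace_eq_span (hl : l ≠ 0) (hτ : 0 < τ.im) {μ : ℝ} (hμ : 0 < μ) :
    laplaceEigenspace (latticeSet l τ) μ = Submodule.span ℂ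
      (range fun p : {p // latticeEigenvalue l τ p = μ} ↦ latticeChar l τ p) := by
  apply le_antisymm
  · rintro f ⟨hc, hp, he⟩
    have hf : LatticePeriodic l τ f := latticePeriodic_iff.2 hp
    have hS : ∀ p ∉ (finite_latticeEigenvalue_eq hl hτ hμ).toFinset,
        latticeCoeff l τ p f = 0 := by
      intro p hp
      have h1 := hf.latticeCoeff_laplacian hl hτ hc p
      have h2 : (fun z ↦ Laplacian.laplacian f z) = fun z ↦ -(μ : ℂ) * f z :=
        funext fun z ↦ by linear_combination -(he z)
      have h3 : latticeCoeff l τ p (fun z ↦ -(μ : ℂ) * f z) =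
          -(μ : ℂ) * latticeCoeff l τ p f := by
        rw [latticeCoeff, latticeCoeff, latticeMean, latticeMean,
          ← MeasureTheory.integral_const_mul]
        simp only [torusLift, mul_left_comm]
      rw [h2, h3, ← sub_eq_zero, ← sub_mul, mul_eq_zero] at h1
      refine h1.resolve_left fun h ↦ hp ?_
      rw [Finite.mem_toFinset, mem_ofPred_eq]
      have : (latticeEigenvalue l τ p : ℂ) = μ := by linear_combination h
      exact_mod_cast this
    have h := funext fun z ↦ hf.eq_sum_latticeChar hl hτ hc.continuous hS z
    have h' : f = ∑ p ∈ (finite_latticeEigenvalue_eq hl hτ hμ).toFinset,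
        latticeCoeff l τ p f • latticeChar l τ p := by
      rw [h]
      ext z
      simp [← h]
    rw [h']
    refine Submodule.sum_mem _ fun p hp ↦ Submodule.smul_mem _ _ (Submodule.subset_span ?_)
    exact ⟨⟨p, by simpa using hp⟩, rfl⟩
  · rw [Submodule.span_le]
    rintro _ ⟨⟨p, rfl⟩, rfl⟩
    exact ⟨contDiff_latticeChar p, latticePeriodic_iff.1 (latticePeriodic_latticeChar hl hτ p),
      laplacian_latticeChar hτ p⟩

theorem finiteDimensional_laplaceEigenspace (hl : l ≠ 0) (hτ : 0 < τ.im) {μ : ℝ} (hμ : 0 < μ) :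
    FiniteDimensional ℂ (laplaceEigenspace (latticeSet l τ) μ) := by
  have : Finite {p // latticeEigenvalue l τ p = μ} := finite_latticeEigenvalue_eq hl hτ hμ
  rw [laplaceEigenspace_eq_span hl hτ hμ]
  exact FiniteDimensional.span_of_finite ℂ (finite_range _)

theorem finrank_laplaceEigenspace (hl : l ≠ 0) (hτ : 0 < τ.im) {μ : ℝ} (hμ : 0 < μ) :
    Module.finrank ℂ (laplaceEigenspace (latticeSet l τ) μ) =
      Nat.card {p // latticeEigenvalue l τ p = μ} := by
  have : Finite {p // latticeEigenvalue l τ p = μ} := finite_latticeEigenvalue_eq hl hτ hμ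
  have := Fintype.ofFinite {p // latticeEigenvalue l τ p = μ}
  rw [laplaceEigenspace_eq_span hl hτ hμ, finrank_span_eq_card, Nat.card_eq_fintype_card]
  exact (linearIndependent_latticeChar hl hτ).comp _ Subtype.val_injective

/-- The spectral zeta function of `ℂ / (ℤ l + ℤ l τ)`. -/
noncomputable def latticeZeta (l τ : ℂ) (s : ℂ) : ℂ :=
  ((4 * Real.pi ^ 2 / (‖l‖ ^ 2 * τ.im ^ 2) : ℝ) : ℂ) ^ (-s) * epsteinZeta τ.re τ.im s

/-- The sum over all characters is grouped by eigenvalue; the eigenvalue `0` contributes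
`0 ^ (-s) = 0`. -/
theorem hasSum_latticeZeta (hl : l ≠ 0) (hτ : 0 < τ.im) {s : ℂ} (hs : 1 < s.re) :
    HasSum (fun μ : Ioi (0 : ℝ) ↦
      (Module.finrank ℂ (laplaceEigenspace (latticeSet l τ) μ) : ℂ) * ((μ : ℝ) : ℂ) ^ (-s))
      (latticeZeta l τ s) := by
  have hs0 : s ≠ 0 := fun h ↦ by simp [h] at hs; linarith
  have h1 : HasSum (fun p ↦ (latticeEigenvalue l τ p : ℂ) ^ (-s)) (latticeZeta l τ s) := by
    refine ((hasSum_epsteinZeta (x := τ.re) hτ hs).mul_left _).congr_fun fun p ↦ ?_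
    rw [latticeEigenvalue, ofReal_mul, mul_cpow_ofReal_nonneg (by positivity)
      (epsteinForm_nonneg p)]
  have h2 := (Equiv.sigmaFiberEquiv (latticeEigenvalue l τ)).hasSum_iff.2 h1
  have h3 := h2.sigma (g := fun μ : ℝ ↦ if 0 < μ then
      (Module.finrank ℂ (laplaceEigenspace (latticeSet l τ) μ) : ℂ) * (μ : ℂ) ^ (-s) else 0) ?_
  · refine ((hasSum_subtype_iff_of_support_subset (s := Ioi (0 : ℝ)) ?_).2 h3).congr_fun
      fun μ ↦ ?_
    · intro μ hμ
      by_contra h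
      exact hμ (if_neg h)
    · exact (if_pos (mem_Ioi.1 μ.2)).symm
  · intro μ
    have e : ∀ c : {p // latticeEigenvalue l τ p = μ},
        ((fun p ↦ (latticeEigenvalue l τ p : ℂ) ^ (-s)) ∘
          (Equiv.sigmaFiberEquiv (latticeEigenvalue l τ))) ⟨μ, c⟩ = (μ : ℂ) ^ (-s) := by
      rintro ⟨p, rfl⟩
      rfl
    simp_rw [e]
    split_ifs with hμ
    · have : Finite {p // latticeEigenvalue l τ p = μ} := finite_latticeEigenvalue_eq hl hτ hμ
      have := Fintype.ofFinite {p // latticeEigenvalue l τ p = μ}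
      convert hasSum_fintype fun _ : {p // latticeEigenvalue l τ p = μ} ↦ (μ : ℂ) ^ (-s) using 1
      rw [finrank_laplaceEigenspace hl hτ hμ, Finset.sum_const, nsmul_eq_mul, Finset.card_univ,
        Nat.card_eq_fintype_card]
    · refine hasSum_zero.congr_fun fun ⟨p, hp⟩ ↦ ?_
      have h0 : μ = 0 := le_antisymm (not_lt.1 hμ) (hp ▸ latticeEigenvalue_nonneg p)
      rw [h0, ofReal_zero, zero_cpow (neg_ne_zero.2 hs0)]

theorem isSpectralZeta_latticeZeta (hl : l ≠ 0) (hτ : 0 < τ.im) :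
    IsSpectralZeta (latticeSet l τ) (latticeZeta l τ) := by
  have hK : ((4 * Real.pi ^ 2 / (‖l‖ ^ 2 * τ.im ^ 2) : ℝ) : ℂ) ≠ 0 := by
    have := norm_pos_iff.2 hl
    exact ofReal_ne_zero.2 (by positivity)
  have hd : Differentiable ℂ fun s : ℂ ↦
      ((4 * Real.pi ^ 2 / (‖l‖ ^ 2 * τ.im ^ 2) : ℝ) : ℂ) ^ (-s) :=
    fun s ↦ differentiableAt_id.neg.const_cpow (Or.inl hK)
  exact ⟨fun μ ↦ finiteDimensional_laplaceEigenspace hl hτ, fun s ↦ hasSum_latticeZeta hl hτ,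
    fun s _ ↦ (hd.analyticAt s).meromorphicAt.mul (meromorphicAt_epsteinZeta hτ s),
    (hd.analyticAt 0).mul (analyticAt_epsteinZeta_zero hτ)⟩

/-- Two spectral zeta functions of the same operator agree for `Re s > 1`, hence near `0` by
analytic continuation. -/
theorem IsSpectralZeta.eventuallyEq {Λ : Set ℂ} {Z W : ℂ → ℂ} (hZ : IsSpectralZeta Λ Z)
    (hW : IsSpectralZeta Λ W) : Z =ᶠ[𝓝 0] W := by
  have hm : MeromorphicOn (Z - W) univ := hZ.meromorphic.sub hW.meromorphic
  have h2 : meromorphicOrderAt (Z - W) 2 = ⊤ := by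
    rw [meromorphicOrderAt_eq_top_iff]
    have ho : {s : ℂ | 1 < s.re} ∈ 𝓝 (2 : ℂ) :=
      (isOpen_lt continuous_const continuous_re).mem_nhds (by simp)
    filter_upwards [mem_nhdsWithin_of_mem_nhds ho] with s hs
    exact sub_eq_zero.2 ((hZ.hasSum s hs).unique (hW.hasSum s hs))
  have h0 : meromorphicOrderAt (Z - W) 0 = ⊤ := by
    by_contra h
    exact (hm.exists_meromorphicOrderAt_ne_top_iff_forall isConnected_univ).1
      ⟨⟨0, mem_univ _⟩, h⟩ ⟨2, mem_univ _⟩ h2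
  rw [meromorphicOrderAt_eq_top_iff] at h0
  have h := (hZ.analyticAt_zero.sub hW.analyticAt_zero).frequently_zero_iff_eventually_zero.1
    h0.frequently
  exact h.mono fun s hs ↦ sub_eq_zero.1 hs

theorem IsSpectralZeta.regularizedDet_eq {Λ : Set ℂ} {Z : ℂ → ℂ} (hZ : IsSpectralZeta Λ Z) :
    regularizedDet Λ = Real.exp (-(deriv Z 0).re) := by
  have h : ∃ Z, IsSpectralZeta Λ Z := ⟨Z, hZ⟩
  rw [regularizedDet, dif_pos h, (h.choose_spec.eventuallyEq hZ).deriv_eq]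

/-- The zeta-regularized determinant of a flat torus, by Kronecker's limit formula: up to a
constant and harmonic functions of `τ`, `-½ log det'Δ` equals `-log (Im τ) - log |l|`. -/
theorem neg_half_log_regularizedDet (hl : l ≠ 0) (hτ : 0 < τ.im) :
    -(1 / 2) * Real.log (regularizedDet (latticeSet l τ)) =
      -Real.log τ.im - Real.log ‖l‖ + (Real.log (4 * Real.pi ^ 2) + kroneckerConst.re) / 2 +
        kroneckerCoeff.re / 2 * τ.im + (kroneckerLog τ).re := by
  have hln := norm_pos_iff.2 hl
  have hK : 0 < 4 * Real.pi ^ 2 / (‖l‖ ^ 2 * τ.im ^ 2) := by positivity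
  have h1 : HasDerivAt (fun s : ℂ ↦ ((4 * Real.pi ^ 2 / (‖l‖ ^ 2 * τ.im ^ 2) : ℝ) : ℂ) ^ (-s))
      (-(Real.log (4 * Real.pi ^ 2 / (‖l‖ ^ 2 * τ.im ^ 2)) : ℂ)) 0 := by
    have := (hasDerivAt_neg (0 : ℂ)).const_cpow (c :=
      ((4 * Real.pi ^ 2 / (‖l‖ ^ 2 * τ.im ^ 2) : ℝ) : ℂ)) (Or.inl (ofReal_ne_zero.2 hK.ne'))
    rw [← ofReal_log hK.le] at this
    simpa using this
  have h2 := h1.mul (hasDerivAt_epsteinZeta_zero (x := τ.re) hτ)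
  have h3 : deriv (latticeZeta l τ) 0 = _ := h2.deriv
  rw [(isSpectralZeta_latticeZeta hl hτ).regularizedDet_eq, Real.log_exp, h3, epsteinZeta_zero,
    Complex.re_add_im, neg_zero, cpow_zero]
  rw [Real.log_div (by positivity) (by positivity),
    Real.log_mul (x := ‖l‖ ^ 2) (by positivity) (by positivity), Real.log_pow ‖l‖ 2,
    Real.log_pow τ.im 2]
  simp only [one_mul, add_re, mul_re, ofReal_re, ofReal_im, mul_zero, sub_zero, neg_mul,
    mul_neg, mul_one, neg_neg, re_ofNat, im_ofNat]
  push_cast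
  ring

end Spectrum


/-! ### Conformal metrics on plane domains -/

section ConformalMetric

open Filter Set
open scoped Topology Laplacian

variable {ρ : ℂ → ℝ} {u : ℂ}

theorem partialDeriv_congr {i : Fin 2} {f g : ℂ → ℝ} (h : f =ᶠ[𝓝 u] g) :
    partialDeriv i f u = partialDeriv i g u := by
  rw [partialDeriv, partialDeriv, h.fderiv_eq]

theorem partialDeriv_neg {i : Fin 2} {f : ℂ → ℝ} :
    partialDeriv i (fun v ↦ -f v) u = -partialDeriv i f u := by
  rw [partialDeriv, partialDeriv, fderiv_fun_neg, neg_apply]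

theorem partialDeriv_zero {i : Fin 2} : partialDeriv i (fun _ ↦ 0) u = 0 := by
  simp [partialDeriv]

theorem laplacian_eq_sum_partialDeriv {f : ℂ → ℝ} (hf : ContDiffAt ℝ 2 f u) :
    Δ f u = ∑ i, partialDeriv i (partialDeriv i f) u := by
  rw [laplacian_eq_fderiv_fderiv hf, Fin.sum_univ_two]
  rfl

theorem inv_smul_one_apply (r : ℝ) (i j : Fin 2) :
    (r • (1 : Matrix (Fin 2) (Fin 2) ℝ))⁻¹ i j = if i = j then r⁻¹ else 0 := by
  rcases eq_or_ne r 0 with rfl | hr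
  · simp
  · have : (r • (1 : Matrix (Fin 2) (Fin 2) ℝ))⁻¹ = r⁻¹ • 1 :=
      Matrix.inv_eq_left_inv (by rw [smul_mul_smul_comm, one_mul, inv_mul_cancel₀ hr, one_smul])
    rw [this, Matrix.smul_apply, Matrix.one_apply]
    simp

/-- In dimension two the factors `√det g` and `g⁻¹` cancel under the outer derivative. -/
theorem laplaceBeltrami_smul_one (hρ : ∀ᶠ v in 𝓝 u, 0 < ρ v) {f : ℂ → ℝ}
    (hf : ContDiffAt ℝ 2 f u) :
    laplaceBeltrami (fun v ↦ ρ v • 1) f u = (ρ u)⁻¹ * Δ f u := by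
  have hdet : ∀ v, 0 < ρ v → √(ρ v • (1 : Matrix (Fin 2) (Fin 2) ℝ)).det = ρ v := fun v hv ↦ by
    simp [Real.sqrt_sq hv.le]
  rw [laplaceBeltrami, hdet u hρ.self_of_nhds, laplacian_eq_sum_partialDeriv hf, one_div]
  congr 1
  refine Finset.sum_congr rfl fun i _ ↦ partialDeriv_congr ?_
  filter_upwards [hρ] with v hv
  rw [hdet v hv]
  simp only [inv_smul_one_apply, ite_mul, zero_mul, Finset.sum_ite_eq, Finset.mem_univ, if_true]
  rw [mul_inv_cancel_left₀ hv.ne']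

/-- The Christoffel symbols of `e^{2φ} |du|²`, `φ = (log ρ) / 2`. -/
theorem christoffel_smul_one {v : ℂ} (hρ : 0 < ρ v) (hd : DifferentiableAt ℝ ρ v)
    (k i j : Fin 2) :
    christoffel (fun v ↦ ρ v • 1) k i j v =
      (if j = k then partialDeriv i (fun w ↦ Real.log (ρ w) / 2) v else 0) +
      (if i = k then partialDeriv j (fun w ↦ Real.log (ρ w) / 2) v else 0) -
      (if i = j then partialDeriv k (fun w ↦ Real.log (ρ w) / 2) v else 0) := by
  have hL : ∀ i, partialDeriv i (fun w ↦ Real.log (ρ w) / 2) v =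
      (ρ v)⁻¹ * partialDeriv i ρ v / 2 := by
    intro i
    have h := (hd.hasFDerivAt.log hρ.ne').mul_const (1 / 2)
    simp only [mul_one_div] at h
    rw [partialDeriv, h.fderiv, partialDeriv]
    simp only [smul_apply, smul_eq_mul]
    ring
  have hg : ∀ i j l : Fin 2, partialDeriv i
      (fun v ↦ (ρ v • (1 : Matrix (Fin 2) (Fin 2) ℝ)) j l) v =
      if j = l then partialDeriv i ρ v else 0 := by
    intro i j l
    simp only [Matrix.smul_apply, Matrix.one_apply, smul_eq_mul, mul_ite, mul_one, mul_zero]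
    split_ifs with h
    · rfl
    · exact partialDeriv_zero
  simp only [christoffel, hg, inv_smul_one_apply, hL, ite_mul, zero_mul, Finset.sum_ite_eq,
    Finset.mem_univ, if_true]
  split_ifs <;> ring

/-- Liouville's formula for the curvature of a conformal metric. -/
theorem scalarCurvature_smul_one (hρ : ∀ᶠ v in 𝓝 u, 0 < ρ v) (hd : ContDiffAt ℝ 2 ρ u) :
    scalarCurvature (fun v ↦ ρ v • 1) u = -((ρ u)⁻¹ * Δ (fun v ↦ Real.log (ρ v)) u) := by
  set φ : ℂ → ℝ := fun w ↦ Real.log (ρ w) / 2 with hφ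
  have hlog : ContDiffAt ℝ 2 (fun v ↦ Real.log (ρ v)) u := hd.log hρ.self_of_nhds.ne'
  have hφ2 : ContDiffAt ℝ 2 φ u := hlog.div_const 2
  have hΔ : Δ (fun v ↦ Real.log (ρ v)) u = 2 * Δ φ u := by
    have e : (fun v ↦ Real.log (ρ v)) = (2 : ℝ) • φ := by
      ext v
      simp [hφ]
      ring
    rw [e, InnerProductSpace.laplacian_smul _ hφ2, smul_eq_mul]
  have hC : ∀ k i j, christoffel (fun v ↦ ρ v • 1) k i j =ᶠ[𝓝 u] fun v ↦
      (if j = k then partialDeriv i φ v else 0) + (if i = k then partialDeriv j φ v else 0) -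
        (if i = j then partialDeriv k φ v else 0) := by
    intro k i j
    filter_upwards [hρ, hd.eventually (by simp)] with v hv hdv
    exact christoffel_smul_one hv (hdv.differentiableAt two_ne_zero) k i j
  rw [hΔ, laplacian_eq_sum_partialDeriv hφ2]
  simp only [scalarCurvature, ricci, inv_smul_one_apply, fun i k a b ↦ partialDeriv_congr
    (i := i) (hC k a b), fun k i j ↦ (hC k i j).self_of_nhds]
  simp only [Fin.sum_univ_two, Fin.isValue, if_true, zero_ne_one, one_ne_zero, if_false, add_zero,
    zero_add, sub_zero, zero_sub, partialDeriv_neg, add_sub_cancel_right, zero_mul]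
  ring

/-! ### Wirtinger derivatives and the Laplace operator -/

theorem fderiv_real_apply {f : ℂ → ℂ} (hf : DifferentiableAt ℂ f u) (v : ℂ) :
    fderiv ℝ f u v = deriv f u * v := by
  rw [hf.hasDerivAt.hasFDerivAt.restrictScalars ℝ |>.fderiv]
  simp [mul_comm]

theorem wirtinger_eq_deriv {f : ℂ → ℂ} (hf : DifferentiableAt ℂ f u) :
    wirtinger f u = deriv f u := by
  rw [wirtinger, fderiv_real_apply hf, fderiv_real_apply hf]
  linear_combination (-deriv f u / 2) * I_sq

theorem wirtinger_wirtingerBar {f : ℂ → ℂ} (hf : ContDiffAt ℝ 2 f u) :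
    wirtinger (wirtingerBar f) u = Δ f u / 4 := by
  have hd : DifferentiableAt ℝ (fderiv ℝ f) u :=
    (hf.fderiv_right (m := 1) (by norm_num)).differentiableAt one_ne_zero
  have h : ∀ v, HasFDerivAt (fun w ↦ fderiv ℝ f w v)
      ((ContinuousLinearMap.apply ℝ ℂ v).comp (fderiv ℝ (fderiv ℝ f) u)) u := fun v ↦
    (ContinuousLinearMap.apply ℝ ℂ v).hasFDerivAt.comp u hd.hasFDerivAt
  have hb : HasFDerivAt (wirtingerBar f) _ u :=
    ((h 1).add ((h I).const_mul I)).mul_const (2⁻¹ : ℂ)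
  have hsymm : fderiv ℝ (fderiv ℝ f) u 1 I = fderiv ℝ (fderiv ℝ f) u I 1 :=
    hf.isSymmSndFDerivAt (by simp) 1 I
  rw [wirtinger, hb.fderiv, laplacian_eq_fderiv_fderiv hf, (h 1).fderiv, (h I).fderiv]
  simp only [smul_apply, add_apply, ContinuousLinearMap.comp_apply,
    ContinuousLinearMap.apply_apply, smul_eq_mul, hsymm]
  linear_combination (-fderiv ℝ (fderiv ℝ f) u I I / 4) * I_sq

theorem coordDeriv_coordDerivBar {a f : ℂ → ℂ} (ha : AnalyticAt ℂ a u) (ha' : deriv a u ≠ 0)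
    (hf : ContDiffAt ℝ 2 f u) :
    coordDeriv a (coordDerivBar a f) u = Δ f u / (4 * ‖deriv a u‖ ^ 2 : ℝ) := by
  have hb : DifferentiableAt ℝ (wirtingerBar f) u := by
    have hd : DifferentiableAt ℝ (fderiv ℝ f) u :=
      (hf.fderiv_right (m := 1) (by norm_num)).differentiableAt one_ne_zero
    unfold wirtingerBar
    fun_prop
  have hg : DifferentiableAt ℂ (fun v ↦ (deriv a v)⁻¹) u :=
    ha.deriv.differentiableAt.inv ha'
  have hgc : HasFDerivAt (fun v ↦ (starRingEnd ℂ) (deriv a v)⁻¹)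
      (conjCLE.toContinuousLinearMap.comp (fderiv ℝ (fun v ↦ (deriv a v)⁻¹) u)) u :=
    conjCLE.toContinuousLinearMap.hasFDerivAt.comp u (hg.restrictScalars ℝ).hasFDerivAt
  have e : coordDerivBar a f = fun v ↦ wirtingerBar f v * (starRingEnd ℂ) (deriv a v)⁻¹ := by
    ext v
    rw [coordDerivBar, map_inv₀, div_eq_mul_inv]
  -- the factor `conj (1 / a')` is antiholomorphic, so `∂/∂u` does not see it
  have hw : wirtinger (fun v ↦ wirtingerBar f v * (starRingEnd ℂ) (deriv a v)⁻¹) u =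
      wirtinger (wirtingerBar f) u * (starRingEnd ℂ) (deriv a u)⁻¹ := by
    rw [wirtinger, (hb.hasFDerivAt.fun_mul hgc).fderiv, wirtinger]
    simp only [add_apply, smul_apply, ContinuousLinearMap.comp_apply, smul_eq_mul,
      ContinuousLinearEquiv.coe_coe, conjCLE_apply, fderiv_real_apply hg, map_mul, map_one, conj_I]
    linear_combination (wirtingerBar f u * (starRingEnd ℂ) (deriv (fun v ↦ (deriv a v)⁻¹) u) / 2) *
      I_sq
  have hn : (starRingEnd ℂ) (deriv a u) * deriv a u = (‖deriv a u‖ ^ 2 : ℝ) := by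
    rw [mul_comm, mul_conj, normSq_eq_norm_sq]
  rw [coordDeriv, e, hw, wirtinger_wirtingerBar hf, map_inv₀, ofReal_mul, ← hn]
  have hc : (starRingEnd ℂ) (deriv a u) ≠ 0 := by simpa using ha'
  push_cast
  field_simp

theorem laplacian_ofReal {f : ℂ → ℝ} (hf : ContDiffAt ℝ 2 f u) :
    Δ (fun v ↦ (f v : ℂ)) u = (Δ f u : ℂ) :=
  hf.laplacian_CLM_comp_left (l := ofRealCLM)

theorem contDiffAt_im {τ : ℂ → ℂ} (hτ : AnalyticAt ℂ τ u) {n : WithTop ℕ∞} :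
    ContDiffAt ℝ n (fun v ↦ (τ v).im) u :=
  imCLM.contDiff.contDiffAt.comp u (hτ.contDiffAt.restrict_scalars ℝ)

/-- The logarithm of `Im τ` has the Laplacian of the logarithm of the Poincaré density. -/
theorem laplacian_log_im {τ : ℂ → ℂ} (hτ : AnalyticAt ℂ τ u) (him : 0 < (τ u).im) :
    Δ (fun v ↦ Real.log (τ v).im) u = -(‖deriv τ u‖ ^ 2 / (τ u).im ^ 2) := by
  have hg : ContDiffAt ℝ 2 (fun v ↦ (τ v).im) u := contDiffAt_im hτ
  have hd : DifferentiableAt ℝ (fderiv ℝ fun v ↦ (τ v).im) u :=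
    (hg.fderiv_right (m := 1) (by norm_num)).differentiableAt one_ne_zero
  have hharm : Δ (fun v ↦ (τ v).im) u = 0 := hτ.harmonicAt_im.2.self_of_nhds
  rw [laplacian_eq_fderiv_fderiv hg] at hharm
  have hpos : ∀ᶠ v in 𝓝 u, 0 < (τ v).im := hg.continuousAt.eventually_const_lt him
  have h1 : ∀ w, fderiv ℝ (fun v ↦ (τ v).im) u w = (deriv τ u * w).im := by
    intro w
    rw [← fderiv_real_apply hτ.differentiableAt]
    have := imCLM.hasFDerivAt.comp u (hτ.differentiableAt.restrictScalars ℝ).hasFDerivAt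
    rw [HasFDerivAt.fderiv (f := fun v ↦ (τ v).im) this]
    rfl
  have h2 : ∀ w, fderiv ℝ (fun v ↦ fderiv ℝ (fun v ↦ Real.log (τ v).im) v w) u w =
      fderiv ℝ (fun v ↦ fderiv ℝ (fun v ↦ (τ v).im) v w) u w / (τ u).im -
        (deriv τ u * w).im ^ 2 / (τ u).im ^ 2 := by
    intro w
    have e : (fun v ↦ fderiv ℝ (fun v ↦ Real.log (τ v).im) v w) =ᶠ[𝓝 u]
        fun v ↦ (τ v).im⁻¹ * fderiv ℝ (fun v ↦ (τ v).im) v w := by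
      filter_upwards [hpos, hg.eventually (by simp)] with v hv hdv
      rw [((hdv.differentiableAt two_ne_zero).hasFDerivAt.log hv.ne').fderiv]
      rfl
    have hD : DifferentiableAt ℝ (fun v ↦ fderiv ℝ (fun v ↦ (τ v).im) v w) u :=
      hd.clm_apply (differentiableAt_const w)
    have hI := (hasDerivAt_inv him.ne').comp_hasFDerivAt u
      (hg.differentiableAt two_ne_zero).hasFDerivAt
    rw [e.fderiv_eq, (HasFDerivAt.fun_mul (c := fun v ↦ (τ v).im⁻¹) hI hD.hasFDerivAt).fderiv]
    simp only [add_apply, smul_apply, smul_eq_mul, h1]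
    field_simp
    ring
  have hn : ‖deriv τ u‖ ^ 2 = (deriv τ u).re ^ 2 + (deriv τ u).im ^ 2 := by
    rw [← normSq_eq_norm_sq, normSq_apply]
    ring
  rw [laplacian_eq_fderiv_fderiv (hg.log him.ne'), h2, h2, hn]
  simp only [mul_one, mul_im, I_re, I_im, mul_zero, add_zero]
  linear_combination (τ u).im⁻¹ * hharm

end ConformalMetric


/-! ### The area of a fibre -/

section Covolume

open MeasureTheory

theorem span_latticeSet {l τ : ℂ} (hl : l ≠ 0) (hτ : 0 < τ.im) :
    Submodule.span ℤ (latticeSet l τ) = (scaledPair l hl τ hτ).lattice := by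
  have h : latticeSet l τ = ((scaledPair l hl τ hτ).lattice : Set ℂ) := by
    ext z
    rw [SetLike.mem_coe, mem_scaledPair_lattice]
    exact ⟨fun ⟨n, hn⟩ ↦ ⟨n.1, n.2, hn⟩, fun ⟨m, n, h⟩ ↦ ⟨(m, n), h⟩⟩
  rw [h, Submodule.span_eq]

theorem covolume_latticeSet {l τ : ℂ} (hl : l ≠ 0) (hτ : 0 < τ.im) :
    ZLattice.covolume (Submodule.span ℤ (latticeSet l τ)) = ‖l‖ ^ 2 * τ.im := by
  set L := scaledPair l hl τ hτ with hL
  have hF : IsAddFundamentalDomain L.lattice (ZSpan.fundamentalDomain L.basis) volume := by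
    rw [L.lattice_eq_span_range_basis]
    exact ZSpan.isAddFundamentalDomain L.basis volume
  have h1 : volume.real (ZSpan.fundamentalDomain basisOneI) = 1 := by
    rw [measureReal_def, measure_congr (ZSpan.fundamentalDomain_ae_parallelepiped _ _),
      ← toBasis_orthonormalBasisOneI, OrthonormalBasis.coe_toBasis,
      OrthonormalBasis.volume_parallelepiped, ENNReal.toReal_one]
  rw [span_latticeSet hl hτ, ZLattice.covolume_eq_measure_fundamentalDomain _ _ hF,
    ZSpan.measureReal_fundamentalDomain _ _ basisOneI, h1, mul_one, Module.Basis.det_apply,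
    Matrix.det_fin_two]
  simp only [Module.Basis.toMatrix_apply, PeriodPair.basis_zero, PeriodPair.basis_one,
    coe_basisOneI_repr, Matrix.cons_val_zero, Matrix.cons_val_one, Matrix.cons_val_fin_one]
  have hn : ‖l‖ ^ 2 = l.re ^ 2 + l.im ^ 2 := by
    rw [← normSq_eq_norm_sq, normSq_apply]
    ring
  have e : L.ω₁.re * L.ω₂.im - L.ω₂.re * L.ω₁.im = ‖l‖ ^ 2 * τ.im := by
    rw [hn]
    simp only [hL, scaledPair, mul_re, mul_im]
    ring
  rw [e, abs_of_nonneg (by positivity)]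

end Covolume

/-! ### Special coordinates -/

section SpecialCharts

open Filter Set InnerProductSpace
open scoped Topology Laplacian

variable {Nf : ℕ} {C : SeibergWittenCurve Nf} {U : Set ℂ} {a aD : ℂ → ℂ} {u : ℂ}

theorem SeibergWittenCurve.isOpen_puncturedPlane (C : SeibergWittenCurve Nf) :
    IsOpen C.puncturedPlane :=
  isOpen_ne_fun (Polynomial.continuous _) continuous_const

/-- The functions `a` and `a_D` are primitives of half of the local periods. -/
theorem SeibergWittenCurve.exists_isSpecialChart (C : SeibergWittenCurve Nf)
    (hu : u ∈ C.puncturedPlane) :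
    ∃ (U : Set ℂ) (a aD : ℂ → ℂ), u ∈ U ∧ C.IsSpecialChart U a aD := by
  have hdisc : C.g₂.eval u ^ 3 - 27 * C.g₃.eval u ^ 2 ≠ 0 := by
    have hu : (C.g₂ ^ 3 - 27 * C.g₃ ^ 2).eval u ≠ 0 := hu
    simpa using hu
  obtain ⟨r, hr, l, τ, hl, hτ, h⟩ := exists_local_periods (A := fun u ↦ C.g₂.eval u)
    (B := fun u ↦ C.g₃.eval u) (u₀ := u)
    C.g₂.differentiable.contDiff C.g₃.differentiable.contDiff hdisc
  obtain ⟨a, ha⟩ := (hl.div_const 2).isExactOn_ball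
  obtain ⟨aD, haD⟩ := ((hl.mul hτ).div_const 2).isExactOn_ball
  have hda : ∀ v ∈ Metric.ball u r, 2 * deriv a v = l v := fun v hv ↦ by
    rw [(ha v hv).deriv]
    ring
  have hdaD : ∀ v ∈ Metric.ball u r, 2 * deriv aD v = l v * τ v := fun v hv ↦ by
    rw [(haD v hv).deriv]
    simp only [Pi.mul_apply]
    ring
  refine ⟨Metric.ball u r ∩ C.puncturedPlane, a, aD, ⟨Metric.mem_ball_self hr, hu⟩,
    Metric.isOpen_ball.inter C.isOpen_puncturedPlane, inter_subset_right,
    fun v hv ↦ (ha v hv.1).differentiableAt.differentiableWithinAt,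
    fun v hv ↦ (haD v hv.1).differentiableAt.differentiableWithinAt, fun v hv ↦ ?_, fun v hv ↦ ?_⟩
  · rw [hda v hv.1, hdaD v hv.1]
    exact (h v hv.1).2.2
  · have e : deriv aD v / deriv a v = τ v := by
      rw [← mul_div_mul_left _ _ (two_ne_zero (α := ℂ)), hda v hv.1, hdaD v hv.1,
        mul_div_cancel_left₀ _ (h v hv.1).1]
    rw [e]
    exact (h v hv.1).2.1

namespace SeibergWittenCurve.IsSpecialChart

theorem deriv_ne_zero (h : C.IsSpecialChart U a aD) (hu : u ∈ U) : deriv a u ≠ 0 := by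
  intro h0
  have := h.im_pos u hu
  simp [h0] at this

theorem modularParameter_im_pos (h : C.IsSpecialChart U a aD) (hu : u ∈ U) :
    0 < (modularParameter a aD u).im :=
  h.im_pos u hu

theorem analyticAt_a (h : C.IsSpecialChart U a aD) (hu : u ∈ U) : AnalyticAt ℂ a u :=
  h.differentiableOn_a.analyticAt (h.isOpen.mem_nhds hu)

theorem analyticAt_modularParameter (h : C.IsSpecialChart U a aD) (hu : u ∈ U) :
    AnalyticAt ℂ (modularParameter a aD) u :=
  (h.differentiableOn_aD.analyticAt (h.isOpen.mem_nhds hu)).deriv.div (h.analyticAt_a hu).deriv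
    (h.deriv_ne_zero hu)

theorem periods_eq_latticeSet (h : C.IsSpecialChart U a aD) (hu : u ∈ U) :
    C.periods u = latticeSet (2 * deriv a u) (modularParameter a aD u) := by
  have e : 2 * deriv a u * modularParameter a aD u = 2 * deriv aD u := by
    rw [modularParameter, mul_assoc, mul_div_cancel₀ _ (h.deriv_ne_zero hu)]
  rw [h.periods_eq u hu, latticeSet, e]

theorem kaehlerDensity_eq (h : C.IsSpecialChart U a aD) (hu : u ∈ U) :
    C.kaehlerDensity u = 8 * (modularParameter a aD u).im * ‖deriv a u‖ ^ 2 := by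
  have ha := h.deriv_ne_zero hu
  rw [kaehlerDensity, fibreArea, h.periods_eq_latticeSet hu,
    covolume_latticeSet (mul_ne_zero two_ne_zero ha) (h.modularParameter_im_pos hu), norm_mul,
    Complex.norm_two]
  ring

theorem kaehlerDensity_pos (h : C.IsSpecialChart U a aD) (hu : u ∈ U) :
    0 < C.kaehlerDensity u := by
  have h1 := norm_pos_iff.2 (h.deriv_ne_zero hu)
  have h2 := h.modularParameter_im_pos hu
  rw [h.kaehlerDensity_eq hu]
  positivity

theorem harmonicAt_log_norm_deriv (h : C.IsSpecialChart U a aD) (hu : u ∈ U) :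
    HarmonicAt (fun v ↦ Real.log ‖deriv a v‖) u :=
  (h.analyticAt_a hu).deriv.harmonicAt_log_norm (h.deriv_ne_zero hu)

/-- In special coordinates `F⁽¹⁾` is `-log (Im τ)` plus a harmonic function. -/
theorem exists_harmonicAt_F1 (h : C.IsSpecialChart U a aD) (hu : u ∈ U) :
    ∃ G : ℂ → ℝ, HarmonicAt G u ∧
      C.F1 =ᶠ[𝓝 u] (fun v ↦ G v - Real.log (modularParameter a aD v).im) := by
  have hτ := h.analyticAt_modularParameter hu
  have hΦ : AnalyticAt ℂ (fun v ↦ kroneckerLog (modularParameter a aD v)) u :=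
    (differentiableOn_kroneckerLog.analyticAt ((isOpen_lt continuous_const continuous_im).mem_nhds
      (h.modularParameter_im_pos hu))).comp hτ
  refine ⟨_, ((((harmonicAt_const (-Real.log 2 + (Real.log (4 * Real.pi ^ 2) +
    kroneckerConst.re) / 2)).add (h.harmonicAt_log_norm_deriv hu).neg).add
    (hτ.harmonicAt_im.const_smul (c := kroneckerCoeff.re / 2))).add hΦ.harmonicAt_re), ?_⟩
  filter_upwards [h.isOpen.mem_nhds hu] with v hv
  have ha := h.deriv_ne_zero hv
  rw [F1, h.periods_eq_latticeSet hv, neg_half_log_regularizedDet (mul_ne_zero two_ne_zero ha)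
    (h.modularParameter_im_pos hv), norm_mul, Complex.norm_two,
    Real.log_mul two_ne_zero (norm_ne_zero_iff.2 ha)]
  simp only [Pi.add_apply, Pi.neg_apply, Pi.smul_apply, smul_eq_mul]
  ring

theorem contDiffAt_log_im (h : C.IsSpecialChart U a aD) (hu : u ∈ U) {n : WithTop ℕ∞} :
    ContDiffAt ℝ n (fun v ↦ Real.log (modularParameter a aD v).im) u :=
  (contDiffAt_im (h.analyticAt_modularParameter hu)).log (h.modularParameter_im_pos hu).ne'

theorem contDiffAt_F1 (h : C.IsSpecialChart U a aD) (hu : u ∈ U) {n : WithTop ℕ∞} :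
    ContDiffAt ℝ n C.F1 u := by
  obtain ⟨G, hG, e⟩ := h.exists_harmonicAt_F1 hu
  exact (((HarmonicAt.analyticAt hG).contDiffAt).sub (h.contDiffAt_log_im hu)).congr_of_eventuallyEq e

/-- Only the term `-log (Im τ)` contributes. -/
theorem laplacian_F1 (h : C.IsSpecialChart U a aD) (hu : u ∈ U) :
    Δ C.F1 u = ‖deriv (modularParameter a aD) u‖ ^ 2 / (modularParameter a aD u).im ^ 2 := by
  obtain ⟨G, hG, e⟩ := h.exists_harmonicAt_F1 hu
  have hs := hG.1.laplacian_sub (h.contDiffAt_log_im hu)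
  rw [(laplacian_congr_nhds e).self_of_nhds]
  refine hs.trans ?_
  rw [hG.2.self_of_nhds, laplacian_log_im (h.analyticAt_modularParameter hu)
    (h.modularParameter_im_pos hu)]
  simp

theorem eventually_metric_pos (h : C.IsSpecialChart U a aD) (hu : u ∈ U) {c : ℝ} (hc : 0 < c) :
    ∀ᶠ v in 𝓝 u, 0 < c * C.kaehlerDensity v := by
  filter_upwards [h.isOpen.mem_nhds hu] with v hv
  exact mul_pos hc (h.kaehlerDensity_pos hv)

theorem laplaceBeltrami_eq (h : C.IsSpecialChart U a aD) (hu : u ∈ U) {c : ℝ} (hc : 0 < c)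
    {f : ℂ → ℝ} (hf : ContDiffAt ℝ 2 f u) :
    laplaceBeltrami (C.kaehlerMetric c) f u =
      Δ f u / (8 * c * (modularParameter a aD u).im * ‖deriv a u‖ ^ 2) := by
  have := laplaceBeltrami_smul_one (h.eventually_metric_pos hu hc) hf
  rw [h.kaehlerDensity_eq hu] at this
  refine this.trans ?_
  rw [div_eq_inv_mul]
  ring_nf

/-- The logarithm of the density is `log (Im τ)` up to the harmonic function
`log (8c) + 2 log |da/du|`. -/
theorem scalarCurvature_eq (h : C.IsSpecialChart U a aD) (hu : u ∈ U) {c : ℝ} (hc : 0 < c) :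
    scalarCurvature (C.kaehlerMetric c) u =
      ‖deriv (modularParameter a aD) u‖ ^ 2 / (modularParameter a aD u).im ^ 2 /
        (8 * c * (modularParameter a aD u).im * ‖deriv a u‖ ^ 2) := by
  have hτ := h.analyticAt_modularParameter hu
  have ha := (h.analyticAt_a hu).deriv
  have e : (fun v ↦ c * C.kaehlerDensity v) =ᶠ[𝓝 u]
      fun v ↦ c * (8 * (modularParameter a aD v).im * ‖deriv a v‖ ^ 2) := by
    filter_upwards [h.isOpen.mem_nhds hu] with v hv
    rw [h.kaehlerDensity_eq hv]
  have hd : ContDiffAt ℝ 2 (fun v ↦ c * C.kaehlerDensity v) u :=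
    (contDiffAt_const.mul ((contDiffAt_const.mul (contDiffAt_im hτ)).mul
      ((ha.contDiffAt.restrict_scalars ℝ).norm_sq ℝ))).congr_of_eventuallyEq e
  have hharm : HarmonicAt ((fun _ ↦ Real.log (8 * c)) +
      (2 : ℝ) • fun v ↦ Real.log ‖deriv a v‖) u :=
    (harmonicAt_const _).add (h.harmonicAt_log_norm_deriv hu).const_smul
  have hlog : (fun v ↦ Real.log (c * C.kaehlerDensity v)) =ᶠ[𝓝 u]
      ((fun _ ↦ Real.log (8 * c)) + (2 : ℝ) • fun v ↦ Real.log ‖deriv a v‖) +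
        fun v ↦ Real.log (modularParameter a aD v).im := by
    filter_upwards [h.isOpen.mem_nhds hu] with v hv
    have h1 := norm_pos_iff.2 (h.deriv_ne_zero hv)
    have h2 := h.modularParameter_im_pos hv
    rw [h.kaehlerDensity_eq hv, show c * (8 * (modularParameter a aD v).im * ‖deriv a v‖ ^ 2) =
      8 * c * ‖deriv a v‖ ^ 2 * (modularParameter a aD v).im by ring,
      Real.log_mul (by positivity) h2.ne', Real.log_mul (x := 8 * c) (by positivity)
      (by positivity), Real.log_pow ‖deriv a v‖ 2]
    simp
  have hS := scalarCurvature_smul_one (h.eventually_metric_pos hu hc) hd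
  rw [(laplacian_congr_nhds hlog).self_of_nhds, hharm.1.laplacian_add (h.contDiffAt_log_im hu),
    hharm.2.self_of_nhds, laplacian_log_im hτ (h.modularParameter_im_pos hu),
    h.kaehlerDensity_eq hu] at hS
  refine hS.trans ?_
  simp only [Pi.zero_apply, zero_add, mul_neg, neg_neg]
  rw [div_eq_inv_mul _ (8 * c * _ * _)]
  ring_nf

theorem coordDeriv_modularParameter (h : C.IsSpecialChart U a aD) (hu : u ∈ U) :
    coordDeriv a (modularParameter a aD) u =
      deriv (modularParameter a aD) u / deriv a u := by
  rw [coordDeriv, wirtinger_eq_deriv (h.analyticAt_modularParameter hu).differentiableAt]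

theorem coordDeriv_coordDerivBar_ofReal (h : C.IsSpecialChart U a aD) (hu : u ∈ U) {f : ℂ → ℝ}
    (hf : ContDiffAt ℝ 2 f u) :
    coordDeriv a (coordDerivBar a fun v ↦ (f v : ℂ)) u =
      ((Δ f u / (4 * ‖deriv a u‖ ^ 2) : ℝ) : ℂ) := by
  have hfc : ContDiffAt ℝ 2 (fun v ↦ (f v : ℂ)) u := ofRealCLM.contDiff.contDiffAt.comp u hf
  rw [coordDeriv_coordDerivBar (h.analyticAt_a hu) (h.deriv_ne_zero hu) hfc, laplacian_ofReal hf]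
  push_cast
  rfl

end SeibergWittenCurve.IsSpecialChart

end SpecialCharts

/-- The one-loop amplitude `F⁽¹⁾ = -½ log det'Δ` is a well-defined smooth function on the punctured
`u`-plane and satisfies `Δ_UP F⁽¹⁾ = S`, for every normalization `c` of the metric of `Ω`. The other
clauses give the Kähler form `Ω`, the Laplace-Beltrami operator `Δ_UP` (which is
`(1 / Im τ) ∂_a ∂_ā` for `c = 1/2`), the scalar curvature `S` and the resulting anomaly equation in
special coordinates, which exist locally. -/
theorem mainTheorem1 (Nf : ℕ) (C : SeibergWittenCurve Nf) :
    (∀ u ∈ C.puncturedPlane, ∃ Z, IsSpectralZeta (C.periods u) Z) ∧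
    ContDiffOn ℝ ∞ C.F1 C.puncturedPlane ∧
    (∀ c : ℝ, 0 < c → ∀ u ∈ C.puncturedPlane,
      laplaceBeltrami (C.kaehlerMetric c) C.F1 u = scalarCurvature (C.kaehlerMetric c) u) ∧
    (∀ u ∈ C.puncturedPlane, ∃ (U : Set ℂ) (a aD : ℂ → ℂ), u ∈ U ∧ C.IsSpecialChart U a aD) ∧
    (∀ (U : Set ℂ) (a aD : ℂ → ℂ), C.IsSpecialChart U a aD → ∀ u ∈ U,
      C.kaehlerDensity u = 8 * (modularParameter a aD u).im * ‖deriv a u‖ ^ 2 ∧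
      (∀ c : ℝ, 0 < c → ∀ f : ℂ → ℝ, ContDiffOn ℝ 2 f U →
        (laplaceBeltrami (C.kaehlerMetric c) f u : ℂ) =
          1 / (2 * (c : ℂ) * ((modularParameter a aD u).im : ℂ)) *
            coordDeriv a (coordDerivBar a (fun v ↦ (f v : ℂ))) u) ∧
      (∀ c : ℝ, 0 < c → scalarCurvature (C.kaehlerMetric c) u =
        ‖coordDeriv a (modularParameter a aD) u‖ ^ 2 /
          (8 * c * (modularParameter a aD u).im ^ 3)) ∧
      coordDeriv a (coordDerivBar a (fun v ↦ (C.F1 v : ℂ))) u =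
        ((‖coordDeriv a (modularParameter a aD) u‖ ^ 2 /
          (4 * (modularParameter a aD u).im ^ 2) : ℝ) : ℂ)) := by
  refine ⟨fun u hu ↦ ?_, fun u hu ↦ ?_, fun c hc u hu ↦ ?_, fun u hu ↦ C.exists_isSpecialChart hu,
    fun U a aD h u hu ↦ ⟨h.kaehlerDensity_eq hu, fun c hc f hf ↦ ?_, fun c hc ↦ ?_, ?_⟩⟩
  · obtain ⟨U, a, aD, huU, h⟩ := C.exists_isSpecialChart hu
    rw [h.periods_eq_latticeSet huU]
    exact ⟨_, isSpectralZeta_latticeZeta (mul_ne_zero two_ne_zero (h.deriv_ne_zero huU))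
      (h.modularParameter_im_pos huU)⟩
  · obtain ⟨U, a, aD, huU, h⟩ := C.exists_isSpecialChart hu
    exact (h.contDiffAt_F1 huU).contDiffWithinAt
  · obtain ⟨U, a, aD, huU, h⟩ := C.exists_isSpecialChart hu
    rw [h.laplaceBeltrami_eq huU hc (h.contDiffAt_F1 huU), h.scalarCurvature_eq huU hc,
      h.laplacian_F1 huU]
  · have hf' := hf.contDiffAt (h.isOpen.mem_nhds hu)
    have h1 : (deriv a u) ≠ 0 := h.deriv_ne_zero hu
    have h2 := (h.modularParameter_im_pos hu).ne'
    rw [h.laplaceBeltrami_eq hu hc hf', h.coordDeriv_coordDerivBar_ofReal hu hf']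
    norm_cast
    have h3 : ‖deriv a u‖ ≠ 0 := norm_ne_zero_iff.2 h1
    field_simp
    ring
  · rw [h.scalarCurvature_eq hu hc, h.coordDeriv_modularParameter hu, norm_div, div_pow]
    have h2 := (h.modularParameter_im_pos hu).ne'
    have h3 : ‖deriv a u‖ ≠ 0 := norm_ne_zero_iff.2 (h.deriv_ne_zero hu)
    field_simp
  · rw [h.coordDeriv_coordDerivBar_ofReal hu (h.contDiffAt_F1 hu), h.laplacian_F1 hu,
      h.coordDeriv_modularParameter hu, norm_div, div_pow]
    congr 1
    have h2 := (h.modularParameter_im_pos hu).ne'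
    have h3 : ‖deriv a u‖ ≠ 0 := norm_ne_zero_iff.2 (h.deriv_ne_zero hu)
    field_simp
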